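/- Let $d\ge 1$ be an integer, let $1<p<\infty$, let $X=L^p(\mathbb{R}^d)$ (complex valued) and let $A=(-\Delta)^{1/2}$ on $X$, the closed operator with Fourier symbol $|\xi|$. More generally, for a function $m:[0,\infty)\to\mathbb{C}$ let $m(A)$ be the closure in $X$ of the operator $f\mapsto \mathcal{F}^{-1}[m(|\cdot|)\hat f\,]$, defined on those $f\in L^2(\mathbb{R}^d)\cap X$ whose image lies in $L^2(\mathbb{R}^d)\cap X$. For bounded operators $\tau\subset B(X)$, let $\gamma(\tau)\in[0,\infty]$ be the smallest constant $C$ such that $$\Big(\mathbb{E}\big\|\sum_k\gamma_kT_kx_k\big\|^2\Big)^{1/2}\le C\Big(\mathbb{E}\big\|\sum_k\gamma_kx_k\big\|^2\Big)^{1/2}$$ for all finite families $T_1,\dots,T_n\in\tau$ (not necessarily distinct) and $x_1,\dots,x_n\in X$, where $\gamma_1,\gamma_2,\dots$ are independent standard Gaussian variables ($\gamma(\tau)=\infty$ if there is no such $C$). (1) The operators $\exp(-zA)$, $\operatorname{Re}z>0$, are bounded on $X$. They form an analytic semigroup on the right half plane, strongly continuous at $0$ along $(0,\infty)$, with generator $-A$,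 and are given by the (absolutely convergent) Poisson integral $$\exp(-zA)f(x)=\frac{\Gamma(\frac{d+1}{2})}{\pi^{\frac{d+1}{2}}}\int_{\mathbb{R}^d}\frac{z}{(z^2+|x-y|^2)^{\frac{d+1}{2}}}f(y)\,dy\quad\text{for almost every }x .$$ (2) For every $\alpha>\frac{d-1}{2}$ there is a constant $C$, depending only on $d,p,\alpha$, such that for all $t>0$ and all real $\theta$ with $|\theta|<\frac{\pi}{2}$ $$\gamma\big(\{\exp(-e^{i\theta}t2^kA): k\in\mathbb{Z}\}\big)\le C\Big(\frac{\pi}{2}-|\theta|\Big)^{-\alpha}.$$ (3) For every $\alpha>\frac{d-1}{2}$ the operators $(1+2^kA)^{-\alpha}e^{it2^kA}$, $k\in\mathbb{Z}$, $t\in\mathbb{R}$, are bounded on $X$, and there is a constant $C$, depending only on $d,p,\alpha$, such that for all $t\in\mathbb{R}$ $$\gamma\big(\{(1+2^kA)^{-\alpha}e^{it2^kA}: k\in\mathbb{Z}\}\big)\le C(1+|t|)^{\alpha}.$$ In particular, for every $\alpha>\frac{d-1}{2}$ there are $\beta\ge\alpha$ and $C$ such that the operators $(1+2^kA)^{-\beta}e^{it2^kA}$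 are bounded on $X$ and $\gamma(\{(1+2^kA)^{-\beta}e^{it2^kA}: k\in\mathbb{Z}\})\le C(1+|t|)^\alpha$ for all $t\in\mathbb{R}$. -/

import Mathlib

open MeasureTheory ProbabilityTheory Filter Topology FourierTransform
open scoped ENNReal NNReal

noncomputable section

/-! ### Gaussian sums and `γ`-boundedness -/

section GammaBounded

variable {X : Type*} [NormedAddCommGroup X] [NormedSpace ℂ X]

/-- `(𝔼 ‖∑ k, γ_k x_k‖ ^ 2) ^ (1 / 2)` for independent real standard Gaussian variables
`γ_k`, realised as the coordinates of `ℝⁿ` with the standard Gaussian product measure. -/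
def gaussNorm {n : ℕ} (x : Fin n → X) : ℝ :=
  Real.sqrt (∫ ω : Fin n → ℝ, ‖∑ k, (ω k : ℂ) • x k‖ ^ 2
    ∂(Measure.pi fun _ : Fin n => gaussianReal 0 1))

/-- The set `τ` of bounded operators is `γ`-bounded with constant `C`. The operators
`T 0, …, T (n - 1)` need not be distinct. -/
def IsGammaBoundedWith (τ : Set (X →L[ℂ] X)) (C : ℝ≥0) : Prop :=
  ∀ (n : ℕ) (T : Fin n → X →L[ℂ] X) (x : Fin n → X), (∀ k, T k ∈ τ) →
    gaussNorm (fun k => T k (x k)) ≤ C * gaussNorm x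

/-- The `γ`-bound `γ(τ)`: the smallest admissible constant, and `∞` if `τ` is not
`γ`-bounded. -/
def gammaBound (τ : Set (X →L[ℂ] X)) : ℝ≥0∞ :=
  ⨅ (C : ℝ≥0) (_ : IsGammaBoundedWith τ C), (C : ℝ≥0∞)

end GammaBounded

/-! ### The operator `A = (-Δ)^{1/2}` on `L^p(ℝ^d)` and functions of it -/

/-- The complex space `L^p(ℝ^d)`. -/
abbrev LpSpace (d : ℕ) (p : ℝ≥0∞) : Type :=
  Lp ℂ p (volume : Measure (EuclideanSpace ℝ (Fin d)))

/-- The pairs `(f, g)` in `L^p × L^p` with `f, g ∈ L²` and `ĝ(ξ) = m(2π|ξ|) f̂(ξ)`, that is,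
`g = m(A) f` in the sense of the spectral calculus of `A = (-Δ)^{1/2}` on `L²`.
The Fourier transform is `f̂(ξ) = ∫ e^{-2πi⟨x,ξ⟩} f(x) dx`, extended to `L²`, so that `-Δ` has
the symbol `(2π|ξ|)²` and `A` has the symbol `2π|ξ|`. -/
def preSpectralGraph (d : ℕ) (p : ℝ≥0∞) [Fact (1 ≤ p)] (m : ℝ → ℂ) :
    Submodule ℂ (LpSpace d p × LpSpace d p) where
  carrier := {q | ∃ u v : LpSpace d 2, u =ᵐ[volume] q.1 ∧ v =ᵐ[volume] q.2 ∧
    (𝓕 v : LpSpace d 2) =ᵐ[volume] fun ξ => m (2 * Real.pi * ‖ξ‖) * (𝓕 u : LpSpace d 2) ξ}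
  zero_mem' := by
    have h0 : 𝓕 (0 : LpSpace d 2) = 0 := map_zero (Lp.fourierTransformₗᵢ _ ℂ)
    refine ⟨0, 0, ?_, ?_, ?_⟩
    · exact (Lp.coeFn_zero ..).trans (Lp.coeFn_zero ..).symm
    · exact (Lp.coeFn_zero ..).trans (Lp.coeFn_zero ..).symm
    · rw [h0]
      filter_upwards [] with ξ
      simp
  add_mem' := by
    rintro ⟨f, g⟩ ⟨f', g'⟩ ⟨u, v, h1, h2, h3⟩ ⟨u', v', h1', h2', h3'⟩
    refine ⟨u + u', v + v', ?_, ?_, ?_⟩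
    · exact (Lp.coeFn_add ..).trans ((h1.add h1').trans (Lp.coeFn_add ..).symm)
    · exact (Lp.coeFn_add ..).trans ((h2.add h2').trans (Lp.coeFn_add ..).symm)
    · rw [FourierTransform.fourier_add, FourierTransform.fourier_add]
      filter_upwards [Lp.coeFn_add (𝓕 u) (𝓕 u'), Lp.coeFn_add (𝓕 v) (𝓕 v'), h3, h3']
        with ξ e1 e2 e3 e4
      rw [e1, e2, Pi.add_apply, Pi.add_apply, e3, e4, mul_add]
  smul_mem' := by
    rintro c ⟨f, g⟩ ⟨u, v, h1, h2, h3⟩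
    refine ⟨c • u, c • v, ?_, ?_, ?_⟩
    · exact (Lp.coeFn_smul ..).trans ((h1.const_smul c).trans (Lp.coeFn_smul ..).symm)
    · exact (Lp.coeFn_smul ..).trans ((h2.const_smul c).trans (Lp.coeFn_smul ..).symm)
    · rw [FourierTransform.fourier_smul, FourierTransform.fourier_smul]
      filter_upwards [Lp.coeFn_smul c (𝓕 u), Lp.coeFn_smul c (𝓕 v), h3] with ξ e1 e2 e3
      rw [e1, e2, Pi.smul_apply, Pi.smul_apply, e3, smul_eq_mul, smul_eq_mul]
      ring

/-- The graph of the closed operator `m(A)` on `L^p(ℝ^d)`. -/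
def spectralGraph (d : ℕ) (p : ℝ≥0∞) [Fact (1 ≤ p)] (m : ℝ → ℂ) :
    Submodule ℂ (LpSpace d p × LpSpace d p) :=
  (preSpectralGraph d p m).topologicalClosure

/-- The unbounded operator `A = (-Δ)^{1/2}` on `L^p(ℝ^d)`. -/
def sqrtLaplacian (d : ℕ) (p : ℝ≥0∞) [Fact (1 ≤ p)] : LpSpace d p →ₗ.[ℂ] LpSpace d p :=
  (spectralGraph d p fun s => (s : ℂ)).toLinearPMap

/-- The everywhere defined bounded operator `T` equals `m(A)`. -/
def IsFunctionOfSqrtLaplacian {d : ℕ} {p : ℝ≥0∞} [Fact (1 ≤ p)] (m : ℝ → ℂ)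
    (T : LpSpace d p →L[ℂ] LpSpace d p) : Prop :=
  LinearMap.graph (T : LpSpace d p →ₗ[ℂ] LpSpace d p) = spectralGraph d p m

open Classical in
/-- The operator `m(A)` on `L^p(ℝ^d)` when it is everywhere defined and bounded (and `0`
otherwise). -/
def functionOfSqrtLaplacian (d : ℕ) (p : ℝ≥0∞) [Fact (1 ≤ p)] (m : ℝ → ℂ) :
    LpSpace d p →L[ℂ] LpSpace d p :=
  if h : ∃ T : LpSpace d p →L[ℂ] LpSpace d p, IsFunctionOfSqrtLaplacian m T
  then h.choose else 0

/-- The function `s ↦ e^{-zs}`. -/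
def expSymbol (z : ℂ) : ℝ → ℂ := fun s => Complex.exp (-z * s)

/-- The Poisson semigroup `exp(-zA)` on `L^p(ℝ^d)`. -/
def poissonSemigroup (d : ℕ) (p : ℝ≥0∞) [Fact (1 ≤ p)] (z : ℂ) :
    LpSpace d p →L[ℂ] LpSpace d p :=
  functionOfSqrtLaplacian d p (expSymbol z)

/-- The function `s ↦ (1 + rs)^{-β} e^{itrs}`. -/
def waveSymbol (β t r : ℝ) : ℝ → ℂ := fun s =>
  (((1 + r * s) ^ (-β) : ℝ) : ℂ) * Complex.exp (Complex.I * ((t * (r * s) : ℝ) : ℂ))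

/-- The regularised wave operator `(1 + rA)^{-β} e^{itrA}` on `L^p(ℝ^d)`. -/
def waveOperator (d : ℕ) (p : ℝ≥0∞) [Fact (1 ≤ p)] (β t r : ℝ) :
    LpSpace d p →L[ℂ] LpSpace d p :=
  functionOfSqrtLaplacian d p (waveSymbol β t r)

/-- There is a constant `C` with
`γ({(1 + 2^k A)^{-β} e^{it2^k A} : k ∈ ℤ}) ≤ C (1 + |t|)^α` for all real `t`, the operators
being everywhere defined and bounded. -/
def WaveGammaCondition (d : ℕ) (p : ℝ≥0∞) [Fact (1 ≤ p)] (β α : ℝ) : Prop :=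
  (∀ (t : ℝ) (k : ℤ),
    IsFunctionOfSqrtLaplacian (waveSymbol β t (2 ^ k)) (waveOperator d p β t (2 ^ k))) ∧
  ∃ C : ℝ, ∀ t : ℝ,
    gammaBound {T : LpSpace d p →L[ℂ] LpSpace d p | ∃ k : ℤ, T = waveOperator d p β t (2 ^ k)} ≤
      ENNReal.ofReal (C * (1 + |t|) ^ α)

/-- The kernel `c_d z (z² + |x|²)^{-(d+1)/2}`, `c_d = Γ((d+1)/2) / π^{(d+1)/2}`, of
`exp(-zA)`, with the principal branch of the power. -/
def halfSpacePoissonKernel (d : ℕ) (z : ℂ) (x : EuclideanSpace ℝ (Fin d)) : ℂ :=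
  ((Real.Gamma (((d : ℝ) + 1) / 2) / Real.pi ^ (((d : ℝ) + 1) / 2) : ℝ) : ℂ) *
    (z / (z ^ 2 + ((‖x‖ ^ 2 : ℝ) : ℂ)) ^ (((d : ℂ) + 1) / 2))

end

noncomputable section

/-! ### Convolution operators on `L^p(ℝ^d)` -/

section Convolution

set_option linter.unusedSectionVars false

/-! Everything rests on the explicit kernel `P_z(x) = c_d z (z² + |x|²)^{-(d+1)/2}` of `exp(-zA)`.
Since `|z² + r²|² = ((r + |Im z|)² + (Re z)²)((r - |Im z|)² + (Re z)²)`, the kernel at `|z| = 1` is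
large only in a shell of width about `Re z` around the sphere `|x| = |Im z|`. Integrating over that
shell gives `‖P_z‖₁ ≤ C (|z| / Re z)^α` for each `α > (d-1)/2`; this is where the exponent comes
from.

On `L^p` Gaussian norms are equivalent to square functions (`exists_gaussNorm_equiv`), so a
`γ`-bound for the dyadic family `exp(-2^k z A)` is a bound for a diagonal convolution operator on
`L^p(ℓ²_n)`, uniform in `n`. On `L²` this operator is a contraction because the symbols are bounded
by 1. The Hörmander integrals of the dilates of `P_z` decay geometrically away from the scale `2^k
|z| ≈ |h|`, so their sum over `k` is again at most `C (|z| / Re z)^α`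
(`exists_sum_poissonHormander_le`). The Calderón–Zygmund theorem for operator valued kernels, with a
constant linear in the hypotheses (`lintegral_enorm_opConv_rpow_le`), gives `1 < p < 2`; the kernels
are even, and duality (`norm_diagConv_le_of_conj`) gives `p > 2`. For `z = e^{iθ} t` the ratio `|z|
/ Re z` is `1 / cos θ`, comparable with `(π/2 - |θ|)⁻¹`.

The wave operators are Gamma averages of the semigroup, `(1 + rA)^{-α} e^{itrA} = Γ(α)⁻¹ ∫_0^∞
u^{α-1} e^{-u} exp(-r(u - it)A) du`. Here `|u - it| / u ≤ (1 + |t|)(1 + u)/u`. The square function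
bound with an exponent `β` strictly between `(d-1)/2` and `α` makes the integral converge at `u =
0`.

That `P_z` has the right Fourier transform follows for real `z` by subordination to Gaussians, and
for complex `z` by analytic continuation (`fourier_poissonSymbol`). Identities between symbols are
proved on `L²` and carried to `L^p` by density. The generator is identified through the kernel of
`∫_0^t exp(-sA) ds`, whose symbol multiplied by `λ` is `1 - e^{-tλ}`. -/

instance fact_one_ne_top : Fact ((1 : ℝ≥0∞) ≠ ∞) := ⟨ENNReal.one_ne_top⟩
instance fact_two_ne_top : Fact ((2 : ℝ≥0∞) ≠ ∞) := ⟨ENNReal.ofNat_ne_top⟩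

variable {d : ℕ} {p : ℝ≥0∞} [Fact (1 ≤ p)]

/-- Translation by `y` on `L^p(ℝ^d)`. -/
def translateLp (p : ℝ≥0∞) [Fact (1 ≤ p)] (y : EuclideanSpace ℝ (Fin d)) :
    LpSpace d p →ₗᵢ[ℂ] LpSpace d p :=
  Lp.compMeasurePreservingₗᵢ ℂ (fun x => x - y) (measurePreserving_sub_right volume y)

lemma translateLp_ae (y : EuclideanSpace ℝ (Fin d)) (f : LpSpace d p) :
    translateLp p y f =ᵐ[volume] fun x => f (x - y) :=
  Lp.coeFn_compMeasurePreserving f (measurePreserving_sub_right volume y)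

lemma translateLp_zero (f : LpSpace d p) : translateLp p 0 f = f := by
  refine Lp.ext ((translateLp_ae 0 f).trans ?_)
  simp

variable [hp : Fact (p ≠ ∞)]

lemma continuous_translateLp (f : LpSpace d p) :
    Continuous fun y => translateLp p y f := by
  let g : C(EuclideanSpace ℝ (Fin d), C(EuclideanSpace ℝ (Fin d), EuclideanSpace ℝ (Fin d))) :=
    (ContinuousMap.mk (fun a : EuclideanSpace ℝ (Fin d) × EuclideanSpace ℝ (Fin d) => a.2 - a.1)
      (by fun_prop)).curry
  exact Continuous.compMeasurePreservingLp (f := fun _ => f) (g := fun y => g y) continuous_const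
    g.continuous (fun y => measurePreserving_sub_right volume y) hp.out

lemma integrable_smul_translateLp {K : EuclideanSpace ℝ (Fin d) → ℂ} (hK : Integrable K)
    (f : LpSpace d p) : Integrable fun y => K y • translateLp p y f := by
  refine Integrable.mono' (hK.norm.mul_const ‖f‖)
    (hK.aestronglyMeasurable.smul (continuous_translateLp f).aestronglyMeasurable) ?_
  filter_upwards with y
  rw [norm_smul, (translateLp p y).norm_map]

/-- Convolution with an integrable function, as a bounded bilinear map
`L¹ × L^p → L^p`. -/
def convLp (d : ℕ) (p : ℝ≥0∞) [Fact (1 ≤ p)] [Fact (p ≠ ∞)] :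
    LpSpace d 1 →L[ℂ] LpSpace d p →L[ℂ] LpSpace d p :=
  -- A Bochner integral of translates has norm at most `‖K‖₁ ‖f‖` without any exchange of integrals.
  -- Linearity and boundedness in `K` let holomorphy and parameter integrals pass from kernels to
  -- operators.
  LinearMap.mkContinuous₂
    (LinearMap.mk₂ ℂ (fun (K : LpSpace d 1) (f : LpSpace d p) => ∫ y, K y • translateLp p y f)
      (fun K K' f => by
        rw [← integral_add (integrable_smul_translateLp (L1.integrable_coeFn K) f)
          (integrable_smul_translateLp (L1.integrable_coeFn K') f)]
        refine integral_congr_ae ?_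
        filter_upwards [Lp.coeFn_add K K'] with y hy
        rw [hy, Pi.add_apply, add_smul])
      (fun c K f => by
        rw [← integral_smul]
        refine integral_congr_ae ?_
        filter_upwards [Lp.coeFn_smul c K] with y hy
        rw [hy, Pi.smul_apply, smul_assoc])
      (fun K f f' => by
        rw [← integral_add (integrable_smul_translateLp (L1.integrable_coeFn K) f)
          (integrable_smul_translateLp (L1.integrable_coeFn K) f')]
        simp_rw [map_add, smul_add])
      (fun c K f => by
        rw [← integral_smul]
        simp_rw [map_smul, smul_comm c])) 1
    (fun K f => by
      rw [one_mul, LinearMap.mk₂_apply, L1.norm_eq_integral_norm, ← integral_mul_const]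
      refine (norm_integral_le_integral_norm _).trans_eq ?_
      simp_rw [norm_smul, (translateLp p _).norm_map])

lemma convLp_apply (K : LpSpace d 1) (f : LpSpace d p) :
    convLp d p K f = ∫ y, K y • translateLp p y f := rfl

section Pairing

variable {q : ℝ≥0∞} [Fact (1 ≤ q)] [ENNReal.HolderConjugate p q]

/-- The bilinear pairing `∫ f g` of `L^p` and `L^q`. -/
abbrev pairLp (d : ℕ) (p q : ℝ≥0∞) [Fact (1 ≤ p)] [Fact (1 ≤ q)] [ENNReal.HolderConjugate p q] :
    LpSpace d p →L[ℂ] LpSpace d q →L[ℂ] ℂ :=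
  ContinuousLinearMap.lpPairing volume p q (ContinuousLinearMap.mul ℂ ℂ)

lemma pairLp_apply (f : LpSpace d p) (g : LpSpace d q) :
    pairLp d p q f g = ∫ x, f x * g x :=
  ContinuousLinearMap.lpPairing_eq_integral ..

lemma pairLp_translateLp (y : EuclideanSpace ℝ (Fin d)) (f : LpSpace d p) (g : LpSpace d q) :
    pairLp d p q (translateLp p y f) g = ∫ x, f (x - y) * g x := by
  rw [pairLp_apply]
  refine integral_congr_ae ?_
  filter_upwards [translateLp_ae y f] with x hx
  rw [hx]

lemma pairLp_convLp (K : LpSpace d 1) (f : LpSpace d p) (g : LpSpace d q) :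
    pairLp d p q (convLp d p K f) g = ∫ y, K y * ∫ x, f (x - y) * g x := by
  have h := ((pairLp d p q).flip g).integral_comp_comm
    (integrable_smul_translateLp (L1.integrable_coeFn K) f)
  rw [convLp_apply]
  refine Eq.trans h.symm ?_
  congr 1
  ext y
  rw [map_smul, ContinuousLinearMap.flip_apply, pairLp_translateLp, smul_eq_mul]

/-- The reflection `y ↦ -y` followed by the shift `x ↦ x - y` exchanges the two functions, so an
even kernel gives an operator that is its own transpose. -/
lemma pairLp_convLp_comm [Fact (q ≠ ∞)] (K : LpSpace d 1)
    (hK : ∀ᵐ x, K (-x) = K x) (f : LpSpace d p) (g : LpSpace d q) :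
    ∫ x, convLp d p K f x * g x = ∫ x, f x * convLp d q K g x := by
  have : ENNReal.HolderConjugate q p := ENNReal.HolderConjugate.symm
  rw [← pairLp_apply, pairLp_convLp]
  have h2 : ∫ x, f x * convLp d q K g x = pairLp d q p (convLp d q K g) f := by
    rw [pairLp_apply]; simp_rw [mul_comm]
  rw [h2, pairLp_convLp, ← integral_neg_eq_self]
  refine integral_congr_ae ?_
  filter_upwards [hK] with y hy
  rw [hy, ← integral_sub_right_eq_self _ y]
  congr 2
  ext x
  rw [sub_neg_eq_add, sub_add_cancel, mul_comm]

end Pairing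

lemma integrableOn_of_Lp (f : LpSpace d p) {s : Set (EuclideanSpace ℝ (Fin d))}
    (hs' : volume s < ∞) : IntegrableOn f s := by
  have : IsFiniteMeasure (volume.restrict s) := ⟨by simpa using hs'⟩
  exact ((Lp.memLp f).restrict s).integrable Fact.out

lemma aestronglyMeasurable_sub_prod {f : EuclideanSpace ℝ (Fin d) → ℂ}
    (hf : AEStronglyMeasurable f volume) :
    AEStronglyMeasurable (fun z : EuclideanSpace ℝ (Fin d) × EuclideanSpace ℝ (Fin d) =>
      f (z.1 - z.2)) (volume.prod volume) :=
  hf.comp_quasiMeasurePreserving (quasiMeasurePreserving_sub volume volume)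

/-- The restriction to a set of finite measure is needed because `f` is only in `L^p`; there the
`L¹` norms of all translates of `f` are bounded together. -/
lemma integrable_conv_prod {K : EuclideanSpace ℝ (Fin d) → ℂ} (hK : Integrable K)
    (f : LpSpace d p) {s : Set (EuclideanSpace ℝ (Fin d))} 
    (hs' : volume s < ∞) :
    Integrable (fun z : EuclideanSpace ℝ (Fin d) × EuclideanSpace ℝ (Fin d) =>
      K z.2 * f (z.1 - z.2)) ((volume.restrict s).prod volume) := by
  have hm : AEStronglyMeasurable (fun z : EuclideanSpace ℝ (Fin d) × EuclideanSpace ℝ (Fin d) =>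
      K z.2 * f (z.1 - z.2)) ((volume.restrict s).prod volume) := by
    refine AEStronglyMeasurable.mono_ac
      (Measure.AbsolutelyContinuous.prod Measure.restrict_le_self.absolutelyContinuous
        Measure.AbsolutelyContinuous.rfl) ?_
    exact hK.aestronglyMeasurable.comp_snd.mul
      (aestronglyMeasurable_sub_prod (Lp.aestronglyMeasurable f))
  have : IsFiniteMeasure (volume.restrict s) := ⟨by simpa using hs'⟩
  rw [integrable_prod_iff' hm]
  constructor
  · filter_upwards with y
    refine Integrable.const_mul ?_ _
    exact (integrableOn_of_Lp (translateLp p y f) hs').congr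
      (ae_restrict_of_ae (translateLp_ae y f))
  -- The constant is Hölder's factor `|s|^{1 - 1/p}` times `‖f‖`, independent of `y` by translation
  -- invariance.
  · obtain ⟨C, hC⟩ : ∃ C : ℝ, ∀ y, ∫ x in s, ‖f (x - y)‖ ≤ C := by
      refine ⟨(volume.real s) ^ (1 - 1 / p.toReal) * ‖f‖, fun y => ?_⟩
      have h1 : ∫ x in s, ‖f (x - y)‖ = (eLpNorm (translateLp p y f) 1 (volume.restrict s)).toReal := by
        rw [eLpNorm_one_eq_lintegral_enorm, ← integral_norm_eq_lintegral_enorm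
          (Lp.aestronglyMeasurable _).restrict]
        refine integral_congr_ae (ae_restrict_of_ae ?_)
        filter_upwards [translateLp_ae y f] with x hx
        rw [hx]
      rw [h1]
      have h2 := eLpNorm_le_eLpNorm_mul_rpow_measure_univ (μ := volume.restrict s) (p := 1) (q := p)
        Fact.out ((Lp.aestronglyMeasurable (translateLp p y f)).restrict)
      have h3 : eLpNorm (translateLp p y f) p (volume.restrict s) ≤ ENNReal.ofReal ‖f‖ := by
        refine (eLpNorm_restrict_le _ _ _ _).trans_eq ?_
        rw [← (translateLp p y).norm_map f, Lp.norm_def, ENNReal.ofReal_toReal (Lp.eLpNorm_ne_top _)]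
      have hp1 : 1 / p.toReal ≤ 1 := by
        rw [div_le_one₀ (ENNReal.toReal_pos (zero_lt_one.trans_le Fact.out).ne' hp.out)]
        exact (ENNReal.toReal_mono hp.out (Fact.out : 1 ≤ p))
      rw [Measure.restrict_apply_univ] at h2
      refine ENNReal.toReal_le_of_le_ofReal (by positivity) (h2.trans ?_)
      rw [mul_comm, ENNReal.ofReal_mul (by positivity)]
      gcongr
      rw [← ENNReal.ofReal_rpow_of_nonneg measureReal_nonneg (by linarith), measureReal_def,
        ENNReal.ofReal_toReal hs'.ne]
      simp
    refine Integrable.mono' (hK.norm.mul_const C) hm.norm.prod_swap.integral_prod_right' ?_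
    filter_upwards with y
    simp_rw [norm_mul, integral_const_mul, norm_mul, norm_norm]
    gcongr
    rw [Real.norm_of_nonneg (integral_nonneg fun _ => norm_nonneg _)]
    exact hC y

/-- Integrals over sets of finite measure are pairings with indicators, which lie in the conjugate
space; they turn the Bochner integral into a scalar one, and Fubini compares the two sides. -/
lemma convLp_ae' (K : LpSpace d 1) (f : LpSpace d p) :
    convLp d p K f =ᵐ[volume] fun x => ∫ y, K y * f (x - y) := by
  refine ae_eq_of_forall_setIntegral_eq_of_sigmaFinite (fun s _ hs' => integrableOn_of_Lp _ hs')
    (fun s _ hs' => (integrable_conv_prod (L1.integrable_coeFn K) f hs').integral_prod_left)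
    (fun s hs hs' => ?_)
  have : ENNReal.HolderConjugate p p.conjExponent := ENNReal.HolderConjugate.conjExponent Fact.out
  have : Fact (1 ≤ p.conjExponent) := ⟨ENNReal.HolderConjugate.one_le p.conjExponent p⟩
  rw [integral_integral_swap (integrable_conv_prod (L1.integrable_coeFn K) f hs')]
  have h1 : ∀ h : EuclideanSpace ℝ (Fin d) → ℂ, ∫ x in s, h x =
      ∫ x, h x * (indicatorConstLp p.conjExponent hs hs'.ne (1 : ℂ)) x := by
    intro h
    rw [← integral_indicator hs]
    refine integral_congr_ae ?_
    filter_upwards [indicatorConstLp_coeFn (p := p.conjExponent) (hs := hs) (hμs := hs'.ne)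
      (c := (1 : ℂ))] with x hx
    rw [hx]
    by_cases hxs : x ∈ s <;> simp [hxs]
  rw [h1, ← pairLp_apply, pairLp_convLp]
  congr 1
  ext y
  rw [← h1, integral_const_mul]

lemma convLp_ae (K : LpSpace d 1) (f : LpSpace d p) :
    convLp d p K f =ᵐ[volume] fun x => ∫ y, K (x - y) * f y := by
  refine (convLp_ae' K f).trans (Eventually.of_forall fun x => ?_)
  change ∫ y, K y * f (x - y) = ∫ y, K (x - y) * f y
  rw [← integral_sub_left_eq_self _ volume x]
  simp

end Convolution

/-! ### Fourier multipliers given by integrable kernels -/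

section Multiplier

set_option linter.unusedSectionVars false

variable {d : ℕ}

lemma integrable_schwartz_mul_Lp {p : ℝ≥0∞} [Fact (1 ≤ p)] (f : LpSpace d p)
    (φ : SchwartzMap (EuclideanSpace ℝ (Fin d)) ℂ) : Integrable fun x => φ x * f x := by
  have : ENNReal.HolderConjugate p.conjExponent p :=
    (ENNReal.HolderConjugate.conjExponent Fact.out).symm
  exact (Lp.memLp f).integrable_mul (φ.memLp p.conjExponent volume) |>.congr
    (Eventually.of_forall fun x => mul_comm _ _)

/-- The `L²` Fourier transform is determined by its pairing with Schwartz functions. -/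
lemma integral_schwartz_mul_fourier (u : LpSpace d 2)
    (φ : SchwartzMap (EuclideanSpace ℝ (Fin d)) ℂ) :
    ∫ x, φ x * (𝓕 u : LpSpace d 2) x = ∫ x, (𝓕 φ) x * u x := by
  have h := Lp.fourier_toTemperedDistribution_eq u
  have h2 := congrArg (fun T : TemperedDistribution (EuclideanSpace ℝ (Fin d)) ℂ => T φ) h
  simp only [TemperedDistribution.fourier_apply, Lp.toTemperedDistribution_apply,
    smul_eq_mul] at h2
  exact h2.symm

lemma ae_eq_of_integral_schwartz_mul_eq {f g : EuclideanSpace ℝ (Fin d) → ℂ}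
    (hf : LocallyIntegrable f) (hg : LocallyIntegrable g)
    (h : ∀ φ : SchwartzMap (EuclideanSpace ℝ (Fin d)) ℂ, ∫ x, φ x * f x = ∫ x, φ x * g x) :
    f =ᵐ[volume] g := by
  refine ae_eq_of_integral_contDiff_smul_eq hf hg fun φ hφ hc => ?_
  have hφ' : ContDiff ℝ (⊤ : ℕ∞) (fun x => (φ x : ℂ)) := Complex.ofRealCLM.contDiff.comp hφ
  have hc' : HasCompactSupport (fun x => (φ x : ℂ)) :=
    hc.comp_left (g := fun r : ℝ => (r : ℂ)) Complex.ofReal_zero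
  exact h (hc'.toSchwartzMap hφ')

lemma fourier_continuous_of_integrable {f : EuclideanSpace ℝ (Fin d) → ℂ} (hf : Integrable f) :
    Continuous (𝓕 f) :=
  VectorFourier.fourierIntegral_continuous Real.continuous_fourierChar continuous_inner hf

lemma norm_fourier_le_integral_norm (f : EuclideanSpace ℝ (Fin d) → ℂ)
    (ξ : EuclideanSpace ℝ (Fin d)) : ‖𝓕 f ξ‖ ≤ ∫ x, ‖f x‖ :=
  VectorFourier.norm_fourierIntegral_le_integral_norm ..

lemma integral_schwartz_mul_convLp (K : LpSpace d 1) (u : LpSpace d 2)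
    (ψ : SchwartzMap (EuclideanSpace ℝ (Fin d)) ℂ) :
    ∫ x, ψ x * convLp d 2 K u x = ∫ y, K y * ∫ x, ψ x * translateLp 2 y u x := by
  have : ENNReal.HolderConjugate 2 2 := inferInstance
  have h1 : ∀ v : LpSpace d 2, ∫ x, ψ x * v x = pairLp d 2 2 v (ψ.toLp 2) := by
    intro v
    rw [pairLp_apply]
    refine integral_congr_ae ?_
    filter_upwards [ψ.coeFn_toLp 2 volume] with x hx
    rw [hx, mul_comm]
  simp_rw [h1]
  rw [pairLp_convLp]
  simp_rw [pairLp_translateLp]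

/-- Translation turns into modulation. -/
lemma integral_schwartz_mul_fourier_translate (u : LpSpace d 2) (y : EuclideanSpace ℝ (Fin d))
    (ψ : SchwartzMap (EuclideanSpace ℝ (Fin d)) ℂ) :
    ∫ x, (𝓕 ψ) x * translateLp 2 y u x =
      ∫ ξ, Real.fourierChar (-(inner ℝ y ξ)) * (ψ ξ * (𝓕 u : LpSpace d 2) ξ) := by
  -- This is `ψ` times a character. Written as the inverse transform of a translate of `𝓕 ψ`, it is
  -- a Schwartz function by construction.
  set φ : SchwartzMap (EuclideanSpace ℝ (Fin d)) ℂ :=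
    𝓕⁻ ((𝓕 ψ).compSubConstCLM ℂ (-y)) with hφ
  have h1 : ∀ ξ, φ ξ = Real.fourierChar (-(inner ℝ y ξ)) * ψ ξ := by
    intro ξ
    rw [hφ, SchwartzMap.fourierInv_coe, Real.fourierInv_eq, ← integral_sub_right_eq_self _ y]
    have h2 : ψ ξ = 𝓕⁻ (𝓕 ψ) ξ := by rw [FourierTransform.fourierInv_fourier_eq]
    rw [h2, SchwartzMap.fourierInv_coe, Real.fourierInv_eq, ← integral_const_mul]
    congr 1
    ext v
    simp only [Circle.smul_def, smul_eq_mul, SchwartzMap.compSubConstCLM_apply]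
    rw [sub_neg_eq_add, sub_add_cancel, inner_sub_left, sub_eq_neg_add, AddChar.map_add_eq_mul,
      Circle.coe_mul, mul_assoc]
  have h3 := integral_schwartz_mul_fourier u φ
  simp_rw [h1, mul_assoc] at h3
  rw [h3, hφ, FourierTransform.fourier_fourierInv_eq,
    ← integral_sub_right_eq_self (fun x => (SchwartzMap.compSubConstCLM ℂ (-y) (𝓕 ψ)) x * u x) y]
  refine integral_congr_ae ?_
  filter_upwards [translateLp_ae y u] with x hx
  rw [hx, SchwartzMap.compSubConstCLM_apply, sub_neg_eq_add, sub_add_cancel]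

/-- Tested against a Schwartz function, the convolution is an integral of translates of `u`. Each
translate becomes a modulation of `𝓕 u`, and Fubini collects the characters into the Fourier
integral of `K`. -/
lemma fourier_convLp (K : LpSpace d 1) (u : LpSpace d 2) :
    (𝓕 (convLp d 2 K u) : LpSpace d 2) =ᵐ[volume]
      fun ξ => 𝓕 (K : EuclideanSpace ℝ (Fin d) → ℂ) ξ * (𝓕 u : LpSpace d 2) ξ := by
  have hK := L1.integrable_coeFn K
  have hu : LocallyIntegrable (𝓕 u : LpSpace d 2) := (Lp.memLp _).locallyIntegrable one_le_two
  refine ae_eq_of_integral_schwartz_mul_eq ((Lp.memLp _).locallyIntegrable one_le_two) ?_ ?_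
  · exact (locallyIntegrableOn_univ.1 ((locallyIntegrableOn_univ.2 hu).continuousOn_mul
      (fourier_continuous_of_integrable hK).continuousOn isOpen_univ.isLocallyClosed))
  intro ψ
  rw [integral_schwartz_mul_fourier, integral_schwartz_mul_convLp]
  simp_rw [integral_schwartz_mul_fourier_translate, ← integral_const_mul]
  have hψ := integrable_schwartz_mul_Lp (𝓕 u : LpSpace d 2) ψ
  rw [integral_integral_swap]
  · congr 1
    ext ξ
    rw [Real.fourier_eq, mul_left_comm, ← integral_mul_const]
    congr 1
    ext y
    rw [Circle.smul_def, smul_eq_mul]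
    ring
  · refine ((hK.norm.mul_prod hψ.norm)).mono' ?_ ?_
    · refine hK.aestronglyMeasurable.comp_fst.mul (AEStronglyMeasurable.mul ?_
        hψ.aestronglyMeasurable.comp_snd)
      refine Continuous.aestronglyMeasurable ?_
      fun_prop
    · filter_upwards with z
      simp only [Function.uncurry, norm_mul, Circle.norm_coe, one_mul, le_refl]

section Function

variable {p : ℝ≥0∞} [Fact (1 ≤ p)] [hp : Fact (p ≠ ∞)]

/-- The pointwise formula does not see the exponent. Through this consistency, identities found on
`L²` by Fourier transform reach `L^p`. -/
lemma convLp_congr {q : ℝ≥0∞} [Fact (1 ≤ q)] [Fact (q ≠ ∞)] (K : LpSpace d 1) {f : LpSpace d p}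
    {u : LpSpace d q} (h : u =ᵐ[volume] f) : convLp d q K u =ᵐ[volume] convLp d p K f := by
  refine (convLp_ae K u).trans (EventuallyEq.trans (Eventually.of_forall fun x => ?_)
    (convLp_ae K f).symm)
  refine integral_congr_ae ?_
  filter_upwards [h] with y hy
  rw [hy]

/-- `L^p ∩ L²` is dense in `L^p`. -/
lemma dense_inter_Lp_two : Dense {f : LpSpace d p | ∃ u : LpSpace d 2, u =ᵐ[volume] f} := by
  intro f
  rw [Metric.mem_closure_iff]
  intro ε hε
  obtain ⟨g, hg1, hg2, hg3, hg4⟩ := (Lp.memLp f).exists_hasCompactSupport_eLpNorm_sub_le hp.out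
    (ε := ENNReal.ofReal (ε / 2)) (by simpa using hε)
  refine ⟨hg4.toLp g, ⟨(hg3.memLp_of_hasCompactSupport hg1).toLp g, ?_⟩, ?_⟩
  · exact (MemLp.coeFn_toLp _).trans (MemLp.coeFn_toLp _).symm
  · rw [Lp.dist_def]
    refine (ENNReal.toReal_le_of_le_ofReal (by positivity) ?_).trans_lt (half_lt_self hε)
    refine (eLpNorm_congr_ae ?_).trans_le hg2
    filter_upwards [hg4.coeFn_toLp] with x hx
    simp [hx]

lemma mem_preSpectralGraph_convLp {m : ℝ → ℂ} (K : LpSpace d 1)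
    (hK : ∀ ξ, 𝓕 (K : EuclideanSpace ℝ (Fin d) → ℂ) ξ = m (2 * Real.pi * ‖ξ‖))
    {f : LpSpace d p} {u : LpSpace d 2} (h : u =ᵐ[volume] f) :
    (f, convLp d p K f) ∈ preSpectralGraph d p m := by
  refine ⟨u, convLp d 2 K u, h, convLp_congr K h, ?_⟩
  filter_upwards [fourier_convLp K u] with ξ hξ
  rw [hξ, hK]

lemma eq_of_fourier_ae_eq {u v : LpSpace d 2}
    (h : (𝓕 u : LpSpace d 2) =ᵐ[volume] (𝓕 v : LpSpace d 2)) : u = v :=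
  (Lp.fourierTransformₗᵢ (EuclideanSpace ℝ (Fin d)) ℂ).injective (Lp.ext h)

/-- Density of `L^p ∩ L²` and boundedness put the graph of the convolution inside the closure.
Conversely a bounded operator has a closed graph, and it contains every pair of the pre-graph
because the `L²` Fourier transform is injective. -/
theorem isFunctionOfSqrtLaplacian_convLp {m : ℝ → ℂ} (K : LpSpace d 1)
    (hK : ∀ ξ, 𝓕 (K : EuclideanSpace ℝ (Fin d) → ℂ) ξ = m (2 * Real.pi * ‖ξ‖)) :
    IsFunctionOfSqrtLaplacian m (convLp d p K) := by
  refine le_antisymm ?_ ?_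
  · rintro ⟨f, g⟩ hg
    obtain rfl : g = convLp d p K f := by simpa [LinearMap.mem_graph_iff] using hg
    have hd := dense_inter_Lp_two (d := d) (p := p) f
    have hc : Continuous fun f : LpSpace d p => (f, convLp d p K f) := by fun_prop
    refine closure_mono ?_ (map_mem_closure (f := fun f : LpSpace d p => (f, convLp d p K f)) hc hd
      fun f hf => Set.mem_image_of_mem _ hf)
    rintro _ ⟨f, ⟨u, hu⟩, rfl⟩
    exact mem_preSpectralGraph_convLp K hK hu
  · refine Submodule.topologicalClosure_minimal _ ?_ ?_
    · rintro ⟨f, g⟩ ⟨u, v, h1, h2, h3⟩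
      rw [LinearMap.mem_graph_iff]
      have hv : v = convLp d 2 K u := by
        refine eq_of_fourier_ae_eq ?_
        filter_upwards [h3, fourier_convLp K u] with ξ e1 e2
        rw [e1, e2, hK]
      refine Lp.ext (h2.symm.trans ?_)
      rw [hv]
      exact convLp_congr K h1
    · have : ((LinearMap.graph (convLp d p K : LpSpace d p →ₗ[ℂ] LpSpace d p) :
          Submodule ℂ (LpSpace d p × LpSpace d p)) : Set (LpSpace d p × LpSpace d p)) =
          {q | q.2 = convLp d p K q.1} := by
        ext q; simp [LinearMap.mem_graph_iff]
      rw [this]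
      exact isClosed_eq continuous_snd (by fun_prop)

lemma IsFunctionOfSqrtLaplacian.unique {m : ℝ → ℂ} {S T : LpSpace d p →L[ℂ] LpSpace d p}
    (hS : IsFunctionOfSqrtLaplacian m S) (hT : IsFunctionOfSqrtLaplacian m T) : S = T := by
  have h : LinearMap.graph (S : LpSpace d p →ₗ[ℂ] LpSpace d p) =
    LinearMap.graph (T : LpSpace d p →ₗ[ℂ] LpSpace d p) := hS.trans hT.symm
  ext1 f
  have h1 : (f, S f) ∈ LinearMap.graph (T : LpSpace d p →ₗ[ℂ] LpSpace d p) := by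
    rw [← h]; simp [LinearMap.mem_graph_iff]
  simpa [LinearMap.mem_graph_iff] using h1

lemma IsFunctionOfSqrtLaplacian.functionOf_eq {m : ℝ → ℂ} {T : LpSpace d p →L[ℂ] LpSpace d p}
    (hT : IsFunctionOfSqrtLaplacian m T) : functionOfSqrtLaplacian d p m = T := by
  have h : ∃ T : LpSpace d p →L[ℂ] LpSpace d p, IsFunctionOfSqrtLaplacian m T := ⟨T, hT⟩
  rw [functionOfSqrtLaplacian, dif_pos h]
  exact h.choose_spec.unique hT

/-- A kernel whose Fourier transform is bounded by `1` gives a contraction on `L²`. -/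
lemma norm_convLp_two_le (K : LpSpace d 1)
    (hK : ∀ ξ, ‖𝓕 (K : EuclideanSpace ℝ (Fin d) → ℂ) ξ‖ ≤ 1) (u : LpSpace d 2) :
    ‖convLp d 2 K u‖ ≤ ‖u‖ := by
  rw [← Lp.norm_fourier_eq (convLp d 2 K u), ← Lp.norm_fourier_eq u]
  refine Lp.norm_le_norm_of_ae_le ?_
  filter_upwards [fourier_convLp K u] with ξ hξ
  rw [hξ, norm_mul]
  exact mul_le_of_le_one_left (norm_nonneg _) (hK ξ)

/-- Composition of convolutions with kernels whose Fourier transforms multiply. -/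
lemma convLp_comp_convLp {K₁ K₂ K₃ : LpSpace d 1}
    (h : ∀ ξ, 𝓕 (K₃ : EuclideanSpace ℝ (Fin d) → ℂ) ξ =
      𝓕 (K₁ : EuclideanSpace ℝ (Fin d) → ℂ) ξ * 𝓕 (K₂ : EuclideanSpace ℝ (Fin d) → ℂ) ξ) :
    convLp d p K₃ = (convLp d p K₁).comp (convLp d p K₂) := by
  refine DFunLike.coe_injective (Continuous.ext_on dense_inter_Lp_two
    (convLp d p K₃).continuous ((convLp d p K₁).comp (convLp d p K₂)).continuous ?_)
  rintro f ⟨u, hu⟩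
  refine Lp.ext ((convLp_congr K₃ hu).symm.trans ?_)
  refine EventuallyEq.trans ?_ (convLp_congr K₁ (convLp_congr K₂ hu))
  have : convLp d 2 K₃ u = convLp d 2 K₁ (convLp d 2 K₂ u) := by
    refine eq_of_fourier_ae_eq ?_
    filter_upwards [fourier_convLp K₃ u, fourier_convLp K₁ (convLp d 2 K₂ u),
      fourier_convLp K₂ u] with ξ h1 h2 h3
    rw [h1, h2, h3, h, mul_assoc]
  rw [this]

end Function

end Multiplier

/-! ### The Poisson kernel: Fourier transform -/

section Subordination

/-- The map `φ(x) = ax - b/x` is an increasing bijection of `(0, ∞)` onto `ℝ`, so `∫ (a + b/x²)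
e^{-φ²} = √π`. The involution `x ↦ b/(ax)` changes the sign of `φ` and shows that the two summands
contribute equally. -/
lemma integral_exp_neg_sq_sub_div {a b : ℝ} (ha : 0 < a) (hb : 0 < b) :
    ∫ x in Set.Ioi (0 : ℝ), Real.exp (-(a * x - b / x) ^ 2) = √Real.pi / (2 * a) := by
  have hφd : ∀ x ∈ Set.Ioi (0 : ℝ), HasDerivWithinAt (fun x => a * x - b / x) (a + b / x ^ 2)
      (Set.Ioi 0) x := by
    intro x hx
    have hx0 : x ≠ 0 := (Set.mem_Ioi.1 hx).ne'
    have := ((hasDerivAt_id x).const_mul a).sub ((hasDerivAt_inv hx0).const_mul b)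
    refine (this.congr_deriv ?_).hasDerivWithinAt
    field_simp
    ring
  have hmono : StrictMonoOn (fun x => a * x - b / x) (Set.Ioi 0) := by
    intro x hx y hy hxy
    have h1 : a * x < a * y := by gcongr
    have h2 : b / y < b / x := div_lt_div_of_pos_left hb hx hxy
    change a * x - b / x < a * y - b / y
    linarith
  have himg : (fun x => a * x - b / x) '' Set.Ioi 0 = Set.univ := by
    refine Set.eq_univ_of_forall fun u => ?_
    have hs : |u| < √(u ^ 2 + 4 * a * b) := by
      rw [← Real.sqrt_sq_eq_abs]
      exact Real.sqrt_lt_sqrt (sq_nonneg _) (by nlinarith [mul_pos ha hb])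
    have hs2 : √(u ^ 2 + 4 * a * b) ^ 2 = u ^ 2 + 4 * a * b :=
      Real.sq_sqrt (by nlinarith [mul_pos ha hb, sq_nonneg u])
    set w := √(u ^ 2 + 4 * a * b)
    have hpos : 0 < u + w := by linarith [neg_abs_le u]
    -- The positive root of `a x² - u x - b = 0`.
    refine ⟨(u + w) / (2 * a), div_pos hpos (by linarith), ?_⟩
    have : u + w ≠ 0 := hpos.ne'
    field_simp
    nlinarith
  have habs : ∀ x ∈ Set.Ioi (0 : ℝ), |a + b / x ^ 2| = a + b / x ^ 2 := fun x hx =>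
    abs_of_pos (by have := Set.mem_Ioi.1 hx; positivity)
  have h1 := integral_image_eq_integral_abs_deriv_smul measurableSet_Ioi hφd hmono.injOn
    (fun u => Real.exp (-u ^ 2))
  have hint := (integrableOn_image_iff_integrableOn_abs_deriv_smul measurableSet_Ioi hφd
    hmono.injOn (fun u => Real.exp (-u ^ 2))).1 (by
      rw [himg, integrableOn_univ]
      simpa using integrable_exp_neg_mul_sq one_pos)
  have hg : ∫ x : ℝ, Real.exp (-x ^ 2) = √Real.pi := by
    simpa using integral_gaussian 1
  rw [himg, Measure.restrict_univ, hg] at h1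
  have hψd : ∀ x ∈ Set.Ioi (0 : ℝ), HasDerivWithinAt (fun x => b / (a * x)) (-(b / (a * x ^ 2)))
      (Set.Ioi 0) x := by
    intro x hx
    have hx0 : x ≠ 0 := (Set.mem_Ioi.1 hx).ne'
    have := (hasDerivAt_inv hx0).const_mul (b / a)
    refine ((this.congr_deriv ?_).congr_of_eventuallyEq (Eventually.of_forall fun y => ?_)).hasDerivWithinAt
    · field_simp
    · change b / (a * y) = b / a * y⁻¹
      rw [div_mul_eq_div_div, div_eq_mul_inv (b / a)]
  have hψanti : Set.InjOn (fun x => b / (a * x)) (Set.Ioi 0) := by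
    intro x hx y hy hxy
    have hx0 : x ≠ 0 := (Set.mem_Ioi.1 hx).ne'
    have hy0 : y ≠ 0 := (Set.mem_Ioi.1 hy).ne'
    simp only at hxy
    field_simp at hxy
    exact hxy.symm
  have hψimg : (fun x => b / (a * x)) '' Set.Ioi 0 = Set.Ioi 0 := by
    ext u
    constructor
    · rintro ⟨x, hx, rfl⟩
      have := Set.mem_Ioi.1 hx
      exact Set.mem_Ioi.2 (by positivity)
    · intro hu
      have := Set.mem_Ioi.1 hu
      exact ⟨b / (a * u), Set.mem_Ioi.2 (by positivity), by field_simp⟩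
  have h2 := integral_image_eq_integral_abs_deriv_smul measurableSet_Ioi hψd hψanti
    (fun x => Real.exp (-(a * x - b / x) ^ 2))
  rw [hψimg] at h2
  have h3 : ∫ x in Set.Ioi (0 : ℝ), |-(b / (a * x ^ 2))| • Real.exp (-(a * (b / (a * x)) - b / (b / (a * x))) ^ 2)
      = ∫ x in Set.Ioi (0 : ℝ), (b / x ^ 2 * Real.exp (-(a * x - b / x) ^ 2)) / a := by
    refine setIntegral_congr_fun measurableSet_Ioi fun x hx => ?_
    have hx' := Set.mem_Ioi.1 hx
    have e : (a * (b / (a * x)) - b / (b / (a * x))) ^ 2 = (a * x - b / x) ^ 2 := by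
      field_simp
      ring
    simp only [smul_eq_mul]
    rw [e, abs_neg, abs_of_pos (by positivity)]
    field_simp
  rw [h3, integral_div] at h2
  have hint' : IntegrableOn (fun x => a * Real.exp (-(a * x - b / x) ^ 2)
      + b / x ^ 2 * Real.exp (-(a * x - b / x) ^ 2)) (Set.Ioi 0) := by
    refine hint.congr_fun (fun x hx => ?_) measurableSet_Ioi
    simp only [smul_eq_mul]
    rw [habs x hx, add_mul]
  have hmeas : ∀ c : ℝ → ℝ, Measurable c → AEStronglyMeasurable
      (fun x => c x * Real.exp (-(a * x - b / x) ^ 2)) (volume.restrict (Set.Ioi 0)) :=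
    fun c hc => (by fun_prop : Measurable _).aestronglyMeasurable
  have hi1 : IntegrableOn (fun x => a * Real.exp (-(a * x - b / x) ^ 2)) (Set.Ioi 0) := by
    refine Integrable.mono' hint' (hmeas _ measurable_const) ?_
    filter_upwards with x
    rw [Real.norm_of_nonneg (by positivity)]
    exact le_add_of_nonneg_right (by positivity)
  have hi2 : IntegrableOn (fun x => b / x ^ 2 * Real.exp (-(a * x - b / x) ^ 2)) (Set.Ioi 0) := by
    refine Integrable.mono' hint' (hmeas _ (by fun_prop)) ?_
    filter_upwards with x
    rw [Real.norm_of_nonneg (by positivity)]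
    exact le_add_of_nonneg_left (by positivity)
  have h4 : √Real.pi = a * (∫ x in Set.Ioi (0 : ℝ), Real.exp (-(a * x - b / x) ^ 2)) +
      ∫ x in Set.Ioi (0 : ℝ), b / x ^ 2 * Real.exp (-(a * x - b / x) ^ 2) := by
    rw [← integral_const_mul, ← integral_add hi1 hi2, h1]
    refine setIntegral_congr_fun measurableSet_Ioi fun x hx => ?_
    simp only [smul_eq_mul]
    rw [habs x hx, add_mul]
  rw [eq_div_iff (by positivity)]
  rw [eq_div_iff ha.ne'] at h2
  linarith

/-- The subordination identity. -/
lemma integral_rpow_mul_exp_neg_add_div {a b : ℝ} (ha : 0 < a) (hb : 0 ≤ b) :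
    ∫ s in Set.Ioi (0 : ℝ), s ^ (-(1 / 2) : ℝ) * Real.exp (-(a ^ 2 * s + b ^ 2 / s)) =
      √Real.pi / a * Real.exp (-(2 * a * b)) := by
  -- The case `b = 0`, needed at frequency zero, is a Gamma integral.
  rcases hb.eq_or_lt with rfl | hb
  · have := Real.integral_rpow_mul_exp_neg_mul_Ioi (a := 1 / 2) (r := a ^ 2) (by norm_num)
      (by positivity)
    rw [show (1 / 2 - 1 : ℝ) = -(1 / 2) by norm_num] at this
    simp only [ne_eq, OfNat.ofNat_ne_zero, not_false_eq_true, zero_pow, zero_div, add_zero,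
      mul_zero, neg_zero, Real.exp_zero, mul_one]
    rw [this, Real.Gamma_one_half_eq, ← Real.sqrt_eq_rpow, Real.sqrt_div zero_le_one,
      Real.sqrt_one, Real.sqrt_sq ha.le]
    ring
  · have hd : ∀ x ∈ Set.Ioi (0 : ℝ), HasDerivWithinAt (fun x : ℝ => x ^ 2) (2 * x) (Set.Ioi 0) x := by
      intro x _
      simpa using (hasDerivAt_pow 2 x).hasDerivWithinAt
    have hinj : Set.InjOn (fun x : ℝ => x ^ 2) (Set.Ioi 0) := fun x hx y hy h =>
      (pow_left_inj₀ (le_of_lt hx) (le_of_lt hy) two_ne_zero).1 h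
    have himg : (fun x : ℝ => x ^ 2) '' Set.Ioi 0 = Set.Ioi 0 := by
      ext u
      constructor
      · rintro ⟨x, hx, rfl⟩
        exact Set.mem_Ioi.2 (pow_pos hx 2)
      · intro hu
        exact ⟨√u, Real.sqrt_pos.2 hu, Real.sq_sqrt (le_of_lt hu)⟩
    have h := integral_image_eq_integral_abs_deriv_smul measurableSet_Ioi hd hinj
      (fun s => s ^ (-(1 / 2) : ℝ) * Real.exp (-(a ^ 2 * s + b ^ 2 / s)))
    rw [himg] at h
    rw [h]
    -- After `s = x²` the Jacobian cancels `s^{-1/2}`, and completing the square splits off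
    -- `e^{-2ab}`.
    have h2 : ∀ x ∈ Set.Ioi (0 : ℝ), |2 * x| • ((x ^ 2) ^ (-(1 / 2) : ℝ) *
        Real.exp (-(a ^ 2 * x ^ 2 + b ^ 2 / x ^ 2))) =
        (2 * Real.exp (-(2 * a * b))) * Real.exp (-(a * x - b / x) ^ 2) := by
      intro x hx
      have hx' := Set.mem_Ioi.1 hx
      rw [abs_of_pos (by positivity), Real.rpow_neg (by positivity), ← Real.sqrt_eq_rpow,
        Real.sqrt_sq hx'.le, smul_eq_mul, mul_assoc 2 (Real.exp _), ← Real.exp_add]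
      have : -(a ^ 2 * x ^ 2 + b ^ 2 / x ^ 2) = -(2 * a * b) + -(a * x - b / x) ^ 2 := by
        field_simp
        ring
      rw [this]
      field_simp
    rw [setIntegral_congr_fun measurableSet_Ioi h2, integral_const_mul,
      integral_exp_neg_sq_sub_div ha hb]
    field_simp

end Subordination

/-! ### Subordination to Gaussians and analytic continuation in time. -/

section PoissonFourier

variable {d : ℕ}

lemma integrable_rpow_neg_one_add_norm_sq_of_lt {r : ℝ} (hr : (d : ℝ) < r) :
    Integrable (fun x : EuclideanSpace ℝ (Fin d) => (1 + ‖x‖ ^ 2) ^ (-r / 2)) :=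
  integrable_rpow_neg_one_add_norm_sq (by simpa using hr)

lemma integrable_exp_neg_mul_norm {a : ℝ} (ha : 0 < a) :
    Integrable (fun x : EuclideanSpace ℝ (Fin d) => Real.exp (-(a * ‖x‖))) := by
  -- compare with a power of `1 + ‖x‖`
  have h1 : Integrable (fun x : EuclideanSpace ℝ (Fin d) => (1 + ‖x‖) ^ (-((d : ℝ) + 1))) :=
    integrable_one_add_norm (by simp)
  obtain ⟨C, hC⟩ : ∃ C : ℝ, ∀ s : ℝ, 0 ≤ s → Real.exp (-(a * s)) ≤ C * (1 + s) ^ (-((d : ℝ) + 1)) := by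
    -- From `x^{d+1} / (d+1)! ≤ e^x` at `x = a(1 + s)`.
    refine ⟨((d + 1).factorial : ℝ) / a ^ (d + 1) * Real.exp a, fun s hs => ?_⟩
    have h2 := Real.pow_div_factorial_le_exp (a * (1 + s)) (by positivity) (d + 1)
    rw [Real.rpow_neg (by positivity), ← Nat.cast_add_one, Real.rpow_natCast,
      ← div_eq_mul_inv, le_div_iff₀ (by positivity), Real.exp_neg, inv_mul_le_iff₀ (Real.exp_pos _)]
    rw [div_le_iff₀ (by positivity), mul_pow, mul_add, mul_one, Real.exp_add] at h2
    rw [← mul_assoc, ← mul_div_assoc, div_mul_eq_mul_div, le_div_iff₀ (by positivity)]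
    nlinarith
  refine (h1.const_mul C).mono' (by fun_prop) (Eventually.of_forall fun x => ?_)
  rw [Real.norm_of_nonneg (Real.exp_pos _).le]
  exact hC _ (norm_nonneg _)

/-- The symbol of `exp(-zA)`. -/
abbrev poissonSymbol (d : ℕ) (z : ℂ) (ξ : EuclideanSpace ℝ (Fin d)) : ℂ :=
  expSymbol z (2 * Real.pi * ‖ξ‖)

lemma norm_expSymbol (z : ℂ) (s : ℝ) : ‖expSymbol z s‖ = Real.exp (-(z.re * s)) := by
  rw [expSymbol, Complex.norm_exp]
  simp

lemma integrable_poissonSymbol {z : ℂ} (hz : 0 < z.re) : Integrable (poissonSymbol d z) := by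
  refine (integrable_exp_neg_mul_norm (d := d) (a := z.re * (2 * Real.pi))
    (by positivity)).mono' ?_ (Eventually.of_forall fun ξ => ?_)
  · refine Continuous.aestronglyMeasurable ?_
    unfold poissonSymbol expSymbol
    fun_prop
  · rw [norm_expSymbol]
    exact le_of_eq (by congr 1; ring)

lemma continuous_poissonSymbol (z : ℂ) : Continuous (poissonSymbol d z) := by
  unfold poissonSymbol expSymbol
  fun_prop

/-- For real `z` the sum is positive; otherwise its imaginary part `2 Re z Im z` is nonzero. Hence
the principal power in the kernel is holomorphic on the whole half plane. -/
lemma sq_add_mem_slitPlane {z : ℂ} (hz : 0 < z.re) {r : ℝ} (hr : 0 ≤ r) :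
    z ^ 2 + (r : ℂ) ∈ Complex.slitPlane := by
  rw [Complex.mem_slitPlane_iff]
  by_cases h : z.im = 0
  · left
    simp [sq, h]
    positivity
  · right
    simp [sq]
    intro h2
    rcases mul_eq_zero.1 (show z.re * z.im = 0 by linarith) with h3 | h3
    · exact hz.ne' h3
    · exact h h3

lemma integrable_subordination {t : ℝ} (ht : 0 < t) :
    Integrable (fun w : ℝ × EuclideanSpace ℝ (Fin d) =>
      w.1 ^ (-(1 / 2) : ℝ) * Real.exp (-(t ^ 2 * w.1 + (Real.pi * ‖w.2‖) ^ 2 / w.1)))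
      ((volume.restrict (Set.Ioi 0)).prod volume) := by
  have hm : Measurable (fun w : ℝ × EuclideanSpace ℝ (Fin d) =>
      w.1 ^ (-(1 / 2) : ℝ) * Real.exp (-(t ^ 2 * w.1 + (Real.pi * ‖w.2‖) ^ 2 / w.1))) := by
    fun_prop
  have hsub : ∀ ξ : EuclideanSpace ℝ (Fin d), ∫ s in Set.Ioi (0 : ℝ),
      s ^ (-(1 / 2) : ℝ) * Real.exp (-(t ^ 2 * s + (Real.pi * ‖ξ‖) ^ 2 / s)) = 
      √Real.pi / t * Real.exp (-(2 * t * (Real.pi * ‖ξ‖))) := fun ξ => 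
    integral_rpow_mul_exp_neg_add_div ht (by positivity)
  rw [integrable_prod_iff' hm.aestronglyMeasurable]
  have hpos : ∀ ξ : EuclideanSpace ℝ (Fin d), ∀ᵐ s ∂(volume.restrict (Set.Ioi (0 : ℝ))),
      0 ≤ s ^ (-(1 / 2) : ℝ) * Real.exp (-(t ^ 2 * s + (Real.pi * ‖ξ‖) ^ 2 / s)) := by
    intro ξ
    filter_upwards [ae_restrict_mem measurableSet_Ioi] with s hs
    have := Set.mem_Ioi.1 hs
    positivity
  constructor
  · filter_upwards with ξ
    -- A nonintegrable function has integral 0 by convention, while the subordination identity gives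
    -- a positive value.
    by_contra h
    have := hsub ξ
    rw [integral_undef h] at this
    have h2 : 0 < √Real.pi / t * Real.exp (-(2 * t * (Real.pi * ‖ξ‖))) := by positivity
    exact h2.ne this
  · have : ∀ ξ : EuclideanSpace ℝ (Fin d), ∫ s in Set.Ioi (0 : ℝ),
      ‖s ^ (-(1 / 2) : ℝ) * Real.exp (-(t ^ 2 * s + (Real.pi * ‖ξ‖) ^ 2 / s))‖ = 
      √Real.pi / t * Real.exp (-((2 * t * Real.pi) * ‖ξ‖)) := by
      intro ξ
      rw [show 2 * t * Real.pi * ‖ξ‖ = 2 * t * (Real.pi * ‖ξ‖) by ring, ← hsub ξ]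
      refine integral_congr_ae ?_
      filter_upwards [hpos ξ] with s hs
      exact Real.norm_of_nonneg hs
    simp_rw [this]
    exact (integrable_exp_neg_mul_norm (by positivity)).const_mul _

/-- The symbol is a superposition of the Gaussians `e^{-π²|ξ|²/s}`. Each has an explicit transform,
and the integral in `s` that remains is a Gamma integral producing `(t² + |x|²)^{-(d+1)/2}`. -/
lemma fourier_poissonSymbol_ofReal {t : ℝ} (ht : 0 < t)
    (x : EuclideanSpace ℝ (Fin d)) :
    𝓕 (poissonSymbol d (t : ℂ)) x = halfSpacePoissonKernel d t x := by
  have hsub : ∀ ξ : EuclideanSpace ℝ (Fin d), poissonSymbol d (t : ℂ) ξ =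
      ((t / √Real.pi : ℝ) : ℂ) * ∫ s in Set.Ioi (0 : ℝ),
      ((s ^ (-(1 / 2) : ℝ) * Real.exp (-(t ^ 2 * s + (Real.pi * ‖ξ‖) ^ 2 / s)) : ℝ) : ℂ) := by
    intro ξ
    rw [integral_complex_ofReal, integral_rpow_mul_exp_neg_add_div ht (by positivity),
      ← Complex.ofReal_mul]
    have : t / √Real.pi * (√Real.pi / t * Real.exp (-(2 * t * (Real.pi * ‖ξ‖)))) =
      Real.exp (-(2 * t * (Real.pi * ‖ξ‖))) := by
      have : √Real.pi ≠ 0 := by positivity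
      field_simp
    rw [this, Complex.ofReal_exp, poissonSymbol, expSymbol]
    congr 1
    push_cast
    ring
  have hint := integrable_subordination (d := d) ht
  have hgauss : ∀ s ∈ Set.Ioi (0 : ℝ), ∫ ξ : EuclideanSpace ℝ (Fin d),
      (Real.fourierChar (-(inner ℝ ξ x)) : ℂ) *
        ((s ^ (-(1 / 2) : ℝ) * Real.exp (-(t ^ 2 * s + (Real.pi * ‖ξ‖) ^ 2 / s)) : ℝ) : ℂ) =
      ((Real.pi ^ (-(d : ℝ) / 2) * (s ^ (((d : ℝ) + 1) / 2 - 1) * Real.exp (-((t ^ 2 + ‖x‖ ^ 2) * s))) : ℝ) : ℂ) := by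
    intro s hs
    have hs' := Set.mem_Ioi.1 hs
    have hb : 0 < ((Real.pi ^ 2 / s : ℝ) : ℂ).re := by
      rw [Complex.ofReal_re]; positivity
    have h := fourier_gaussian_innerProductSpace hb x
    rw [Real.fourier_eq] at h
    have h1 : ∀ ξ : EuclideanSpace ℝ (Fin d), (Real.fourierChar (-(inner ℝ ξ x)) : ℂ) *
        ((s ^ (-(1 / 2) : ℝ) * Real.exp (-(t ^ 2 * s + (Real.pi * ‖ξ‖) ^ 2 / s)) : ℝ) : ℂ) =
        ((s ^ (-(1 / 2) : ℝ) * Real.exp (-(t ^ 2 * s)) : ℝ) : ℂ) *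
        (Real.fourierChar (-(inner ℝ ξ x)) • Complex.exp (-((Real.pi ^ 2 / s : ℝ) : ℂ) * ‖ξ‖ ^ 2)) := by
      intro ξ
      rw [neg_add, Real.exp_add, Circle.smul_def, smul_eq_mul]
      push_cast
      rw [show -((Real.pi * ‖ξ‖ : ℂ) ^ 2 / s) = -(Real.pi ^ 2 / s : ℂ) * ‖ξ‖ ^ 2 by ring]
      ring
    simp_rw [h1]
    rw [integral_const_mul, h, finrank_euclideanSpace_fin]
    have h2 : ((Real.pi : ℂ) / ((Real.pi ^ 2 / s : ℝ) : ℂ)) ^ ((d : ℂ) / 2) =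
        (((s / Real.pi) ^ ((d : ℝ) / 2) : ℝ) : ℂ) := by
      rw [Complex.ofReal_cpow (by positivity)]
      congr 1
      · have : (Real.pi : ℂ) ≠ 0 := by exact_mod_cast Real.pi_ne_zero
        have : (s : ℂ) ≠ 0 := by exact_mod_cast hs'.ne'
        push_cast
        field_simp
      · push_cast; rfl
    have h3 : Complex.exp (-(Real.pi : ℂ) ^ 2 * ‖x‖ ^ 2 / ((Real.pi ^ 2 / s : ℝ) : ℂ)) =
        ((Real.exp (-(‖x‖ ^ 2 * s)) : ℝ) : ℂ) := by
      rw [Complex.ofReal_exp]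
      congr 1
      have : (Real.pi : ℂ) ≠ 0 := by exact_mod_cast Real.pi_ne_zero
      have : (s : ℂ) ≠ 0 := by exact_mod_cast hs'.ne'
      push_cast
      field_simp
    rw [h2, h3, ← Complex.ofReal_mul, ← Complex.ofReal_mul, add_mul, neg_add, Real.exp_add,
      Real.div_rpow hs'.le Real.pi_pos.le, show ((d : ℝ) + 1) / 2 - 1 = -(1 / 2) + (d : ℝ) / 2 by ring,
      Real.rpow_add hs', neg_div, Real.rpow_neg Real.pi_pos.le]
    congr 1
    ring
  have hmove : ∀ ξ : EuclideanSpace ℝ (Fin d),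
      Real.fourierChar (-(inner ℝ ξ x)) • poissonSymbol d (t : ℂ) ξ =
      ((t / √Real.pi : ℝ) : ℂ) * ∫ s in Set.Ioi (0 : ℝ), (Real.fourierChar (-(inner ℝ ξ x)) : ℂ) *
        ((s ^ (-(1 / 2) : ℝ) * Real.exp (-(t ^ 2 * s + (Real.pi * ‖ξ‖) ^ 2 / s)) : ℝ) : ℂ) := by
    intro ξ
    rw [hsub, integral_const_mul, Circle.smul_def, smul_eq_mul]
    ring
  rw [Real.fourier_eq]
  simp_rw [hmove]
  rw [integral_const_mul, integral_integral_swap]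
  · rw [setIntegral_congr_fun measurableSet_Ioi hgauss, integral_complex_ofReal,
      integral_const_mul, Real.integral_rpow_mul_exp_neg_mul_Ioi (by positivity) (by positivity),
      halfSpacePoissonKernel]
    have h4 : ((t : ℂ) ^ 2 + ((‖x‖ ^ 2 : ℝ) : ℂ)) ^ (((d : ℂ) + 1) / 2) =
        (((t ^ 2 + ‖x‖ ^ 2) ^ (((d : ℝ) + 1) / 2) : ℝ) : ℂ) := by
      rw [Complex.ofReal_cpow (by positivity)]
      push_cast
      rfl
    rw [h4, ← Complex.ofReal_div, ← Complex.ofReal_mul, ← Complex.ofReal_mul, one_div,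
      Real.inv_rpow (by positivity)]
    congr 1
    have h5 : Real.pi ^ (((d : ℝ) + 1) / 2) = √Real.pi * Real.pi ^ ((d : ℝ) / 2) := by
      rw [Real.sqrt_eq_rpow, ← Real.rpow_add Real.pi_pos]
      congr 1
      ring
    rw [h5, neg_div, Real.rpow_neg Real.pi_pos.le]
    have : Real.pi ^ ((d : ℝ) / 2) ≠ 0 := by positivity
    have : √Real.pi ≠ 0 := by positivity
    field_simp
  · have hswap := hint.swap
    refine (hswap.ofReal (𝕜 := ℂ)).norm.mono' ?_ (Eventually.of_forall fun w => ?_)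
    · refine AEStronglyMeasurable.mul ?_ (hswap.ofReal (𝕜 := ℂ)).aestronglyMeasurable
      refine Continuous.aestronglyMeasurable ?_
      fun_prop
    · simp only [Function.uncurry, norm_mul, Circle.norm_coe, one_mul]
      simp

lemma differentiableAt_fourier_poissonSymbol {z : ℂ} (hz : 0 < z.re)
    (x : EuclideanSpace ℝ (Fin d)) :
    DifferentiableAt ℂ (fun z => 𝓕 (poissonSymbol d z) x) z := by
  set F' : ℂ → EuclideanSpace ℝ (Fin d) → ℂ := fun w ξ =>
    Real.fourierChar (-(inner ℝ ξ x)) • (-((2 * Real.pi * ‖ξ‖ : ℝ) : ℂ) * poissonSymbol d w ξ)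
  have h := hasDerivAt_integral_of_dominated_loc_of_deriv_le (𝕜 := ℂ) (μ := volume)
    (F := fun w ξ => Real.fourierChar (-(inner ℝ ξ x)) • poissonSymbol d w ξ) (x₀ := z)
    (F' := F') (s := Metric.ball z (z.re / 2))
    (bound := fun ξ => (4 / z.re) * Real.exp (-((z.re / 4 * (2 * Real.pi)) * ‖ξ‖)))
    (Metric.ball_mem_nhds _ (by positivity)) ?_ ?_ ?_ ?_ ?_ ?_
  · exact h.2.differentiableAt
  · refine Eventually.of_forall fun w => Continuous.aestronglyMeasurable ?_
    exact Continuous.smul (by fun_prop) (continuous_poissonSymbol w)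
  · exact (Real.fourierIntegral_convergent_iff x).2 (integrable_poissonSymbol hz)
  · refine Continuous.aestronglyMeasurable ?_
    exact Continuous.smul (by fun_prop) ((by fun_prop : Continuous _).mul (continuous_poissonSymbol z))
  · refine Eventually.of_forall fun ξ w hw => ?_
    have hre : z.re / 2 ≤ w.re := by
      have h1 := Complex.abs_re_le_norm (w - z)
      rw [Metric.mem_ball, dist_eq_norm] at hw
      rw [Complex.sub_re] at h1
      linarith [neg_abs_le (w.re - z.re)]
    set s := 2 * Real.pi * ‖ξ‖ with hs
    have hs0 : 0 ≤ s := by positivity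
    rw [Circle.norm_smul, norm_mul, norm_neg, Complex.norm_real, Real.norm_of_nonneg hs0,
      norm_expSymbol]
    -- Half of the available exponential decay absorbs the factor `s` brought down by the
    -- derivative.
    have h2 : z.re / 4 * s ≤ Real.exp (z.re / 4 * s) := by
      linarith [Real.add_one_le_exp (z.re / 4 * s)]
    have h3 : Real.exp (-(w.re * s)) ≤ Real.exp (-(z.re / 4 * s)) * Real.exp (-(z.re / 4 * s)) := by
      rw [← Real.exp_add]
      refine Real.exp_le_exp.2 ?_
      nlinarith
    have h4 : s ≤ 4 / z.re * Real.exp (z.re / 4 * s) := by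
      rw [div_mul_eq_mul_div, le_div_iff₀ hz]; linarith
    calc s * Real.exp (-(w.re * s)) ≤ (4 / z.re * Real.exp (z.re / 4 * s)) *
          (Real.exp (-(z.re / 4 * s)) * Real.exp (-(z.re / 4 * s))) := by gcongr
      _ = 4 / z.re * Real.exp (-(z.re / 4 * (2 * Real.pi) * ‖ξ‖)) := by
        rw [Real.exp_neg, mul_assoc (z.re / 4), ← hs]
        field_simp
        rw [← Real.exp_add]
        simp
  · exact (integrable_exp_neg_mul_norm (by positivity)).const_mul _
  · refine Eventually.of_forall fun ξ w _ => ?_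
    have h1 : HasDerivAt (fun w : ℂ => Complex.exp (-w * ((2 * Real.pi * ‖ξ‖ : ℝ) : ℂ)))
        (Complex.exp (-w * ((2 * Real.pi * ‖ξ‖ : ℝ) : ℂ)) * (-1 * ((2 * Real.pi * ‖ξ‖ : ℝ) : ℂ))) w :=
      (((hasDerivAt_id w).neg).mul_const _).cexp
    have h2 := h1.const_mul (Real.fourierChar (-(inner ℝ ξ x)) : ℂ)
    refine h2.congr_deriv ?_
    simp only [F', Circle.smul_def, smul_eq_mul, poissonSymbol, expSymbol]
    ring

lemma differentiableAt_halfSpacePoissonKernel {z : ℂ} (hz : 0 < z.re)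
    (x : EuclideanSpace ℝ (Fin d)) :
    DifferentiableAt ℂ (fun z => halfSpacePoissonKernel d z x) z := by
  have hs := sq_add_mem_slitPlane hz (sq_nonneg ‖x‖)
  have hc : ((d : ℂ) + 1) / 2 ≠ 0 := by
    intro h
    have := congrArg Complex.re h
    simp at this
    linarith [d.cast_nonneg (α := ℝ)]
  have h1 : DifferentiableAt ℂ (fun z : ℂ => z ^ 2 + ((‖x‖ ^ 2 : ℝ) : ℂ)) z := by fun_prop
  have h2 := h1.cpow_const (c := ((d : ℂ) + 1) / 2) hs
  have h3 : (z ^ 2 + ((‖x‖ ^ 2 : ℝ) : ℂ)) ^ (((d : ℂ) + 1) / 2) ≠ 0 :=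
    (Complex.cpow_ne_zero_iff_of_exponent_ne_zero hc).2 (Complex.slitPlane_ne_zero hs)
  exact (differentiableAt_id.div h2 h3).const_mul _

/-- Both sides are holomorphic on the half plane and agree at real points accumulating at 1, so the
identity theorem applies. -/
theorem fourier_poissonSymbol {z : ℂ} (hz : 0 < z.re)
    (x : EuclideanSpace ℝ (Fin d)) :
    𝓕 (poissonSymbol d z) x = halfSpacePoissonKernel d z x := by
  have hopen : IsOpen {w : ℂ | 0 < w.re} := isOpen_lt continuous_const Complex.continuous_re
  have h1 : AnalyticOnNhd ℂ (fun z => 𝓕 (poissonSymbol d z) x) {w : ℂ | 0 < w.re} :=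
    DifferentiableOn.analyticOnNhd
      (fun w hw => (differentiableAt_fourier_poissonSymbol hw x).differentiableWithinAt) hopen
  have h2 : AnalyticOnNhd ℂ (fun z => halfSpacePoissonKernel d z x) {w : ℂ | 0 < w.re} :=
    DifferentiableOn.analyticOnNhd
      (fun w hw => (differentiableAt_halfSpacePoissonKernel hw x).differentiableWithinAt) hopen
  refine h1.eqOn_of_preconnected_of_frequently_eq h2
    (convex_halfSpace_re_gt 0).isPreconnected (z₀ := 1) (by simp) ?_ hz
  have h3 : Tendsto (fun t : ℝ => (t : ℂ)) (𝓝[>] 1) (𝓝[≠] 1) := by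
    refine tendsto_nhdsWithin_iff.2 ⟨?_, ?_⟩
    · exact (Complex.continuous_ofReal.tendsto' 1 1 (by simp)).mono_left nhdsWithin_le_nhds
    · filter_upwards [self_mem_nhdsWithin] with t ht
      have := Set.mem_Ioi.1 ht
      simp only [Set.mem_compl_iff, Set.mem_singleton_iff]
      exact_mod_cast this.ne'
  refine h3.frequently (Eventually.frequently ?_)
  filter_upwards [self_mem_nhdsWithin] with t ht
  exact fourier_poissonSymbol_ofReal (zero_lt_one.trans (Set.mem_Ioi.1 ht)) x

/-- Fourier inversion; the symbol is radial, so the inverse transform may be replaced by the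
transform. -/
theorem fourier_halfSpacePoissonKernel {z : ℂ} (hz : 0 < z.re)
    (hint : Integrable (halfSpacePoissonKernel d z)) (ξ : EuclideanSpace ℝ (Fin d)) :
    𝓕 (halfSpacePoissonKernel d z) ξ = expSymbol z (2 * Real.pi * ‖ξ‖) := by
  have h1 : 𝓕 (poissonSymbol d z) = halfSpacePoissonKernel d z :=
    funext (fourier_poissonSymbol hz)
  have h2 := (continuous_poissonSymbol (d := d) z).fourierInv_fourier_eq
    (integrable_poissonSymbol hz) (by rwa [h1])
  have h3 := congrFun h2 (-ξ)
  rw [h1, Real.fourierInv_eq_fourier_neg, neg_neg] at h3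
  rw [h3, poissonSymbol, norm_neg]

end PoissonFourier

/-! ### The Poisson kernel: pointwise and integral bounds -/

section PoissonBounds

variable {d : ℕ}

/-- The normalising constant of the Poisson kernel. -/
def poissonConst (d : ℕ) : ℝ :=
  Real.Gamma (((d : ℝ) + 1) / 2) / Real.pi ^ (((d : ℝ) + 1) / 2)

lemma poissonConst_pos (d : ℕ) : 0 < poissonConst d :=
  div_pos (Real.Gamma_pos_of_pos (by positivity)) (by positivity)

lemma halfSpacePoissonKernel_eq (z : ℂ) (x : EuclideanSpace ℝ (Fin d)) :
    halfSpacePoissonKernel d z x = (poissonConst d : ℂ) *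
      (z * (z ^ 2 + ((‖x‖ ^ 2 : ℝ) : ℂ)) ^ (((-(((d : ℝ) + 1) / 2) : ℝ)) : ℂ)) := by
  rw [halfSpacePoissonKernel, poissonConst, div_eq_mul_inv z, ← Complex.cpow_neg]
  push_cast
  rfl

lemma norm_halfSpacePoissonKernel (z : ℂ) (x : EuclideanSpace ℝ (Fin d)) :
    ‖halfSpacePoissonKernel d z x‖ = poissonConst d *
      (‖z‖ * ‖z ^ 2 + ((‖x‖ ^ 2 : ℝ) : ℂ)‖ ^ (-(((d : ℝ) + 1) / 2))) := by
  rw [halfSpacePoissonKernel_eq, norm_mul, norm_mul, Complex.norm_cpow_real, Complex.norm_real,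
    Real.norm_of_nonneg (poissonConst_pos d).le]

lemma halfSpacePoissonKernel_neg (z : ℂ) (x : EuclideanSpace ℝ (Fin d)) :
    halfSpacePoissonKernel d z (-x) = halfSpacePoissonKernel d z x := by
  simp only [halfSpacePoissonKernel, norm_neg]

lemma continuous_halfSpacePoissonKernel {z : ℂ} (hz : 0 < z.re) :
    Continuous (halfSpacePoissonKernel d z) := by
  have : halfSpacePoissonKernel d z = fun x => _ := funext (halfSpacePoissonKernel_eq z)
  rw [this]
  refine continuous_const.mul (continuous_const.mul ?_)
  exact Continuous.cpow (by fun_prop) continuous_const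
    fun x => sq_add_mem_slitPlane hz (sq_nonneg ‖x‖)

/-- From `z² + r² = (z + ir)(z - ir)`. Only the second factor on the right can become small, namely
when `r` is within about `Re z` of `|Im z|`. -/
lemma sq_norm_sq_add (z : ℂ) (r : ℝ) :
    ‖z ^ 2 + ((r ^ 2 : ℝ) : ℂ)‖ ^ 2 =
      ((r + |z.im|) ^ 2 + z.re ^ 2) * ((r - |z.im|) ^ 2 + z.re ^ 2) := by
  rw [← Complex.normSq_eq_norm_sq, Complex.normSq_apply]
  have h : |z.im| ^ 2 = z.im ^ 2 := sq_abs _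
  simp only [sq, Complex.add_re, Complex.mul_re, Complex.ofReal_re, Complex.add_im, Complex.mul_im,
    Complex.ofReal_im] at h ⊢
  ring_nf
  ring_nf at h
  rw [show |z.im| ^ 4 = (|z.im| ^ 2) ^ 2 by ring, h]
  ring

/-- Discards the nonnegative cross term `2 r |Im z|` in the harmless factor. -/
lemma mul_le_sq_norm_sq_add (z : ℂ) {r : ℝ} (hr : 0 ≤ r) :
    (‖z‖ ^ 2 + r ^ 2) * ((r - |z.im|) ^ 2 + z.re ^ 2) ≤ ‖z ^ 2 + ((r ^ 2 : ℝ) : ℂ)‖ ^ 2 := by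
  rw [sq_norm_sq_add, ← Complex.normSq_eq_norm_sq, Complex.normSq_apply]
  have h : |z.im| ^ 2 = z.im ^ 2 := sq_abs _
  refine mul_le_mul_of_nonneg_right ?_ (by positivity)
  nlinarith [mul_nonneg hr (abs_nonneg z.im)]

lemma norm_sq_add_pos {z : ℂ} (hz : 0 < z.re) {r : ℝ} :
    0 < ‖z ^ 2 + ((r ^ 2 : ℝ) : ℂ)‖ :=
  norm_pos_iff.2 (Complex.slitPlane_ne_zero (sq_add_mem_slitPlane hz (sq_nonneg r)))

lemma mul_re_le_norm_sq_add {z : ℂ} (hz : 0 < z.re) {r : ℝ} (hr : 0 ≤ r) :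
    r * z.re ≤ ‖z ^ 2 + ((r ^ 2 : ℝ) : ℂ)‖ := by
  refine abs_le_of_sq_le_sq' ?_ (norm_nonneg _) |>.2
  refine le_trans ?_ (mul_le_sq_norm_sq_add z hr)
  rw [mul_pow]
  gcongr
  · nlinarith [sq_nonneg ‖z‖]
  · nlinarith [sq_nonneg (r - |z.im|)]

/-- Locally uniform decay of the kernel. -/
lemma norm_halfSpacePoissonKernel_le_of {z : ℂ} {δ B : ℝ} (hδ : 0 < δ) (hδz : δ ≤ z.re)
    (hB : ‖z‖ ≤ B) (x : EuclideanSpace ℝ (Fin d)) :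
    ‖halfSpacePoissonKernel d z x‖ ≤ poissonConst d * (B * (min (δ ^ 2) 1 * (min (δ ^ 2) 1 / (2 * B ^ 2 + 2))) ^
      (-(((d : ℝ) + 1) / 4))) * (1 + ‖x‖ ^ 2) ^ (-((d : ℝ) + 1) / 2) := by
  have hz : 0 < z.re := hδ.trans_le hδz
  have hB0 : 0 ≤ B := (norm_nonneg z).trans hB
  set m := min (δ ^ 2) 1 with hm
  have hm0 : 0 < m := lt_min (by positivity) one_pos
  have hm1 : m ≤ 1 := min_le_right _ _
  have hre : m ≤ z.re ^ 2 := (min_le_left _ _).trans (by gcongr)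
  have hzre : z.re ^ 2 ≤ ‖z‖ ^ 2 := by
    rw [← Complex.normSq_eq_norm_sq, Complex.normSq_apply]; nlinarith [sq_nonneg z.im]
  have him : |z.im| ^ 2 ≤ B ^ 2 := by
    gcongr; exact (Complex.abs_im_le_norm z).trans hB
  set r := ‖x‖ with hr
  have hr0 : 0 ≤ r := norm_nonneg x
  -- Both factors of `|z² + r²|²` dominate a multiple of `1 + r²`; raising their product to the
  -- power `-(d+1)/4` gives the claimed decay.
  have h1 : m * (1 + r ^ 2) ≤ ‖z‖ ^ 2 + r ^ 2 := by nlinarith [sq_nonneg r]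
  have h2 : m / (2 * B ^ 2 + 2) * (1 + r ^ 2) ≤ (r - |z.im|) ^ 2 + z.re ^ 2 := by
    rw [div_mul_eq_mul_div, div_le_iff₀ (by positivity)]
    have h3 : r ^ 2 ≤ 2 * (r - |z.im|) ^ 2 + 2 * B ^ 2 := by
      nlinarith [sq_nonneg (r - 2 * |z.im|)]
    have h4 : m * (1 + r ^ 2) ≤ 2 * (r - |z.im|) ^ 2 + m * (2 * B ^ 2 + 2) := by
      nlinarith [sq_nonneg (r - |z.im|), sq_nonneg B]
    nlinarith [sq_nonneg (r - |z.im|), sq_nonneg B, mul_nonneg (sq_nonneg (r - |z.im|)) (sq_nonneg B)]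
  have h5 : (m * (m / (2 * B ^ 2 + 2))) * (1 + r ^ 2) ^ 2 ≤ ‖z ^ 2 + ((r ^ 2 : ℝ) : ℂ)‖ ^ 2 := by
    refine le_trans ?_ (mul_le_sq_norm_sq_add z hr0)
    calc _ = (m * (1 + r ^ 2)) * (m / (2 * B ^ 2 + 2) * (1 + r ^ 2)) := by ring
      _ ≤ _ := by gcongr
  rw [norm_halfSpacePoissonKernel, mul_assoc, mul_assoc]
  gcongr
  · exact (poissonConst_pos d).le
  have h6 := Real.rpow_le_rpow_of_nonpos (z := -(((d : ℝ) + 1) / 4)) (by positivity) h5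
    (by have := d.cast_nonneg (α := ℝ); linarith)
  rw [Real.mul_rpow (by positivity) (by positivity), ← Real.rpow_natCast_mul (norm_nonneg _),
    ← Real.rpow_natCast_mul (by positivity)] at h6
  have e1 : (((2 : ℕ) : ℝ) * -(((d : ℝ) + 1) / 4)) = -(((d : ℝ) + 1) / 2) := by push_cast; ring
  rw [e1] at h6
  rw [show -((d : ℝ) + 1) / 2 = -(((d : ℝ) + 1) / 2) by ring]
  exact h6

lemma integrable_halfSpacePoissonKernel {z : ℂ} (hz : 0 < z.re) :
    Integrable (halfSpacePoissonKernel d z) := by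
  refine ((integrable_rpow_neg_one_add_norm_sq_of_lt (d := d) (r := d + 1) (by simp)).const_mul
    _).mono' (continuous_halfSpacePoissonKernel hz).aestronglyMeasurable
    (Eventually.of_forall fun x => norm_halfSpacePoissonKernel_le_of hz le_rfl le_rfl x)

lemma exists_norm_halfSpacePoissonKernel_le {z : ℂ} (hz : 0 < z.re) :
    ∃ C : ℝ, ∀ x : EuclideanSpace ℝ (Fin d), ‖halfSpacePoissonKernel d z x‖ ≤ C := by
  refine ⟨_, fun x => (norm_halfSpacePoissonKernel_le_of hz le_rfl le_rfl x).trans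
    (mul_le_of_le_one_right ?_ ?_)⟩
  · have := poissonConst_pos d
    positivity
  · exact Real.rpow_le_one_of_one_le_of_nonpos (by nlinarith [sq_nonneg ‖x‖])
      (by have := d.cast_nonneg (α := ℝ); linarith)

lemma ofReal_mul_cpow_ofReal {a : ℝ} (ha : 0 < a) (w : ℂ) (c : ℝ) :
    ((a : ℂ) * w) ^ (c : ℂ) = ((a ^ c : ℝ) : ℂ) * w ^ (c : ℂ) := by
  rw [Complex.cpow_ofReal, Complex.cpow_ofReal, Complex.arg_real_mul w ha, norm_mul,
    Complex.norm_real, Real.norm_of_nonneg ha.le, Real.mul_rpow ha.le (norm_nonneg _)]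
  push_cast
  ring

/-- Dilation structure. -/
lemma halfSpacePoissonKernel_smul {s : ℝ} (hs : 0 < s) (z : ℂ)
    (x : EuclideanSpace ℝ (Fin d)) :
    halfSpacePoissonKernel d (s * z) x =
      ((s ^ (-(d : ℝ)) : ℝ) : ℂ) * halfSpacePoissonKernel d z (s⁻¹ • x) := by
  have h1 : ((s : ℂ) * z) ^ 2 + ((‖x‖ ^ 2 : ℝ) : ℂ) =
      ((s ^ 2 : ℝ) : ℂ) * (z ^ 2 + ((‖s⁻¹ • x‖ ^ 2 : ℝ) : ℂ)) := by
    have : (s : ℂ) ≠ 0 := by exact_mod_cast hs.ne'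
    rw [norm_smul, norm_inv, Real.norm_of_nonneg hs.le]
    push_cast
    field_simp
  have h2 : ((s ^ 2) ^ (-(((d : ℝ) + 1) / 2)) : ℝ) * s = s ^ (-(d : ℝ)) := by
    rw [← Real.rpow_natCast_mul hs.le, ← Real.rpow_add_one hs.ne']
    congr 1
    push_cast
    ring
  rw [halfSpacePoissonKernel_eq, halfSpacePoissonKernel_eq, h1,
    ofReal_mul_cpow_ofReal (by positivity), ← h2]
  push_cast
  ring

/-- Modulus of continuity of the kernel in `L¹`. -/
lemma lintegral_enorm_halfSpacePoissonKernel_sub_le {z : ℂ} (hz : 0 < z.re)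
    (h : EuclideanSpace ℝ (Fin d)) :
    ∫⁻ x, ‖halfSpacePoissonKernel d z (x - h) - halfSpacePoissonKernel d z x‖ₑ ≤
      ENNReal.ofReal ((d + 1) * ‖h‖ / z.re) * ∫⁻ x, ‖halfSpacePoissonKernel d z x‖ₑ := by
  set c : ℝ := -(((d : ℝ) + 1) / 2) with hc
  set w : EuclideanSpace ℝ (Fin d) → ℝ → ℂ := fun x s => z ^ 2 + ((‖x - s • h‖ ^ 2 : ℝ) : ℂ) with hw
  have hslit : ∀ x s, w x s ∈ Complex.slitPlane := fun x s => sq_add_mem_slitPlane hz (sq_nonneg _)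
  set D : EuclideanSpace ℝ (Fin d) → ℝ → ℂ := fun x s => (poissonConst d : ℂ) *
    (z * ((c : ℂ) * (w x s) ^ ((c : ℂ) - 1) * ((-(2 * inner ℝ (x - s • h) h) : ℝ) : ℂ))) with hD
  have hderiv : ∀ x s, HasDerivAt (fun s : ℝ => halfSpacePoissonKernel d z (x - s • h)) (D x s) s := by
    intro x s
    have h1 : HasDerivAt (fun s : ℝ => x - s • h) (-h) s := by
      simpa using ((hasDerivAt_id s).smul_const h).const_sub x
    have h2 : HasDerivAt (fun s : ℝ => ‖x - s • h‖ ^ 2) (-(2 * inner ℝ (x - s • h) h)) s := by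
      convert h1.norm_sq using 1
      rw [inner_neg_right]; ring
    have h3 : HasDerivAt (w x) ((-(2 * inner ℝ (x - s • h) h) : ℝ) : ℂ) s :=
      (h2.ofReal_comp).const_add _
    have h4 := (((((hasDerivAt_id (w x s)).cpow_const (c := (c : ℂ)) (hslit x s)).comp s
      h3).const_mul z).const_mul (poissonConst d : ℂ)).congr_deriv (g' := D x s) (by simp [hD])
    refine h4.congr_of_eventuallyEq (Eventually.of_forall fun s => ?_)
    exact halfSpacePoissonKernel_eq z _
  have hDc : ∀ x, Continuous (D x) := by
    intro x
    have : Continuous fun s => (w x s) ^ ((c : ℂ) - 1) :=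
      Continuous.cpow (by fun_prop) continuous_const (hslit x)
    fun_prop
  -- Differentiating the power along the segment costs a factor at most `(d + 1) ‖h‖ r / |z² + r²|`,
  -- with `r = ‖x - s h‖`, and `r Re z ≤ |z² + r²|`.
  have hDn : ∀ x s, ‖D x s‖ₑ ≤ ENNReal.ofReal ((d + 1) * ‖h‖ / z.re) *
      ‖halfSpacePoissonKernel d z (x - s • h)‖ₑ := by
    intro x s
    rw [← ofReal_norm, ← ofReal_norm, ← ENNReal.ofReal_mul (by positivity)]
    refine ENNReal.ofReal_le_ofReal ?_
    have hwpos : 0 < ‖w x s‖ := norm_pos_iff.2 (Complex.slitPlane_ne_zero (hslit x s))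
    have e1 : ((c : ℂ) - 1) = ((c - 1 : ℝ) : ℂ) := by push_cast; rfl
    rw [norm_halfSpacePoissonKernel, hD]
    simp only [norm_mul]
    rw [e1, Complex.norm_cpow_real, Complex.norm_real, Complex.norm_real, Complex.norm_real,
      Real.norm_of_nonneg (poissonConst_pos d).le, Real.rpow_sub_one hwpos.ne']
    have e2 : ‖c‖ = ((d : ℝ) + 1) / 2 := by
      rw [hc, norm_neg, Real.norm_of_nonneg (by positivity)]
    have e3 : ‖-(2 * inner ℝ (x - s • h) h)‖ ≤ 2 * (‖x - s • h‖ * ‖h‖) := by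
      rw [norm_neg, norm_mul, Real.norm_of_nonneg (by norm_num : (0 : ℝ) ≤ 2)]
      gcongr
      exact norm_inner_le_norm _ _
    have e4 : ‖x - s • h‖ * z.re ≤ ‖w x s‖ := mul_re_le_norm_sq_add hz (norm_nonneg _)
    have e5 : ‖x - s • h‖ / ‖w x s‖ ≤ 1 / z.re := by
      rw [div_le_div_iff₀ hwpos hz]; linarith
    rw [e2]
    calc poissonConst d * (‖z‖ * (((d : ℝ) + 1) / 2 * (‖w x s‖ ^ c / ‖w x s‖) *
          ‖-(2 * inner ℝ (x - s • h) h)‖))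
        ≤ poissonConst d * (‖z‖ * (((d : ℝ) + 1) / 2 * (‖w x s‖ ^ c / ‖w x s‖) *
          (2 * (‖x - s • h‖ * ‖h‖)))) := by
          have := poissonConst_pos d
          gcongr
      _ = ((d + 1) * ‖h‖ * (‖x - s • h‖ / ‖w x s‖)) * (poissonConst d * (‖z‖ * ‖w x s‖ ^ c)) := by
          ring
      _ ≤ ((d + 1) * ‖h‖ * (1 / z.re)) * (poissonConst d * (‖z‖ * ‖w x s‖ ^ c)) := by
          have := poissonConst_pos d
          gcongr
      _ = _ := by rw [mul_one_div]
  have hP := continuous_halfSpacePoissonKernel (d := d) hz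
  calc ∫⁻ x, ‖halfSpacePoissonKernel d z (x - h) - halfSpacePoissonKernel d z x‖ₑ
      ≤ ∫⁻ x, ∫⁻ s in Set.Ioc (0 : ℝ) 1, ENNReal.ofReal ((d + 1) * ‖h‖ / z.re) *
        ‖halfSpacePoissonKernel d z (x - s • h)‖ₑ := by
        refine lintegral_mono fun x => ?_
        have := intervalIntegral.integral_eq_sub_of_hasDerivAt (a := 0) (b := 1)
          (fun s _ => hderiv x s) ((hDc x).intervalIntegrable _ _)
        simp only [one_smul, zero_smul, sub_zero] at this
        rw [← this, intervalIntegral.integral_of_le zero_le_one]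
        exact (enorm_integral_le_lintegral_enorm _).trans (lintegral_mono fun s => hDn x s)
    _ = ∫⁻ s in Set.Ioc (0 : ℝ) 1, ∫⁻ x, ENNReal.ofReal ((d + 1) * ‖h‖ / z.re) *
        ‖halfSpacePoissonKernel d z (x - s • h)‖ₑ := by
        refine lintegral_lintegral_swap ?_
        refine Measurable.aemeasurable ?_
        have : Continuous fun q : EuclideanSpace ℝ (Fin d) × ℝ =>
          halfSpacePoissonKernel d z (q.1 - q.2 • h) := hP.comp (by fun_prop)
        exact (this.enorm.measurable).const_mul _
    _ = ∫⁻ s in Set.Ioc (0 : ℝ) 1, ENNReal.ofReal ((d + 1) * ‖h‖ / z.re) *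
        ∫⁻ x, ‖halfSpacePoissonKernel d z x‖ₑ := by
        refine lintegral_congr fun s => ?_
        rw [lintegral_const_mul' _ _ ENNReal.ofReal_ne_top,
          lintegral_sub_right_eq_self (fun x => ‖halfSpacePoissonKernel d z x‖ₑ)]
    _ = _ := by simp

/-- Integration of radial functions in polar coordinates. -/
lemma lintegral_fun_norm (hd : 1 ≤ d) {f : ℝ → ℝ≥0∞} (hf : Measurable f) :
    ∫⁻ x : EuclideanSpace ℝ (Fin d), f ‖x‖ =
      (d * volume (Metric.ball (0 : EuclideanSpace ℝ (Fin d)) 1)) *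
        ∫⁻ y in Set.Ioi (0 : ℝ), ENNReal.ofReal (y ^ (d - 1)) * f y := by
  have : Nonempty (Fin d) := ⟨⟨0, hd⟩⟩
  have : Nontrivial (EuclideanSpace ℝ (Fin d)) := inferInstance
  set μ : Measure (EuclideanSpace ℝ (Fin d)) := volume
  calc ∫⁻ x, f ‖x‖ ∂μ = ∫⁻ x : ({(0)}ᶜ : Set (EuclideanSpace ℝ (Fin d))), f ‖x.1‖ ∂(μ.comap (↑)) := by
        rw [lintegral_subtype_comap (measurableSet_singleton _).compl fun x => f ‖x‖,
          restrict_compl_singleton]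
    _ = ∫⁻ x, f x.2 ∂μ.toSphere.prod (.volumeIoiPow (Module.finrank ℝ (EuclideanSpace ℝ (Fin d)) - 1)) := by
        rw [← μ.measurePreserving_homeomorphUnitSphereProd.lintegral_comp_emb
          (Homeomorph.measurableEmbedding _)]
        simp
    _ = μ.toSphere Set.univ * ∫⁻ x : Set.Ioi (0 : ℝ), f x ∂(.volumeIoiPow (Module.finrank ℝ (EuclideanSpace ℝ (Fin d)) - 1)) := by
        rw [lintegral_prod_symm' _ (by fun_prop)]
        simp only [lintegral_const, finrank_euclideanSpace, Fintype.card_fin]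
        rw [lintegral_mul_const _ (by fun_prop), mul_comm]
    _ = _ := by
        rw [μ.toSphere_apply_univ, finrank_euclideanSpace_fin, Measure.volumeIoiPow,
          lintegral_withDensity_eq_lintegral_mul _ (by fun_prop) (by fun_prop)]
        congr 1
        exact lintegral_subtype_comap measurableSet_Ioi fun y => ENNReal.ofReal (y ^ (d - 1)) * f y

lemma lintegral_comp_inv_smul {s : ℝ} (hs : 0 < s) {f : EuclideanSpace ℝ (Fin d) → ℝ≥0∞}
    (hf : Measurable f) :
    ∫⁻ x, ENNReal.ofReal (s ^ (-(d : ℝ))) * f (s⁻¹ • x) = ∫⁻ x, f x := by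
  have h := Measure.map_addHaar_smul (volume : Measure (EuclideanSpace ℝ (Fin d)))
    (inv_ne_zero hs.ne')
  have h2 : ∫⁻ x, f (s⁻¹ • x) = ENNReal.ofReal (s ^ d) * ∫⁻ x, f x := by
    rw [← lintegral_map hf (by fun_prop), h, lintegral_smul_measure, finrank_euclideanSpace_fin]
    rw [abs_of_pos (by positivity), inv_pow, inv_inv, smul_eq_mul]
  rw [lintegral_const_mul' _ _ ENNReal.ofReal_ne_top, h2, ← mul_assoc,
    ← ENNReal.ofReal_mul (by positivity), ← Real.rpow_natCast s d, ← Real.rpow_add hs]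
  simp

end PoissonBounds

/-! ### Integral bounds for parameters on the unit circle. -/

section PoissonIntegral

variable {d : ℕ}

lemma re_le_norm_sq_add {z : ℂ} (hz1 : ‖z‖ = 1) {r : ℝ} (hr : 0 ≤ r) :
    z.re ≤ ‖z ^ 2 + ((r ^ 2 : ℝ) : ℂ)‖ := by
  refine abs_le_of_sq_le_sq' ?_ (norm_nonneg _) |>.2
  refine le_trans ?_ (mul_le_sq_norm_sq_add z hr)
  rw [hz1]
  nlinarith [sq_nonneg (r - |z.im|), sq_nonneg r, mul_nonneg (sq_nonneg (r - |z.im|)) (sq_nonneg r),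
    mul_nonneg (sq_nonneg z.re) (sq_nonneg r)]

lemma abs_sub_im_le_norm_sq_add {z : ℂ} (hz1 : ‖z‖ = 1) {r : ℝ} (hr : 0 ≤ r) :
    |r - (|z.im|)| ≤ ‖z ^ 2 + ((r ^ 2 : ℝ) : ℂ)‖ := by
  refine abs_le_of_sq_le_sq' ?_ (norm_nonneg _) |>.2
  refine le_trans ?_ (mul_le_sq_norm_sq_add z hr)
  rw [hz1, sq_abs]
  nlinarith [sq_nonneg (r - |z.im|), sq_nonneg r, mul_nonneg (sq_nonneg (r - |z.im|)) (sq_nonneg r),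
    mul_nonneg (sq_nonneg z.re) (sq_nonneg r), sq_nonneg z.re]

lemma sq_div_two_le_norm_sq_add {z : ℂ} (hz1 : ‖z‖ = 1) {r : ℝ} (hr : 2 ≤ r) :
    r ^ 2 / 2 ≤ ‖z ^ 2 + ((r ^ 2 : ℝ) : ℂ)‖ := by
  have h1 := norm_sub_norm_le ((r ^ 2 : ℝ) : ℂ) (-(z ^ 2))
  rw [sub_neg_eq_add, add_comm, norm_neg, norm_pow, hz1, Complex.norm_real,
    Real.norm_of_nonneg (sq_nonneg r)] at h1
  nlinarith

lemma lintegral_rpow_neg_two_Ioi {R : ℝ} (hR : 0 < R) :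
    ∫⁻ y in Set.Ioi R, ENNReal.ofReal (y ^ (-2 : ℝ)) = ENNReal.ofReal R⁻¹ := by
  rw [← ofReal_integral_eq_lintegral_ofReal (integrableOn_Ioi_rpow_of_lt (by norm_num) hR),
    integral_Ioi_rpow_of_lt (by norm_num) hR]
  · norm_num
    rw [Real.rpow_neg_one]
  · filter_upwards [ae_restrict_mem measurableSet_Ioi] with y hy
    exact Real.rpow_nonneg (hR.trans hy).le _

lemma lintegral_ball_rpow_neg_lt_top {b : ℝ} (hb : b < 1) :
    ∫⁻ s in Metric.ball (0 : ℝ) 4, ENNReal.ofReal (|s| ^ (-b)) < ∞ := by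
  have h : IntegrableOn (fun s : ℝ => ‖s‖ ^ (-b)) (Metric.ball 0 4) := by
    rw [integrableOn_fun_norm_addHaar (volume : Measure ℝ) (f := fun s => s ^ (-b))]
    simp only [Module.finrank_self, tsub_self, pow_zero, one_smul]
    exact ((intervalIntegral.intervalIntegrable_rpow' (a := 0) (b := 4)
      (by linarith : -1 < -b)).1).mono_set Set.Ioo_subset_Ioc_self
  have h2 := h.hasFiniteIntegral
  rw [hasFiniteIntegral_iff_ofReal (Eventually.of_forall fun s => by positivity)] at h2
  exact h2

lemma enorm_halfSpacePoissonKernel {z : ℂ} (hz1 : ‖z‖ = 1) (x : EuclideanSpace ℝ (Fin d)) :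
    ‖halfSpacePoissonKernel d z x‖ₑ = ENNReal.ofReal (poissonConst d) *
      ENNReal.ofReal (‖z ^ 2 + ((‖x‖ ^ 2 : ℝ) : ℂ)‖ ^ (-(((d : ℝ) + 1) / 2))) := by
  rw [← ofReal_norm, norm_halfSpacePoissonKernel, hz1, one_mul,
    ENNReal.ofReal_mul (poissonConst_pos d).le]

lemma measurable_norm_sq_add_rpow (z : ℂ) (c : ℝ) :
    Measurable fun y : ℝ => ENNReal.ofReal (‖z ^ 2 + ((y ^ 2 : ℝ) : ℂ)‖ ^ c) := by
  fun_prop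

lemma ofReal_pow_mul_le_of_two_le (hd : 1 ≤ d) {z : ℂ} (hz1 : ‖z‖ = 1) {y : ℝ} (hy : 2 ≤ y) :
    ENNReal.ofReal (y ^ (d - 1)) *
      ENNReal.ofReal (‖z ^ 2 + ((y ^ 2 : ℝ) : ℂ)‖ ^ (-(((d : ℝ) + 1) / 2))) ≤
    ENNReal.ofReal (2 ^ (((d : ℝ) + 1) / 2)) * ENNReal.ofReal (y ^ (-2 : ℝ)) := by
  have hy0 : 0 < y := by linarith
  rw [← ENNReal.ofReal_mul (by positivity), ← ENNReal.ofReal_mul (by positivity)]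
  refine ENNReal.ofReal_le_ofReal ?_
  have h1 := Real.rpow_le_rpow_of_nonpos (z := -(((d : ℝ) + 1) / 2)) (by positivity)
    (sq_div_two_le_norm_sq_add hz1 hy) (by have := d.cast_nonneg (α := ℝ); linarith)
  calc _ ≤ y ^ (d - 1) * (y ^ 2 / 2) ^ (-(((d : ℝ) + 1) / 2)) := by gcongr
    _ = _ := by
      rw [Real.div_rpow (by positivity) (by norm_num), Real.rpow_neg zero_le_two, div_inv_eq_mul,
        ← Real.rpow_natCast_mul hy0.le, ← Real.rpow_natCast y (d - 1), ← mul_assoc,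
        ← Real.rpow_add hy0, Nat.cast_sub hd, mul_comm]
      congr 2
      push_cast
      ring

/-- `L¹` bound of the kernel on the unit circle of parameters. -/
lemma exists_lintegral_halfSpacePoissonKernel_le_of_lt (hd : 1 ≤ d) {α : ℝ}
    (hα : ((d : ℝ) - 1) / 2 < α) (hα2 : α < ((d : ℝ) + 1) / 2) :
    ∃ C : ℝ≥0, ∀ z : ℂ, ‖z‖ = 1 → 0 < z.re →
      ∫⁻ x : EuclideanSpace ℝ (Fin d), ‖halfSpacePoissonKernel d z x‖ₑ ≤
        C * ENNReal.ofReal (z.re ^ (-α)) := by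
  have hd1 : (1 : ℝ) ≤ d := by exact_mod_cast hd
  have hα0 : 0 < α := by linarith
  set a := ((d : ℝ) + 1) / 2 with ha
  set G := ∫⁻ s in Metric.ball (0 : ℝ) 4, ENNReal.ofReal (|s| ^ (-(a - α))) with hG
  have hGfin : G < ∞ := lintegral_ball_rpow_neg_lt_top (by linarith)
  set V := (d * volume (Metric.ball (0 : EuclideanSpace ℝ (Fin d)) 1)) with hV
  have hVfin : V ≠ ∞ := ENNReal.mul_ne_top (by simp) measure_ball_lt_top.ne
  set C : ℝ≥0∞ := ENNReal.ofReal (poissonConst d) * (V * (ENNReal.ofReal (2 ^ (d - 1)) * G +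
    ENNReal.ofReal (2 ^ a) * ENNReal.ofReal (2 : ℝ)⁻¹)) with hC
  have hCfin : C ≠ ∞ := by
    refine ENNReal.mul_ne_top ENNReal.ofReal_ne_top (ENNReal.mul_ne_top hVfin
      (ENNReal.add_ne_top.2 ⟨ENNReal.mul_ne_top ENNReal.ofReal_ne_top hGfin.ne, by finiteness⟩))
  refine ⟨C.toNNReal, fun z hz1 hz => ?_⟩
  rw [ENNReal.coe_toNNReal hCfin]
  have hre1 : z.re ≤ 1 := by
    rw [← hz1]; exact (le_abs_self _).trans (Complex.abs_re_le_norm z)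
  have him1 : |z.im| ≤ 1 := by
    rw [← hz1]; exact Complex.abs_im_le_norm z
  set Dl := ENNReal.ofReal (z.re ^ (-α)) with hDl
  have hDl1 : 1 ≤ Dl := by
    rw [hDl, ENNReal.one_le_ofReal]
    exact Real.one_le_rpow_of_pos_of_le_one_of_nonpos hz hre1 (by linarith)
  simp_rw [enorm_halfSpacePoissonKernel hz1]
  rw [lintegral_const_mul' _ _ ENNReal.ofReal_ne_top,
    lintegral_fun_norm hd (measurable_norm_sq_add_rpow z _), ← hV, hC,
    mul_assoc (ENNReal.ofReal (poissonConst d)), mul_assoc V]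
  refine mul_le_mul' le_rfl (mul_le_mul' le_rfl ?_)
  have hsplit : Set.Ioi (0 : ℝ) = Set.Ioc 0 2 ∪ Set.Ioi 2 :=
    (Set.Ioc_union_Ioi_eq_Ioi zero_le_two).symm
  rw [hsplit, add_mul]
  refine (lintegral_union_le _ _ _).trans (add_le_add ?_ ?_)
  · have hne : ∀ᵐ y ∂(volume : Measure ℝ), y ≠ |z.im| := by
      simp [ae_iff, measure_singleton]
    calc _ ≤ ∫⁻ y in Set.Ioc (0 : ℝ) 2, (ENNReal.ofReal (2 ^ (d - 1)) * Dl) *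
          ENNReal.ofReal (|y - (|z.im|)| ^ (-(a - α))) := by
          refine lintegral_mono_ae ?_
          filter_upwards [ae_restrict_mem measurableSet_Ioc, ae_restrict_of_ae hne] with y hy hyne
          have hy0 : 0 < y := hy.1
          have hpos : 0 < |y - (|z.im|)| := abs_pos.2 (sub_ne_zero.2 hyne)
          have hN : 0 < ‖z ^ 2 + ((y ^ 2 : ℝ) : ℂ)‖ := norm_sq_add_pos hz
          -- The power is split between two lower bounds for `|z² + y²|`: the part `-α` uses `Re z`
          -- and gives the constant, the part `-(a - α)` uses `|y - |Im z||`. The latter is locally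
          -- integrable because `a - α < 1`, which is the condition `α > (d-1)/2`.
          rw [mul_assoc, show -a = -α + -(a - α) by ring, Real.rpow_add hN,
            ENNReal.ofReal_mul (by positivity)]
          refine mul_le_mul' (ENNReal.ofReal_le_ofReal (pow_le_pow_left₀ hy0.le hy.2 _))
            (mul_le_mul' (ENNReal.ofReal_le_ofReal ?_) (ENNReal.ofReal_le_ofReal ?_))
          · exact Real.rpow_le_rpow_of_nonpos hz (re_le_norm_sq_add hz1 hy0.le) (by linarith)
          · exact Real.rpow_le_rpow_of_nonpos hpos (abs_sub_im_le_norm_sq_add hz1 hy0.le)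
              (by linarith)
      _ = (ENNReal.ofReal (2 ^ (d - 1)) * Dl) * ∫⁻ y in Set.Ioc (0 : ℝ) 2,
          ENNReal.ofReal (|y - (|z.im|)| ^ (-(a - α))) :=
          lintegral_const_mul' _ _ (ENNReal.mul_ne_top ENNReal.ofReal_ne_top ENNReal.ofReal_ne_top)
      _ ≤ (ENNReal.ofReal (2 ^ (d - 1)) * Dl) * G := by
          gcongr
          rw [hG, ← lintegral_indicator measurableSet_Ioc, ← lintegral_indicator measurableSet_ball,
            ← lintegral_sub_right_eq_self (Set.indicator (Metric.ball (0 : ℝ) 4)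
              fun s => ENNReal.ofReal (|s| ^ (-(a - α)))) (|z.im|)]
          refine lintegral_mono fun y => ?_
          by_cases hy : y ∈ Set.Ioc (0 : ℝ) 2
          · have : y - |z.im| ∈ Metric.ball (0 : ℝ) 4 := by
              rw [mem_ball_zero_iff, Real.norm_eq_abs, abs_lt]
              constructor <;> linarith [hy.1, hy.2, abs_nonneg z.im]
            rw [Set.indicator_of_mem hy, Set.indicator_of_mem this]
          · rw [Set.indicator_of_notMem hy]; exact zero_le
      _ = _ := by ring
  · calc _ ≤ ∫⁻ y in Set.Ioi (2 : ℝ), ENNReal.ofReal (2 ^ a) * ENNReal.ofReal (y ^ (-2 : ℝ)) :=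
          setLIntegral_mono' measurableSet_Ioi fun y hy =>
            ofReal_pow_mul_le_of_two_le hd hz1 (le_of_lt hy)
      _ = ENNReal.ofReal (2 ^ a) * ENNReal.ofReal (2 : ℝ)⁻¹ := by
          rw [lintegral_const_mul' _ _ ENNReal.ofReal_ne_top, lintegral_rpow_neg_two_Ioi two_pos]
      _ ≤ _ := le_mul_of_one_le_right zero_le hDl1

/-- Tail bound of the kernel on the unit circle of parameters. -/
lemma exists_setLIntegral_halfSpacePoissonKernel_le (hd : 1 ≤ d) :
    ∃ C : ℝ≥0, ∀ z : ℂ, ‖z‖ = 1 → ∀ R : ℝ, 2 ≤ R →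
      ∫⁻ x in {x : EuclideanSpace ℝ (Fin d) | R ≤ ‖x‖}, ‖halfSpacePoissonKernel d z x‖ₑ ≤
        C * ENNReal.ofReal R⁻¹ := by
  set a := ((d : ℝ) + 1) / 2 with ha
  set V := (d * volume (Metric.ball (0 : EuclideanSpace ℝ (Fin d)) 1)) with hV
  have hVfin : V ≠ ∞ := ENNReal.mul_ne_top (by simp) measure_ball_lt_top.ne
  set C : ℝ≥0∞ := ENNReal.ofReal (poissonConst d) * (V * ENNReal.ofReal (2 ^ a)) with hC
  have hCfin : C ≠ ∞ := by finiteness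
  refine ⟨C.toNNReal, fun z hz1 R hR => ?_⟩
  have hR0 : 0 < R := by linarith
  rw [ENNReal.coe_toNNReal hCfin]
  have hms : MeasurableSet {x : EuclideanSpace ℝ (Fin d) | R ≤ ‖x‖} :=
    measurableSet_le measurable_const measurable_norm
  have h1 : ∀ x : EuclideanSpace ℝ (Fin d),
      Set.indicator {x : EuclideanSpace ℝ (Fin d) | R ≤ ‖x‖}
      (fun x => ‖halfSpacePoissonKernel d z x‖ₑ) x = ENNReal.ofReal (poissonConst d) *
      Set.indicator (Set.Ici R) (fun y => ENNReal.ofReal (‖z ^ 2 + ((y ^ 2 : ℝ) : ℂ)‖ ^ (-a))) ‖x‖ := by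
    intro x
    by_cases hx : R ≤ ‖x‖
    · rw [Set.indicator_of_mem (by exact hx), Set.indicator_of_mem (by exact hx),
        enorm_halfSpacePoissonKernel hz1]
    · rw [Set.indicator_of_notMem (by exact hx), Set.indicator_of_notMem (by exact hx), mul_zero]
  rw [← lintegral_indicator hms]
  simp_rw [h1]
  rw [lintegral_const_mul' _ _ ENNReal.ofReal_ne_top,
    lintegral_fun_norm hd ((measurable_norm_sq_add_rpow z _).indicator measurableSet_Ici), ← hV, hC,
    mul_assoc (ENNReal.ofReal (poissonConst d)), mul_assoc V]
  refine mul_le_mul' le_rfl (mul_le_mul' le_rfl ?_)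
  calc _ = ∫⁻ y in Set.Ioi (0 : ℝ), Set.indicator (Set.Ici R) (fun y => ENNReal.ofReal (y ^ (d - 1)) *
        ENNReal.ofReal (‖z ^ 2 + ((y ^ 2 : ℝ) : ℂ)‖ ^ (-a))) y := by
        refine lintegral_congr fun y => ?_
        by_cases hy : y ∈ Set.Ici R
        · rw [Set.indicator_of_mem hy, Set.indicator_of_mem hy]
        · rw [Set.indicator_of_notMem hy, Set.indicator_of_notMem hy, mul_zero]
    _ ≤ ∫⁻ y, Set.indicator (Set.Ici R) (fun y => ENNReal.ofReal (y ^ (d - 1)) *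
        ENNReal.ofReal (‖z ^ 2 + ((y ^ 2 : ℝ) : ℂ)‖ ^ (-a))) y := setLIntegral_le_lintegral _ _
    _ = ∫⁻ y in Set.Ici R, ENNReal.ofReal (y ^ (d - 1)) *
        ENNReal.ofReal (‖z ^ 2 + ((y ^ 2 : ℝ) : ℂ)‖ ^ (-a)) := lintegral_indicator measurableSet_Ici _
    _ ≤ ∫⁻ y in Set.Ici R, ENNReal.ofReal (2 ^ a) * ENNReal.ofReal (y ^ (-2 : ℝ)) :=
        setLIntegral_mono' measurableSet_Ici fun y hy =>
          ofReal_pow_mul_le_of_two_le hd hz1 (hR.trans hy)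
    _ = _ := by
        rw [lintegral_const_mul' _ _ ENNReal.ofReal_ne_top, setLIntegral_congr Ioi_ae_eq_Ici.symm,
          lintegral_rpow_neg_two_Ioi hR0]

/-- The Hörmander integral of the Poisson kernel. -/
def poissonHormander (d : ℕ) (z : ℂ) (h : EuclideanSpace ℝ (Fin d)) : ℝ≥0∞ :=
  ∫⁻ x in {x : EuclideanSpace ℝ (Fin d) | 2 * ‖h‖ ≤ ‖x‖},
    ‖halfSpacePoissonKernel d z (x - h) - halfSpacePoissonKernel d z x‖ₑ

/-- For `‖h‖ ≥ 2` the tail of the kernel gives decay `1/‖h‖`. For smaller `h` the trivial bound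
`2‖P_z‖₁` is interpolated with the bound `(d + 1)(‖h‖ / Re z) ‖P_z‖₁` from the modulus of
continuity. The decay on both sides of `‖h‖ = 1` makes the dyadic sum converge. -/
lemma exists_poissonHormander_le (hd : 1 ≤ d) {α : ℝ} (hα : ((d : ℝ) - 1) / 2 < α) :
    ∃ C : ℝ≥0, ∃ ε : ℝ, 0 < ε ∧ ∀ z : ℂ, ‖z‖ = 1 → 0 < z.re →
      ∀ h : EuclideanSpace ℝ (Fin d), h ≠ 0 →
      poissonHormander d z h ≤ C * ENNReal.ofReal (z.re ^ (-α)) *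
        ENNReal.ofReal (2 ^ (-(ε * |Real.logb 2 ‖h‖|))) := by
  -- The `L¹` bound is used with `α'`; the gap `α - α'` pays for the extra factor `(Re z)^{-ε}` of
  -- the interpolation.
  obtain ⟨α', h1, h2, h3⟩ : ∃ α', ((d : ℝ) - 1) / 2 < α' ∧ α' < ((d : ℝ) + 1) / 2 ∧ α' < α := by
    obtain ⟨α', h1, h2⟩ := exists_between (lt_min hα (by linarith : ((d : ℝ) - 1) / 2 < ((d : ℝ) + 1) / 2))
    exact ⟨α', h1, h2.trans_le (min_le_right _ _), h2.trans_le (min_le_left _ _)⟩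
  have hd1 : (1 : ℝ) ≤ d := by exact_mod_cast hd
  set ε := min (α - α') 1 with hε
  have hε0 : 0 < ε := lt_min (by linarith) one_pos
  have hε1 : ε ≤ 1 := min_le_right _ _
  obtain ⟨C1, hC1⟩ := exists_lintegral_halfSpacePoissonKernel_le_of_lt hd h1 h2
  obtain ⟨C2, hC2⟩ := exists_setLIntegral_halfSpacePoissonKernel_le hd
  refine ⟨(d + 2) * C1 * 4 + 2 * C2, ε, hε0, fun z hz1 hz h hh => ?_⟩
  have hre1 : z.re ≤ 1 := by
    rw [← hz1]; exact (le_abs_self _).trans (Complex.abs_re_le_norm z)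
  have hh0 : 0 < ‖h‖ := norm_pos_iff.2 hh
  have hP := continuous_halfSpacePoissonKernel (d := d) hz
  set L := Real.logb 2 ‖h‖ with hL
  have hhL : ‖h‖ = 2 ^ L := (Real.rpow_logb two_pos (by norm_num) hh0).symm
  have hms : ∀ r : ℝ, MeasurableSet {x : EuclideanSpace ℝ (Fin d) | r ≤ ‖x‖} := fun r =>
    measurableSet_le measurable_const measurable_norm
  have hδ1 : 1 ≤ z.re ^ (-α) := 
    Real.one_le_rpow_of_pos_of_le_one_of_nonpos hz hre1 (by linarith)
  -- the trivial bound by the tail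
  have htriv : ∀ s : Set (EuclideanSpace ℝ (Fin d)), 
      ∫⁻ x in s, ‖halfSpacePoissonKernel d z (x - h) - halfSpacePoissonKernel d z x‖ₑ ≤
      (∫⁻ x in s, ‖halfSpacePoissonKernel d z (x - h)‖ₑ) + 
        ∫⁻ x in s, ‖halfSpacePoissonKernel d z x‖ₑ := by
    intro s
    rw [← lintegral_add_right _ (by exact hP.enorm.measurable)]
    exact lintegral_mono fun x => enorm_sub_le
  rcases le_or_gt 2 ‖h‖ with hbig | hsmall
  · have hL1 : 1 ≤ L := by
      rw [hL, Real.le_logb_iff_rpow_le one_lt_two hh0]; simpa using hbig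
    have e1 : ∫⁻ x in {x : EuclideanSpace ℝ (Fin d) | 2 * ‖h‖ ≤ ‖x‖}, ‖halfSpacePoissonKernel d z (x - h)‖ₑ
        ≤ ∫⁻ x in {x : EuclideanSpace ℝ (Fin d) | ‖h‖ ≤ ‖x‖}, ‖halfSpacePoissonKernel d z x‖ₑ := by
      rw [← lintegral_indicator (hms _), ← lintegral_indicator (hms _),
        ← lintegral_sub_right_eq_self (Set.indicator {x : EuclideanSpace ℝ (Fin d) | ‖h‖ ≤ ‖x‖}
          fun x => ‖halfSpacePoissonKernel d z x‖ₑ) h]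
      refine lintegral_mono fun x => ?_
      by_cases hx : 2 * ‖h‖ ≤ ‖x‖
      · have : ‖h‖ ≤ ‖x - h‖ := by linarith [norm_sub_norm_le x h]
        rw [Set.indicator_of_mem (by exact hx), Set.indicator_of_mem (by exact this)]
      · rw [Set.indicator_of_notMem (by exact hx)]; exact zero_le
    have e2 : ∫⁻ x in {x : EuclideanSpace ℝ (Fin d) | 2 * ‖h‖ ≤ ‖x‖}, ‖halfSpacePoissonKernel d z x‖ₑ
        ≤ ∫⁻ x in {x : EuclideanSpace ℝ (Fin d) | ‖h‖ ≤ ‖x‖}, ‖halfSpacePoissonKernel d z x‖ₑ :=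
      lintegral_mono_set fun x hx => by
        have : 2 * ‖h‖ ≤ ‖x‖ := hx
        exact (by linarith : ‖h‖ ≤ ‖x‖)
    calc poissonHormander d z h ≤ C2 * ENNReal.ofReal ‖h‖⁻¹ + C2 * ENNReal.ofReal ‖h‖⁻¹ :=
          (htriv _).trans (add_le_add (e1.trans (hC2 z hz1 _ hbig)) (e2.trans (hC2 z hz1 _ hbig)))
      _ = ((2 * C2 : ℝ≥0) : ℝ≥0∞) * ENNReal.ofReal 1 * ENNReal.ofReal ‖h‖⁻¹ := by
          push_cast; simp; ring
      _ ≤ _ := by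
          gcongr
          · exact_mod_cast le_add_self
          · rw [abs_of_pos (by linarith), hhL, ← Real.rpow_neg zero_le_two]
            refine Real.rpow_le_rpow_of_exponent_le one_le_two ?_
            nlinarith
  · have b1 : poissonHormander d z h ≤ 2 * (C1 * ENNReal.ofReal (z.re ^ (-α'))) := by
      refine (setLIntegral_le_lintegral _ _).trans ?_
      have := htriv Set.univ
      rw [Measure.restrict_univ,
        lintegral_sub_right_eq_self (fun x => ‖halfSpacePoissonKernel d z x‖ₑ), ← two_mul] at this
      refine this.trans ?_
      gcongr
      exact hC1 z hz1 hz
    have b2 : poissonHormander d z h ≤ ENNReal.ofReal ((d + 1) * ‖h‖ / z.re) *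
        (C1 * ENNReal.ofReal (z.re ^ (-α'))) := by
      refine (setLIntegral_le_lintegral _ _).trans
        ((lintegral_enorm_halfSpacePoissonKernel_sub_le hz h).trans ?_)
      gcongr
      exact hC1 z hz1 hz
    have hL1 : L < 1 := by
      rw [hL, Real.logb_lt_iff_lt_rpow one_lt_two hh0]; simpa using hsmall
    -- With `q = ‖h‖ / Re z` and `0 < ε ≤ 1`, both `2` for `q ≥ 1` and `(d + 1) q` for `q < 1` are
    -- at most `(d + 2) q^ε`.
    have b3 : poissonHormander d z h ≤ ENNReal.ofReal ((d + 2) * (‖h‖ / z.re) ^ ε) *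
        (C1 * ENNReal.ofReal (z.re ^ (-α'))) := by
      rcases le_or_gt 1 (‖h‖ / z.re) with hq | hq
      · refine b1.trans ?_
        gcongr
        refine (ENNReal.ofReal_ofNat 2).symm.trans_le (ENNReal.ofReal_le_ofReal ?_)
        have := Real.one_le_rpow hq hε0.le
        nlinarith
      · refine b2.trans ?_
        gcongr
        rw [mul_div_assoc]
        have hq0 : 0 < ‖h‖ / z.re := by positivity
        have := Real.rpow_le_rpow_of_exponent_ge hq0 hq.le hε1
        rw [Real.rpow_one] at this
        nlinarith
    refine b3.trans ?_
    -- The factor 4 covers `0 ≤ L < 1`, where `2^{εL}` exceeds `2^{-ε|L|}` by `2^{2εL} ≤ 4`.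
    have e1 : (‖h‖ / z.re) ^ ε * z.re ^ (-α') ≤ z.re ^ (-α) * (4 * 2 ^ (-(ε * |L|))) := by
      rw [Real.div_rpow hh0.le hz.le, div_mul_eq_mul_div, mul_div_assoc, ← Real.rpow_sub hz, mul_comm]
      gcongr ?_ * ?_
      · refine Real.rpow_le_rpow_of_exponent_ge hz hre1 ?_
        have : ε ≤ α - α' := min_le_left _ _
        linarith
      · rw [hhL, ← Real.rpow_mul zero_le_two, show (4 : ℝ) = 2 ^ (2 : ℝ) by norm_num,
          ← Real.rpow_add two_pos]
        refine Real.rpow_le_rpow_of_exponent_le one_le_two ?_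
        rcases le_or_gt 0 L with h0 | h0
        · rw [abs_of_nonneg h0]; nlinarith
        · rw [abs_of_neg h0]; nlinarith
    calc ENNReal.ofReal ((d + 2) * (‖h‖ / z.re) ^ ε) * (C1 * ENNReal.ofReal (z.re ^ (-α')))
        = ((d + 2 : ℝ≥0) * C1 : ℝ≥0) * ENNReal.ofReal ((‖h‖ / z.re) ^ ε * z.re ^ (-α')) := by
          rw [ENNReal.ofReal_mul (by positivity), ENNReal.ofReal_mul (by positivity)]
          have : ENNReal.ofReal ((d : ℝ) + 2) = (((d : ℝ≥0) + 2 : ℝ≥0) : ℝ≥0∞) := by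
            rw [ENNReal.ofReal_eq_coe_nnreal (by positivity)]
            congr 1
          rw [this]
          push_cast
          ring
      _ ≤ ((d + 2 : ℝ≥0) * C1 : ℝ≥0) * ENNReal.ofReal (z.re ^ (-α) * (4 * 2 ^ (-(ε * |L|)))) := by
          gcongr
      _ = ((d + 2 : ℝ≥0) * C1 * 4 : ℝ≥0) * ENNReal.ofReal (z.re ^ (-α)) *
          ENNReal.ofReal (2 ^ (-(ε * |L|))) := by
          rw [ENNReal.ofReal_mul (by positivity), ENNReal.ofReal_mul (by positivity)]
          push_cast
          simp only [ENNReal.ofReal_ofNat]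
          ring
      _ ≤ _ := by
          gcongr
          exact le_self_add

end PoissonIntegral

/-! ### Dilation to general parameters and the dyadic Hörmander sum. -/

section PoissonScaling

variable {d : ℕ}

lemma enorm_halfSpacePoissonKernel_smul {s : ℝ} (hs : 0 < s) (z : ℂ)
    (x : EuclideanSpace ℝ (Fin d)) :
    ‖halfSpacePoissonKernel d (s * z) x‖ₑ =
      ENNReal.ofReal (s ^ (-(d : ℝ))) * ‖halfSpacePoissonKernel d z (s⁻¹ • x)‖ₑ := by
  rw [halfSpacePoissonKernel_smul hs, enorm_mul, ← ofReal_norm, Complex.norm_real,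
    Real.norm_of_nonneg (by positivity)]

lemma exists_unit_mul {z : ℂ} (hz : 0 < z.re) :
    ∃ w : ℂ, z = (‖z‖ : ℝ) * w ∧ ‖w‖ = 1 ∧ w.re = z.re / ‖z‖ ∧ 0 < w.re ∧ 0 < ‖z‖ := by
  have hz0 : 0 < ‖z‖ := norm_pos_iff.2 fun h => by simp [h] at hz
  have hre : (((‖z‖⁻¹ : ℝ) : ℂ) * z).re = z.re / ‖z‖ := by
    rw [Complex.re_ofReal_mul]; field_simp
  refine ⟨((‖z‖⁻¹ : ℝ) : ℂ) * z, ?_, ?_, hre, ?_, hz0⟩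
  · rw [← mul_assoc, ← Complex.ofReal_mul, mul_inv_cancel₀ hz0.ne', Complex.ofReal_one, one_mul]
  · rw [norm_mul, Complex.norm_real, norm_inv, norm_norm, inv_mul_cancel₀ hz0.ne']
  · rw [hre]; positivity

lemma inv_re_unit_rpow {z : ℂ} (hz : 0 < z.re) (α : ℝ) :
    (z.re / ‖z‖) ^ (-α) = (‖z‖ / z.re) ^ α := by
  rw [Real.rpow_neg (by positivity), ← Real.inv_rpow (by positivity), inv_div]

/-- `L¹` bound of the Poisson kernel at complex time. -/
theorem exists_lintegral_halfSpacePoissonKernel_le (hd : 1 ≤ d) {α : ℝ}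
    (hα : ((d : ℝ) - 1) / 2 < α) :
    ∃ C : ℝ≥0, ∀ z : ℂ, 0 < z.re →
      ∫⁻ x : EuclideanSpace ℝ (Fin d), ‖halfSpacePoissonKernel d z x‖ₑ ≤
        C * ENNReal.ofReal ((‖z‖ / z.re) ^ α) := by
  -- A smaller exponent removes the restriction `α < (d+1)/2`, since `‖z‖ / Re z ≥ 1`.
  obtain ⟨α', h1, h2⟩ := exists_between
    (lt_min hα (by linarith : ((d : ℝ) - 1) / 2 < ((d : ℝ) + 1) / 2))
  obtain ⟨C, hC⟩ := exists_lintegral_halfSpacePoissonKernel_le_of_lt hd h1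
    (h2.trans_le (min_le_right _ _))
  refine ⟨C, fun z hz => ?_⟩
  obtain ⟨w, hzw, hw1, hwre, hw0, hz0⟩ := exists_unit_mul hz
  have hle : (‖z‖ / z.re) ^ α' ≤ (‖z‖ / z.re) ^ α := by
    refine Real.rpow_le_rpow_of_exponent_le ?_ (h2.trans_le (min_le_left _ _)).le
    rw [one_le_div hz]
    exact (le_abs_self _).trans (Complex.abs_re_le_norm z)
  calc ∫⁻ x : EuclideanSpace ℝ (Fin d), ‖halfSpacePoissonKernel d z x‖ₑ
      = ∫⁻ x, ‖halfSpacePoissonKernel d w x‖ₑ := by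
        rw [← lintegral_comp_inv_smul hz0 (continuous_halfSpacePoissonKernel hw0).enorm.measurable]
        conv_lhs => rw [hzw]
        simp_rw [enorm_halfSpacePoissonKernel_smul hz0]
    _ ≤ C * ENNReal.ofReal (w.re ^ (-α')) := hC w hw1 hw0
    _ ≤ _ := by
        rw [hwre, inv_re_unit_rpow hz]
        gcongr

lemma poissonHormander_smul {s : ℝ} (hs : 0 < s) {z : ℂ} (hz : 0 < z.re)
    (h : EuclideanSpace ℝ (Fin d)) :
    poissonHormander d (s * z) h = poissonHormander d z (s⁻¹ • h) := by
  have hms : ∀ r : ℝ, MeasurableSet {x : EuclideanSpace ℝ (Fin d) | r ≤ ‖x‖} := fun r =>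
    measurableSet_le measurable_const measurable_norm
  have hP := continuous_halfSpacePoissonKernel (d := d) hz
  have hm : Measurable (Set.indicator {x : EuclideanSpace ℝ (Fin d) | 2 * ‖s⁻¹ • h‖ ≤ ‖x‖}
    fun x => ‖halfSpacePoissonKernel d z (x - s⁻¹ • h) - halfSpacePoissonKernel d z x‖ₑ) :=
    Measurable.indicator (by
      have : Continuous fun x => halfSpacePoissonKernel d z (x - s⁻¹ • h) - halfSpacePoissonKernel d z x :=
        (hP.comp (by fun_prop)).sub hP
      exact this.enorm.measurable) (hms _)
  rw [poissonHormander, poissonHormander, ← lintegral_indicator (hms _), ← lintegral_indicator (hms _),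
    ← lintegral_comp_inv_smul hs hm]
  refine lintegral_congr fun x => ?_
  have hiff : 2 * ‖h‖ ≤ ‖x‖ ↔ 2 * ‖s⁻¹ • h‖ ≤ ‖s⁻¹ • x‖ := by
    rw [norm_smul, norm_smul, norm_inv, Real.norm_of_nonneg hs.le]
    constructor
    · intro h1
      have := mul_le_mul_of_nonneg_left h1 (inv_nonneg.2 hs.le)
      linarith
    · intro h1
      have h2 := mul_le_mul_of_nonneg_left h1 hs.le
      have e1 : s * (2 * (s⁻¹ * ‖h‖)) = 2 * ‖h‖ := by field_simp
      have e2 : s * (s⁻¹ * ‖x‖) = ‖x‖ := by field_simp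
      rwa [e1, e2] at h2
  by_cases hx : 2 * ‖h‖ ≤ ‖x‖
  · rw [Set.indicator_of_mem (by exact hx), Set.indicator_of_mem (by exact hiff.1 hx),
      halfSpacePoissonKernel_smul hs, halfSpacePoissonKernel_smul hs, ← mul_sub, enorm_mul,
      ← ofReal_norm, Complex.norm_real, Real.norm_of_nonneg (by positivity), smul_sub]
  · rw [Set.indicator_of_notMem (by exact hx),
      Set.indicator_of_notMem (by exact fun h' => hx (hiff.2 h')), mul_zero]

lemma summable_pow_natAbs {q : ℝ} (hq0 : 0 ≤ q) (hq : q < 1) :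
    Summable fun j : ℤ => q ^ j.natAbs := by
  refine Summable.of_nat_of_neg ?_ ?_
  · simpa using summable_geometric_of_lt_one hq0 hq
  · simpa using summable_geometric_of_lt_one hq0 hq

lemma exists_sum_two_rpow_le {ε : ℝ} (hε : 0 < ε) :
    ∃ C : ℝ≥0, ∀ (L : ℝ) (S : Finset ℤ),
      ∑ k ∈ S, ENNReal.ofReal (2 ^ (-(ε * |L - k|))) ≤ C := by
  set q : ℝ := 2 ^ (-ε) with hq
  have hq0 : 0 < q := by positivity
  have hq1 : q < 1 := Real.rpow_lt_one_of_one_lt_of_neg one_lt_two (by linarith)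
  have hsum := summable_pow_natAbs hq0.le hq1
  refine ⟨(2 ^ ε * ∑' j : ℤ, q ^ j.natAbs).toNNReal, fun L S => ?_⟩
  -- Rounding `L` to an integer costs at most `2^ε`; the bilateral geometric series no longer
  -- depends on `L` after a shift.
  have hterm : ∀ k : ℤ, (2 : ℝ) ^ (-(ε * |L - k|)) ≤ 2 ^ ε * q ^ (k - ⌊L⌋).natAbs := by
    intro k
    rw [hq, ← Real.rpow_natCast, ← Real.rpow_mul zero_le_two, ← Real.rpow_add two_pos]
    refine Real.rpow_le_rpow_of_exponent_le one_le_two ?_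
    have h1 : ((k - ⌊L⌋).natAbs : ℝ) = |(k : ℝ) - ⌊L⌋| := by
      rw [Nat.cast_natAbs]; push_cast; rfl
    have h2 : |(k : ℝ) - ⌊L⌋| ≤ |L - k| + 1 := by
      have h3 := Int.floor_le L
      have h4 := Int.lt_floor_add_one L
      have h5 : |L - ⌊L⌋| ≤ 1 := by rw [abs_le]; constructor <;> linarith
      calc |(k : ℝ) - ⌊L⌋| = |-(L - k) + (L - ⌊L⌋)| := by ring_nf
        _ ≤ |L - k| + |L - ⌊L⌋| := by
          refine (abs_add_le _ _).trans_eq ?_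
          rw [abs_neg]
        _ ≤ _ := by linarith
    rw [h1]
    nlinarith
  calc ∑ k ∈ S, ENNReal.ofReal (2 ^ (-(ε * |L - k|)))
      ≤ ∑ k ∈ S, ENNReal.ofReal (2 ^ ε * q ^ (k - ⌊L⌋).natAbs) :=
        Finset.sum_le_sum fun k _ => ENNReal.ofReal_le_ofReal (hterm k)
    _ = ENNReal.ofReal (∑ k ∈ S, 2 ^ ε * q ^ (k - ⌊L⌋).natAbs) :=
        (ENNReal.ofReal_sum_of_nonneg fun k _ => by positivity).symm
    _ ≤ ENNReal.ofReal (2 ^ ε * ∑' j : ℤ, q ^ j.natAbs) := by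
        refine ENNReal.ofReal_le_ofReal ?_
        rw [← Finset.mul_sum]
        gcongr
        have h1 := (Equiv.subRight ⌊L⌋).summable_iff.2 hsum
        refine (h1.sum_le_tsum S fun k _ => pow_nonneg hq0.le _).trans_eq ?_
        exact (Equiv.subRight ⌊L⌋).tsum_eq (fun j : ℤ => q ^ j.natAbs)

/-- Hörmander's condition for the dyadic dilates of the Poisson kernel at complex time. -/
theorem exists_sum_poissonHormander_le (hd : 1 ≤ d) {α : ℝ} (hα : ((d : ℝ) - 1) / 2 < α) :
    ∃ C : ℝ≥0, ∀ z : ℂ, 0 < z.re → ∀ (S : Finset ℤ) (y : EuclideanSpace ℝ (Fin d)),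
      ∑ k ∈ S, poissonHormander d (((2 ^ k : ℝ) : ℂ) * z) y ≤
        C * ENNReal.ofReal ((‖z‖ / z.re) ^ α) := by
  obtain ⟨C1, ε, hε, hC1⟩ := exists_poissonHormander_le hd hα
  obtain ⟨C2, hC2⟩ := exists_sum_two_rpow_le hε
  refine ⟨C1 * C2, fun z hz S y => ?_⟩
  by_cases hy : y = 0
  · have : ∀ w : ℂ, poissonHormander d w 0 = 0 := by intro w; simp [poissonHormander]
    simp [hy, this]
  obtain ⟨w, hzw, hw1, hwre, hw0, hz0⟩ := exists_unit_mul hz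
  -- Scaling by `2^k ‖z‖` subtracts `k` from `log₂(‖y‖ / ‖z‖)`, so the terms decay geometrically in
  -- `k` around that number.
  have hterm : ∀ k : ℤ, poissonHormander d (((2 ^ k : ℝ) : ℂ) * z) y ≤
      C1 * ENNReal.ofReal ((‖z‖ / z.re) ^ α) *
        ENNReal.ofReal (2 ^ (-(ε * |Real.logb 2 (‖y‖ / ‖z‖) - k|))) := by
    intro k
    have hk : (0 : ℝ) < 2 ^ k * ‖z‖ := by positivity
    have e1 : ((2 ^ k : ℝ) : ℂ) * z = ((2 ^ k * ‖z‖ : ℝ) : ℂ) * w := by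
      conv_lhs => rw [hzw]
      push_cast
      ring
    rw [e1, poissonHormander_smul hk hw0]
    have hne : (2 ^ k * ‖z‖ : ℝ)⁻¹ • y ≠ 0 := smul_ne_zero (inv_ne_zero hk.ne') hy
    refine (hC1 w hw1 hw0 _ hne).trans_eq ?_
    rw [hwre, inv_re_unit_rpow hz, norm_smul, norm_inv, Real.norm_of_nonneg hk.le]
    have hy0 : ‖y‖ ≠ 0 := norm_ne_zero_iff.2 hy
    have e2 : Real.logb 2 ((2 ^ k * ‖z‖)⁻¹ * ‖y‖) = Real.logb 2 (‖y‖ / ‖z‖) - k := by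
      rw [show (2 ^ k * ‖z‖)⁻¹ * ‖y‖ = (‖y‖ / ‖z‖) / 2 ^ k by field_simp,
        Real.logb_div (div_ne_zero hy0 hz0.ne') (by positivity), ← Real.rpow_intCast,
        Real.logb_rpow two_pos (by norm_num)]
    rw [e2]
  calc _ ≤ ∑ k ∈ S, C1 * ENNReal.ofReal ((‖z‖ / z.re) ^ α) *
        ENNReal.ofReal (2 ^ (-(ε * |Real.logb 2 (‖y‖ / ‖z‖) - k|))) :=
        Finset.sum_le_sum fun k _ => hterm k
    _ = C1 * ENNReal.ofReal ((‖z‖ / z.re) ^ α) *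
        ∑ k ∈ S, ENNReal.ofReal (2 ^ (-(ε * |Real.logb 2 (‖y‖ / ‖z‖) - k|))) := by
        rw [Finset.mul_sum]
    _ ≤ C1 * ENNReal.ofReal ((‖z‖ / z.re) ^ α) * C2 := by gcongr; exact hC2 _ _
    _ = _ := by push_cast; ring

end PoissonScaling

/-! ### Holomorphy of the Poisson kernels with values in `L¹`. -/

section Holomorphic

variable {d : ℕ}

/-- A dominated pointwise holomorphic family is holomorphic with values in `L¹`. -/
lemma differentiableAt_L1_of_dominated {F : ℂ → LpSpace d 1}
    {G : ℂ → EuclideanSpace ℝ (Fin d) → ℂ} {z₀ : ℂ} {r : ℝ} (hr : 0 < r)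
    {M : EuclideanSpace ℝ (Fin d) → ℝ} (hM : Integrable M)
    (hF : ∀ z ∈ Metric.ball z₀ (2 * r), F z =ᵐ[volume] G z)
    (hG : ∀ z ∈ Metric.ball z₀ (2 * r), ∀ x, DifferentiableAt ℂ (fun w => G w x) z)
    (hb : ∀ z ∈ Metric.ball z₀ (2 * r), ∀ x, ‖G z x‖ ≤ M x) :
    DifferentiableAt ℂ F z₀ := by
  set G' : EuclideanSpace ℝ (Fin d) → ℂ := fun x => deriv (fun w => G w x) z₀ with hG'
  have hz₀ : z₀ ∈ Metric.ball z₀ (2 * r) := Metric.mem_ball_self (by positivity)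
  have hslope : ∀ x, Tendsto (fun z => slope (fun w => G w x) z₀ z) (𝓝[≠] z₀) (𝓝 (G' x)) := fun x =>
    hasDerivAt_iff_tendsto_slope.1 (hG z₀ hz₀ x).hasDerivAt
  have hev : ∀ᶠ z in 𝓝[≠] z₀, z ∈ Metric.ball z₀ (r / 2) :=
    mem_nhdsWithin_of_mem_nhds (Metric.ball_mem_nhds _ (by positivity))
  have hsub : ∀ z ∈ Metric.ball z₀ (r / 2), z ∈ Metric.ball z₀ (2 * r) := fun z hz =>
    Metric.ball_subset_ball (by linarith) hz
  -- Cauchy estimates on discs of radius `r / 2` dominate the derivatives, and hence the difference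
  -- quotients, by a multiple of `M`; no separate bound on derivatives has to be assumed.
  have hcauchy : ∀ z ∈ Metric.ball z₀ r, ∀ x, ‖deriv (fun w => G w x) z‖ ≤ M x / (r / 2) := by
    intro z hz x
    have hcl : Metric.closedBall z (r / 2) ⊆ Metric.ball z₀ (2 * r) := fun w hw => by
      have h1 := Metric.mem_closedBall.1 hw
      have h2 := Metric.mem_ball.1 hz
      exact Metric.mem_ball.2 (by linarith [dist_triangle w z z₀])
    refine Complex.norm_deriv_le_of_forall_mem_sphere_norm_le (by positivity) ?_ fun w hw =>
      hb w (hcl (Metric.sphere_subset_closedBall hw)) x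
    refine DifferentiableOn.diffContOnCl fun w hw => (hG w (hcl ?_) x).differentiableWithinAt
    exact Metric.closure_ball_subset_closedBall hw
  have hslope_le : ∀ z ∈ Metric.ball z₀ (r / 2), ∀ x, ‖slope (fun w => G w x) z₀ z‖ ≤ M x / (r / 2) := by
    intro z hz x
    have h0 : 0 ≤ M x / (r / 2) := (norm_nonneg _).trans (hcauchy z₀ (Metric.mem_ball_self hr) x)
    have h1 := (convex_ball z₀ r).norm_image_sub_le_of_norm_deriv_le (𝕜 := ℂ) (f := fun w => G w x)
      (fun w hw => hG w (Metric.ball_subset_ball (by linarith) hw) x)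
      (fun w hw => hcauchy w hw x) (Metric.mem_ball_self hr)
      (Metric.ball_subset_ball (by linarith) hz)
    rw [slope_def_field, norm_div]
    exact div_le_of_le_mul₀ (norm_nonneg _) h0 h1
  have hmeas : ∀ z ∈ Metric.ball z₀ (2 * r), AEStronglyMeasurable (G z) volume := fun z hz =>
    (Lp.aestronglyMeasurable (F z)).congr (hF z hz)
  have hmslope : ∀ z ∈ Metric.ball z₀ (r / 2),
      AEStronglyMeasurable (fun x => slope (fun w => G w x) z₀ z) volume := by
    intro z hz
    simp_rw [slope_def_module]
    exact ((hmeas z (hsub z hz)).sub (hmeas z₀ hz₀)).const_smul ((z - z₀)⁻¹ : ℂ)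
  have hmG' : AEStronglyMeasurable G' volume := by
    -- Measurability of the pointwise derivative comes from a sequence of difference quotients.
    obtain ⟨u, hu1, hu2⟩ : ∃ u : ℕ → ℂ, Tendsto u atTop (𝓝[≠] z₀) ∧ ∀ n, u n ∈ Metric.ball z₀ (r / 2) := by
      obtain ⟨u, hu⟩ := exists_seq_tendsto (𝓝[≠] z₀)
      obtain ⟨N, hN⟩ := eventually_atTop.1 (hu.eventually hev)
      exact ⟨fun n => u (n + N), hu.comp (tendsto_add_atTop_nat N), fun n => hN _ (by omega)⟩
    exact aestronglyMeasurable_of_tendsto_ae atTop (fun n => hmslope (u n) (hu2 n))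
      (Eventually.of_forall fun x => (hslope x).comp hu1)
  have hiG' : Integrable G' := by
    refine (hM.div_const (r / 2)).mono' hmG' (Eventually.of_forall fun x => ?_)
    exact hcauchy z₀ (Metric.mem_ball_self hr) x
  have hlim : Tendsto (fun z => ∫ x, ‖slope (fun w => G w x) z₀ z - G' x‖) (𝓝[≠] z₀) (𝓝 0) := by
    rw [show (0 : ℝ) = ∫ _ : EuclideanSpace ℝ (Fin d), (0 : ℝ) by simp]
    refine tendsto_integral_filter_of_dominated_convergence (fun x => M x / (r / 2) + M x / (r / 2))
      ?_ ?_ ((hM.div_const _).add (hM.div_const _)) ?_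
    · filter_upwards [hev] with z hz
      exact ((hmslope z hz).sub hmG').norm
    · filter_upwards [hev] with z hz
      refine Eventually.of_forall fun x => ?_
      rw [norm_norm]
      exact (norm_sub_le _ _).trans (add_le_add (hslope_le z hz x)
        (hcauchy z₀ (Metric.mem_ball_self hr) x))
    · refine Eventually.of_forall fun x => ?_
      have := ((hslope x).sub_const (G' x)).norm
      simpa using this
  refine HasDerivAt.differentiableAt (f' := hiG'.toL1 G') ?_
  rw [hasDerivAt_iff_tendsto_slope, tendsto_iff_norm_sub_tendsto_zero]
  refine hlim.congr' ?_
  filter_upwards [hev] with z hz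
  rw [L1.norm_eq_integral_norm]
  refine integral_congr_ae ?_
  filter_upwards [Lp.coeFn_sub (slope F z₀ z) (hiG'.toL1 G'), hiG'.coeFn_toL1,
    Lp.coeFn_smul (z - z₀)⁻¹ (F z - F z₀), Lp.coeFn_sub (F z) (F z₀), hF z (hsub z hz),
    hF z₀ hz₀] with x h1 h2 h3 h4 h5 h6
  rw [h1, Pi.sub_apply, h2, slope_def_module, slope_def_module, h3, Pi.smul_apply, h4,
    Pi.sub_apply, h5, h6]

open Classical in
/-- The Poisson kernel as an element of `L¹`. -/
def poissonL1 (d : ℕ) (z : ℂ) : LpSpace d 1 :=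
  if h : 0 < z.re then (integrable_halfSpacePoissonKernel (d := d) h).toL1 _ else 0

lemma poissonL1_ae {z : ℂ} (hz : 0 < z.re) :
    poissonL1 d z =ᵐ[volume] halfSpacePoissonKernel d z := by
  rw [poissonL1, dif_pos hz]
  exact (integrable_halfSpacePoissonKernel hz).coeFn_toL1

lemma fourier_congr_ae {f g : EuclideanSpace ℝ (Fin d) → ℂ} (h : f =ᵐ[volume] g)
    (ξ : EuclideanSpace ℝ (Fin d)) : 𝓕 f ξ = 𝓕 g ξ := by
  rw [Real.fourier_eq, Real.fourier_eq]
  refine integral_congr_ae ?_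
  filter_upwards [h] with x hx
  rw [hx]

lemma fourier_poissonL1 {z : ℂ} (hz : 0 < z.re) (ξ : EuclideanSpace ℝ (Fin d)) :
    𝓕 (poissonL1 d z : EuclideanSpace ℝ (Fin d) → ℂ) ξ = expSymbol z (2 * Real.pi * ‖ξ‖) := by
  rw [fourier_congr_ae (poissonL1_ae hz), fourier_halfSpacePoissonKernel hz
    (integrable_halfSpacePoissonKernel hz)]

lemma norm_poissonL1 {z : ℂ} (hz : 0 < z.re) :
    ‖poissonL1 d z‖ = ∫ x, ‖halfSpacePoissonKernel d z x‖ := by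
  rw [L1.norm_eq_integral_norm]
  refine integral_congr_ae ?_
  filter_upwards [poissonL1_ae hz] with x hx
  rw [hx]

lemma exists_norm_poissonL1_le (hd : 1 ≤ d) {α : ℝ} (hα : ((d : ℝ) - 1) / 2 < α) :
    ∃ C : ℝ≥0, ∀ z : ℂ, 0 < z.re → ‖poissonL1 d z‖ ≤ C * (‖z‖ / z.re) ^ α := by
  obtain ⟨C, hC⟩ := exists_lintegral_halfSpacePoissonKernel_le hd hα
  refine ⟨C, fun z hz => ?_⟩
  rw [norm_poissonL1 hz, integral_norm_eq_lintegral_enorm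
    (integrable_halfSpacePoissonKernel hz).aestronglyMeasurable]
  refine ENNReal.toReal_le_of_le_ofReal (by positivity) ((hC z hz).trans_eq ?_)
  rw [ENNReal.ofReal_mul (by positivity), ENNReal.ofReal_coe_nnreal]

theorem differentiableOn_poissonL1 (d : ℕ) :
    DifferentiableOn ℂ (poissonL1 d) {z : ℂ | 0 < z.re} := by
  intro z₀ hz₀
  have hz₀' : 0 < z₀.re := hz₀
  have hball : ∀ z ∈ Metric.ball z₀ (2 * (z₀.re / 4)), z₀.re / 2 ≤ z.re ∧ ‖z‖ ≤ ‖z₀‖ + z₀.re := by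
    intro z hz
    rw [Metric.mem_ball, dist_eq_norm] at hz
    have h1 := Complex.abs_re_le_norm (z - z₀)
    rw [Complex.sub_re] at h1
    refine ⟨by linarith [neg_abs_le (z.re - z₀.re)], ?_⟩
    linarith [norm_le_norm_add_norm_sub' z z₀]
  obtain ⟨c, hc⟩ : ∃ c : ℝ, ∀ z ∈ Metric.ball z₀ (2 * (z₀.re / 4)),
      ∀ x : EuclideanSpace ℝ (Fin d), ‖halfSpacePoissonKernel d z x‖ ≤
        c * (1 + ‖x‖ ^ 2) ^ (-((d : ℝ) + 1) / 2) :=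
    ⟨_, fun z hz x => norm_halfSpacePoissonKernel_le_of (half_pos hz₀') (hball z hz).1
      (hball z hz).2 x⟩
  refine (differentiableAt_L1_of_dominated (r := z₀.re / 4) (by positivity)
    (G := halfSpacePoissonKernel d)
    ((integrable_rpow_neg_one_add_norm_sq_of_lt (d := d) (r := d + 1) (by simp)).const_mul c)
    (fun z hz => ?_) (fun z hz x => ?_) (fun z hz x => ?_)).differentiableWithinAt
  · exact poissonL1_ae (by linarith [(hball z hz).1])
  · exact differentiableAt_halfSpacePoissonKernel (by linarith [(hball z hz).1]) x
  · exact hc z hz x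

end Holomorphic

/-! ### Dyadic cubes and the Calderón–Zygmund decomposition -/

section Dyadic

variable {d : ℕ}

/-- The index of the dyadic cube of side `2^{-j}` containing `x`. -/
def dyadicIndex (j : ℤ) (x : EuclideanSpace ℝ (Fin d)) : Fin d → ℤ := fun i => ⌊2 ^ j * x i⌋

/-- The half-open dyadic cube of side `2^{-j}` with index `m`. -/
def dyadicCube (q : ℤ × (Fin d → ℤ)) : Set (EuclideanSpace ℝ (Fin d)) :=
  {x | dyadicIndex q.1 x = q.2}

/-- The corner of a dyadic cube. -/
def dyadicCorner (q : ℤ × (Fin d → ℤ)) : EuclideanSpace ℝ (Fin d) :=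
  WithLp.toLp 2 fun i => (q.2 i : ℝ) / 2 ^ q.1

lemma dyadicIndex_corner (q : ℤ × (Fin d → ℤ)) : dyadicIndex q.1 (dyadicCorner q) = q.2 := by
  ext i
  have : (2 : ℝ) ^ q.1 ≠ 0 := by positivity
  simp only [dyadicIndex, dyadicCorner]
  rw [mul_div_cancel₀ _ this, Int.floor_intCast]

lemma mem_dyadicCube_iff (q : ℤ × (Fin d → ℤ)) (x : EuclideanSpace ℝ (Fin d)) :
    x ∈ dyadicCube q ↔ ∀ i, x i ∈ Set.Ico ((q.2 i : ℝ) / 2 ^ q.1) ((q.2 i + 1 : ℝ) / 2 ^ q.1) := by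
  have : (0 : ℝ) < 2 ^ q.1 := by positivity
  simp only [dyadicCube, Set.mem_ofPred_eq, funext_iff, dyadicIndex, Int.floor_eq_iff, Set.mem_Ico,
    div_le_iff₀ this, lt_div_iff₀ this, mul_comm]

lemma dyadicCube_eq_preimage (q : ℤ × (Fin d → ℤ)) :
    dyadicCube q = (WithLp.ofLp : EuclideanSpace ℝ (Fin d) → (Fin d → ℝ)) ⁻¹'
      Set.pi Set.univ fun i => Set.Ico ((q.2 i : ℝ) / 2 ^ q.1) ((q.2 i + 1 : ℝ) / 2 ^ q.1) := by
  ext x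
  simp [mem_dyadicCube_iff]

lemma measurableSet_dyadicCube (q : ℤ × (Fin d → ℤ)) : MeasurableSet (dyadicCube q) := by
  rw [dyadicCube_eq_preimage]
  exact (PiLp.volume_preserving_ofLp (Fin d)).measurable
    (MeasurableSet.univ_pi fun i => measurableSet_Ico)

lemma volume_dyadicCube (q : ℤ × (Fin d → ℤ)) :
    volume (dyadicCube q) = ENNReal.ofReal ((2 ^ (-q.1)) ^ d) := by
  rw [dyadicCube_eq_preimage, (PiLp.volume_preserving_ofLp (Fin d)).measure_preimage
    (MeasurableSet.univ_pi fun i => measurableSet_Ico).nullMeasurableSet, Real.volume_pi_Ico]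
  have : ∀ i, ((q.2 i + 1 : ℝ) / 2 ^ q.1 - (q.2 i : ℝ) / 2 ^ q.1) = 2 ^ (-q.1) := by
    intro i
    rw [zpow_neg, ← sub_div]
    ring
  simp_rw [this]
  rw [Finset.prod_const, Finset.card_univ, Fintype.card_fin, ENNReal.ofReal_pow (by positivity)]

lemma volume_dyadicCube_pos (q : ℤ × (Fin d → ℤ)) : 0 < volume (dyadicCube q) := by
  rw [volume_dyadicCube]
  exact ENNReal.ofReal_pos.2 (by positivity)

lemma volume_dyadicCube_ne_top (q : ℤ × (Fin d → ℤ)) : volume (dyadicCube q) ≠ ∞ := by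
  rw [volume_dyadicCube]
  exact ENNReal.ofReal_ne_top

lemma norm_sub_le_of_mem_dyadicCube {q : ℤ × (Fin d → ℤ)} {x y : EuclideanSpace ℝ (Fin d)}
    (hx : x ∈ dyadicCube q) (hy : y ∈ dyadicCube q) : ‖x - y‖ ≤ √d * 2 ^ (-q.1) := by
  rw [EuclideanSpace.norm_eq, Real.sqrt_le_left (by positivity), mul_pow, Real.sq_sqrt (by positivity)]
  have : ∀ i, ‖(x - y) i‖ ^ 2 ≤ (2 ^ (-q.1)) ^ 2 := by
    intro i
    have h1 := (mem_dyadicCube_iff q x).1 hx i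
    have h2 := (mem_dyadicCube_iff q y).1 hy i
    have h3 : (q.2 i + 1 : ℝ) / 2 ^ q.1 = (q.2 i : ℝ) / 2 ^ q.1 + 2 ^ (-q.1) := by
      rw [zpow_neg, add_div, one_div]
    rw [h3] at h1 h2
    rw [sq_le_sq₀ (norm_nonneg _) (by positivity), Real.norm_eq_abs, PiLp.sub_apply, abs_le]
    constructor <;> linarith [h1.1, h1.2, h2.1, h2.2]
  refine (Finset.sum_le_sum fun i _ => this i).trans_eq ?_
  simp

/-- Nesting of dyadic cubes: the index of the parent is the integer half of the index of the child.
-/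
lemma dyadicIndex_succ_eq {j : ℤ} {x y : EuclideanSpace ℝ (Fin d)}
    (h : dyadicIndex (j + 1) x = dyadicIndex (j + 1) y) : dyadicIndex j x = dyadicIndex j y := by
  have key : ∀ a : ℝ, ⌊2 ^ j * a⌋ = ⌊2 ^ (j + 1) * a⌋ / 2 := by
    intro a
    rw [zpow_add_one₀ two_ne_zero]
    have := Int.floor_div_natCast (2 ^ j * 2 * a) 2
    push_cast at this
    rw [← this]
    congr 1
    ring
  ext i
  have := congrFun h i
  simp only [dyadicIndex] at this ⊢
  rw [key, key, this]

lemma dyadicIndex_eq_of_le {i j : ℤ} (hij : i ≤ j) {x y : EuclideanSpace ℝ (Fin d)}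
    (h : dyadicIndex j x = dyadicIndex j y) : dyadicIndex i x = dyadicIndex i y := by
  induction i, hij using Int.leInductionDown with
  | base => exact h
  | pred n hn ih => exact dyadicIndex_succ_eq (j := n - 1) (by simpa using ih)

variable {F : Type*} [NormedAddCommGroup F]

/-- The average of `‖f‖` over the dyadic cube of generation `j` at `x` exceeds `l`. -/
def LargeAverage (f : EuclideanSpace ℝ (Fin d) → F) (l : ℝ≥0∞) (j : ℤ)
    (x : EuclideanSpace ℝ (Fin d)) : Prop :=
  l * volume (dyadicCube (j, dyadicIndex j x)) < ∫⁻ y in dyadicCube (j, dyadicIndex j x), ‖f y‖ₑ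

/-- The stopping cubes: maximal dyadic cubes with a large average. -/
def stoppingCubes (f : EuclideanSpace ℝ (Fin d) → F) (l : ℝ≥0∞) : Set (ℤ × (Fin d → ℤ)) :=
  {q | LargeAverage f l q.1 (dyadicCorner q) ∧ ∀ i < q.1, ¬ LargeAverage f l i (dyadicCorner q)}

variable {f : EuclideanSpace ℝ (Fin d) → F} {l : ℝ≥0∞}

/-- The generation `i` cube of `x` is an ancestor of `q`, the same for all points of `q`; this
justifies testing at the corner only. -/
lemma largeAverage_iff_of_mem {q : ℤ × (Fin d → ℤ)} {x : EuclideanSpace ℝ (Fin d)}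
    (hx : x ∈ dyadicCube q) {i : ℤ} (hi : i ≤ q.1) :
    LargeAverage f l i x ↔ LargeAverage f l i (dyadicCorner q) := by
  have h : dyadicIndex q.1 x = dyadicIndex q.1 (dyadicCorner q) := by
    rw [dyadicIndex_corner]; exact hx
  rw [LargeAverage, LargeAverage, dyadicIndex_eq_of_le hi h]

lemma eq_of_mem_stoppingCubes {q q' : ℤ × (Fin d → ℤ)} (hq : q ∈ stoppingCubes f l)
    (hq' : q' ∈ stoppingCubes f l) {x : EuclideanSpace ℝ (Fin d)} (hx : x ∈ dyadicCube q)
    (hx' : x ∈ dyadicCube q') : q = q' := by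
  have key : ∀ {q q' : ℤ × (Fin d → ℤ)}, q ∈ stoppingCubes f l → q' ∈ stoppingCubes f l →
      x ∈ dyadicCube q → x ∈ dyadicCube q' → q.1 ≤ q'.1 := by
    intro q q' hq hq' hx hx'
    by_contra hlt
    push Not at hlt
    exact hq.2 q'.1 hlt ((largeAverage_iff_of_mem hx hlt.le).1
      ((largeAverage_iff_of_mem hx' le_rfl).2 hq'.1))
  have h1 : q.1 = q'.1 := le_antisymm (key hq hq' hx hx') (key hq' hq hx' hx)
  have h2 : dyadicIndex q.1 x = q.2 := hx
  have h3 : dyadicIndex q'.1 x = q'.2 := hx'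
  exact Prod.ext h1 (by rw [← h2, ← h3, h1])

lemma lt_lintegral_of_mem_stoppingCubes {q : ℤ × (Fin d → ℤ)} (hq : q ∈ stoppingCubes f l) :
    l * volume (dyadicCube q) < ∫⁻ y in dyadicCube q, ‖f y‖ₑ := by
  have := hq.1
  rwa [LargeAverage, dyadicIndex_corner] at this

/-- By maximality the parent has a small average, and its volume is `2^d` times larger. -/
lemma lintegral_le_of_mem_stoppingCubes {q : ℤ × (Fin d → ℤ)} (hq : q ∈ stoppingCubes f l) :
    ∫⁻ y in dyadicCube q, ‖f y‖ₑ ≤ 2 ^ d * l * volume (dyadicCube q) := by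
  have h := hq.2 (q.1 - 1) (by omega)
  rw [LargeAverage, not_lt] at h
  have hsub : dyadicCube q ⊆ dyadicCube (q.1 - 1, dyadicIndex (q.1 - 1) (dyadicCorner q)) := by
    intro x hx
    refine dyadicIndex_eq_of_le (by omega : q.1 - 1 ≤ q.1) ?_
    rw [dyadicIndex_corner]
    exact hx
  refine (lintegral_mono_set hsub).trans (h.trans_eq ?_)
  rw [volume_dyadicCube, volume_dyadicCube]
  have : ((2 : ℝ) ^ (-(q.1 - 1))) ^ d = 2 ^ d * (2 ^ (-q.1)) ^ d := by
    rw [← mul_pow, neg_sub, sub_eq_add_neg, zpow_one_add₀ two_ne_zero]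
  simp only [this]
  rw [ENNReal.ofReal_mul (by positivity), ENNReal.ofReal_pow zero_le_two, ENNReal.ofReal_ofNat]
  ring

lemma exists_stoppingCube_of_largeAverage (hd : 1 ≤ d) (hl : l ≠ 0)
    (hf : ∫⁻ y, ‖f y‖ₑ ≠ ∞) {j : ℤ} {x : EuclideanSpace ℝ (Fin d)} (h : LargeAverage f l j x) :
    ∃ q ∈ stoppingCubes f l, x ∈ dyadicCube q := by
  obtain ⟨N, hN⟩ : ∃ N : ℕ, ∫⁻ y, ‖f y‖ₑ ≤ l * 2 ^ N := by
    have h1 : Tendsto (fun N : ℕ => l * (2 : ℝ≥0∞) ^ N) atTop (𝓝 ∞) := by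
      have := ENNReal.Tendsto.const_mul (a := l)
        (ENNReal.tendsto_pow_atTop_nhds_top_iff.2 (by norm_num : (1 : ℝ≥0∞) < 2)) (Or.inl ENNReal.top_ne_zero)
      rwa [ENNReal.mul_top hl] at this
    obtain ⟨N, hN⟩ := (h1.eventually (lt_mem_nhds hf.lt_top)).exists
    exact ⟨N, hN.le⟩
  have hbdd : ∀ i : ℤ, LargeAverage f l i x → -(N : ℤ) ≤ i := by
    intro i hi
    by_contra hlt
    push Not at hlt
    refine absurd hi (not_lt.2 ?_)
    refine (setLIntegral_le_lintegral _ _).trans (hN.trans ?_)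
    gcongr
    rw [volume_dyadicCube, ENNReal.ofReal_pow (by positivity)]
    have h2 : (2 : ℝ≥0∞) ^ N = ENNReal.ofReal (2 ^ N) := by
      rw [ENNReal.ofReal_pow zero_le_two, ENNReal.ofReal_ofNat]
    have h3 : ENNReal.ofReal ((2 : ℝ) ^ N) ≤ ENNReal.ofReal (2 ^ (-i)) := by
      refine ENNReal.ofReal_le_ofReal ?_
      rw [← zpow_natCast]
      exact zpow_le_zpow_right₀ one_le_two (by omega)
    have h4 : 1 ≤ ENNReal.ofReal ((2 : ℝ) ^ (-i)) := by
      rw [ENNReal.one_le_ofReal]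
      exact one_le_zpow₀ one_le_two (by omega)
    rw [h2]
    exact h3.trans (le_self_pow₀ h4 (by omega))
  obtain ⟨i, hi, hmin⟩ := Int.exists_least_of_bdd ⟨-(N : ℤ), hbdd⟩ ⟨j, h⟩
  have hmem : x ∈ dyadicCube (i, dyadicIndex i x) := rfl
  refine ⟨(i, dyadicIndex i x), ⟨(largeAverage_iff_of_mem hmem le_rfl).1 hi, fun k hk hk' => ?_⟩, hmem⟩
  have := hmin k ((largeAverage_iff_of_mem hmem (le_of_lt hk)).2 hk')
  exact absurd hk (not_lt.2 this)

/-- Continuity takes the place of Lebesgue differentiation: if `‖f x‖ > l`, all sufficiently small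
cubes at `x` have a large average. Continuous functions suffice, being dense. -/
lemma enorm_le_of_notMem_stoppingCubes (hd : 1 ≤ d) (hl : l ≠ 0) (hf : ∫⁻ y, ‖f y‖ₑ ≠ ∞)
    (hc : Continuous f) {x : EuclideanSpace ℝ (Fin d)}
    (hx : ∀ q ∈ stoppingCubes f l, x ∉ dyadicCube q) : ‖f x‖ₑ ≤ l := by
  by_contra hlt
  push Not at hlt
  obtain ⟨l', h1, h2⟩ := exists_between hlt
  have hopen : IsOpen {y | l' < ‖f y‖ₑ} := isOpen_lt continuous_const hc.enorm
  obtain ⟨η, hη, hball⟩ := Metric.isOpen_iff.1 hopen x h2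
  obtain ⟨N, hN⟩ : ∃ N : ℕ, √d * 2 ^ (-(N : ℤ)) < η := by
    have h3 : Tendsto (fun N : ℕ => √d * (2⁻¹ : ℝ) ^ N) atTop (𝓝 (√d * 0)) :=
      (tendsto_pow_atTop_nhds_zero_of_lt_one (by norm_num) (by norm_num)).const_mul _
    rw [mul_zero] at h3
    obtain ⟨N, hN⟩ := (h3.eventually (gt_mem_nhds hη)).exists
    exact ⟨N, by rwa [zpow_neg, zpow_natCast, ← inv_pow]⟩
  have hmem : x ∈ dyadicCube ((N : ℤ), dyadicIndex N x) := rfl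
  obtain ⟨q, hq, hxq⟩ := exists_stoppingCube_of_largeAverage (f := f) (l := l) (j := N) (x := x) hd hl hf (by
    have hpos := volume_dyadicCube_pos ((N : ℤ), dyadicIndex N x)
    have hfin := volume_dyadicCube_ne_top ((N : ℤ), dyadicIndex N x)
    calc l * volume (dyadicCube ((N : ℤ), dyadicIndex N x))
        < l' * volume (dyadicCube ((N : ℤ), dyadicIndex N x)) :=
          ENNReal.mul_lt_mul_left hpos.ne' hfin h1
      _ = ∫⁻ y in dyadicCube ((N : ℤ), dyadicIndex N x), l' := by rw [setLIntegral_const]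
      _ ≤ _ := setLIntegral_mono' (measurableSet_dyadicCube _) fun y hy => by
          refine le_of_lt (hball ?_)
          rw [Metric.mem_ball, dist_eq_norm]
          exact (norm_sub_le_of_mem_dyadicCube hy hmem).trans_lt hN)
  exact hx q hq hxq

/-- The maximal function estimate behind the decomposition. -/
lemma volume_le_of_mem_stoppingCubes (hc : Continuous f) (hl : l ≠ ∞)
    {q : ℤ × (Fin d → ℤ)} (hq : q ∈ stoppingCubes f l) :
    l * volume (dyadicCube q) ≤ 2 * ∫⁻ y in dyadicCube q, Set.indicator {y | l / 2 < ‖f y‖ₑ} (fun y => ‖f y‖ₑ) y := by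
  have h1 := (lt_lintegral_of_mem_stoppingCubes hq).le
  have hm : MeasurableSet {y | l / 2 < ‖f y‖ₑ} := measurableSet_lt measurable_const hc.enorm.measurable
  set I := ∫⁻ y in dyadicCube q, Set.indicator {y | l / 2 < ‖f y‖ₑ} (fun y => ‖f y‖ₑ) y with hI
  -- Values at most `l / 2` account for at most half of the integral forced by a large average.
  have h2 : ∫⁻ y in dyadicCube q, ‖f y‖ₑ ≤ I + l / 2 * volume (dyadicCube q) := by
    rw [← setLIntegral_const, ← lintegral_add_right _ measurable_const]
    refine lintegral_mono fun y => ?_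
    by_cases hy : l / 2 < ‖f y‖ₑ
    · rw [Set.indicator_of_mem (by exact hy)]; exact le_self_add
    · rw [Set.indicator_of_notMem (by exact hy), zero_add]; exact not_lt.1 hy
  have hfin : l / 2 * volume (dyadicCube q) ≠ ∞ :=
    ENNReal.mul_ne_top (ENNReal.div_ne_top hl (by norm_num)) (volume_dyadicCube_ne_top q)
  have h3 : l * volume (dyadicCube q) = l / 2 * volume (dyadicCube q) + l / 2 * volume (dyadicCube q) := by
    rw [← add_mul, ENNReal.add_halves]
  have h4 : l / 2 * volume (dyadicCube q) ≤ I := by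
    refine ENNReal.le_of_add_le_add_right hfin ?_
    rw [← h3]
    exact h1.trans h2
  rw [h3, two_mul]
  exact add_le_add h4 h4

end Dyadic

/-! ### Good and bad parts -/

section CalderonZygmund

set_option linter.unusedSectionVars false

variable {d : ℕ} {F : Type*} [NormedAddCommGroup F] [NormedSpace ℝ F]
  {f : EuclideanSpace ℝ (Fin d) → F} {l : ℝ≥0∞}

/-- The union of the stopping cubes. -/
def stoppingSet (f : EuclideanSpace ℝ (Fin d) → F) (l : ℝ≥0∞) : Set (EuclideanSpace ℝ (Fin d)) :=
  ⋃ q : stoppingCubes f l, dyadicCube q.1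

open Classical in
/-- The good part of `f` at height `l`: averages on the stopping cubes, and `f` elsewhere. -/
def goodPart (f : EuclideanSpace ℝ (Fin d) → F) (l : ℝ≥0∞) (x : EuclideanSpace ℝ (Fin d)) : F :=
  if h : ∃ q : stoppingCubes f l, x ∈ dyadicCube q.1 then ⨍ y in dyadicCube h.choose.1, f y
  else f x

/-- The bad part of `f` at height `l`. -/
def badPart (f : EuclideanSpace ℝ (Fin d) → F) (l : ℝ≥0∞) (x : EuclideanSpace ℝ (Fin d)) : F :=
  f x - goodPart f l x

lemma measurableSet_stoppingSet : MeasurableSet (stoppingSet f l) :=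
  MeasurableSet.iUnion fun q => measurableSet_dyadicCube q.1

lemma pairwise_disjoint_stoppingCubes :
    Pairwise (Function.onFun Disjoint fun q : stoppingCubes f l => dyadicCube q.1) := by
  intro q q' hne
  rw [Function.onFun, Set.disjoint_left]
  intro x hx hx'
  exact hne (Subtype.ext (eq_of_mem_stoppingCubes q.2 q'.2 hx hx'))

lemma goodPart_of_mem (q : stoppingCubes f l) {x : EuclideanSpace ℝ (Fin d)}
    (hx : x ∈ dyadicCube q.1) : goodPart f l x = ⨍ y in dyadicCube q.1, f y := by
  have h : ∃ q : stoppingCubes f l, x ∈ dyadicCube q.1 := ⟨q, hx⟩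
  rw [goodPart, dif_pos h]
  have : h.choose = q := Subtype.ext (eq_of_mem_stoppingCubes h.choose.2 q.2 h.choose_spec hx)
  rw [this]

lemma goodPart_of_notMem {x : EuclideanSpace ℝ (Fin d)} (hx : x ∉ stoppingSet f l) :
    goodPart f l x = f x := by
  rw [goodPart, dif_neg]
  simpa [stoppingSet] using hx

lemma badPart_of_notMem {x : EuclideanSpace ℝ (Fin d)} (hx : x ∉ stoppingSet f l) :
    badPart f l x = 0 := by
  rw [badPart, goodPart_of_notMem hx, sub_self]

/-- Disjointness sums the bound over the cubes. Keeping only `{‖f‖ > l / 2}` on the right is what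
makes the later integration over heights converge for exponents above 1. -/
lemma volume_stoppingSet_le (hc : Continuous f) (hl0 : l ≠ 0) (hl : l ≠ ∞) :
    volume (stoppingSet f l) ≤ 2 * l⁻¹ * ∫⁻ y in {y | l / 2 < ‖f y‖ₑ}, ‖f y‖ₑ := by
  have hm : MeasurableSet {y | l / 2 < ‖f y‖ₑ} := measurableSet_lt measurable_const hc.enorm.measurable
  rw [stoppingSet, measure_iUnion pairwise_disjoint_stoppingCubes fun q => measurableSet_dyadicCube q.1]
  have h1 : ∀ q : stoppingCubes f l, volume (dyadicCube q.1) ≤ l⁻¹ * (2 * ∫⁻ y in dyadicCube q.1,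
      Set.indicator {y | l / 2 < ‖f y‖ₑ} (fun y => ‖f y‖ₑ) y) := by
    intro q
    rw [← ENNReal.div_eq_inv_mul, ENNReal.le_div_iff_mul_le (Or.inl hl0) (Or.inl hl), mul_comm]
    exact volume_le_of_mem_stoppingCubes hc hl q.2
  refine (ENNReal.tsum_le_tsum h1).trans ?_
  rw [ENNReal.tsum_mul_left, ENNReal.tsum_mul_left, ← lintegral_iUnion
    (fun q : stoppingCubes f l => measurableSet_dyadicCube q.1) pairwise_disjoint_stoppingCubes,
    ← mul_assoc, mul_comm l⁻¹ 2]
  refine mul_le_mul' le_rfl ((setLIntegral_le_lintegral _ _).trans ?_)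
  rw [lintegral_indicator hm]

lemma volume_stoppingSet_ne_top (hc : Continuous f) (hf : ∫⁻ y, ‖f y‖ₑ ≠ ∞)
    (hl0 : l ≠ 0) (hl : l ≠ ∞) : volume (stoppingSet f l) ≠ ∞ := by
  refine ne_top_of_le_ne_top ?_ (volume_stoppingSet_le hc hl0 hl)
  refine ENNReal.mul_ne_top (ENNReal.mul_ne_top (by norm_num) (ENNReal.inv_ne_top.2 hl0)) ?_
  exact ne_top_of_le_ne_top hf (setLIntegral_le_lintegral _ _)

lemma enorm_goodPart_le_of_mem {x : EuclideanSpace ℝ (Fin d)} (hx : x ∈ stoppingSet f l) :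
    ‖goodPart f l x‖ₑ ≤ 2 ^ d * l := by
  obtain ⟨q, hq⟩ := Set.mem_iUnion.1 hx
  rw [goodPart_of_mem q hq, setAverage_eq, enorm_smul]
  have hpos := volume_dyadicCube_pos q.1
  have hfin := volume_dyadicCube_ne_top q.1
  have h1 : ‖(volume.real (dyadicCube q.1))⁻¹‖ₑ = (volume (dyadicCube q.1))⁻¹ := by
    rw [enorm_inv (by rw [Measure.real]; exact (ENNReal.toReal_pos hpos.ne' hfin).ne'), Measure.real,
      Real.enorm_eq_ofReal ENNReal.toReal_nonneg, ENNReal.ofReal_toReal hfin]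
  rw [h1, ← ENNReal.div_eq_inv_mul]
  refine ENNReal.div_le_of_le_mul ?_
  exact (enorm_integral_le_lintegral_enorm _).trans (lintegral_le_of_mem_stoppingCubes q.2)

lemma aestronglyMeasurable_goodPart (hc : Continuous f) :
    AEStronglyMeasurable (goodPart f l) (volume : Measure (EuclideanSpace ℝ (Fin d))) := by
  have h1 : AEStronglyMeasurable (goodPart f l) (volume.restrict (stoppingSet f l)) := by
    rw [stoppingSet, aestronglyMeasurable_iUnion_iff]
    intro q
    refine (aestronglyMeasurable_const (b := ⨍ y in dyadicCube q.1, f y)).congr ?_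
    filter_upwards [self_mem_ae_restrict (measurableSet_dyadicCube q.1)] with x hx
    rw [goodPart_of_mem q hx]
  have h2 : AEStronglyMeasurable (goodPart f l) (volume.restrict (stoppingSet f l)ᶜ) := by
    refine (hc.aestronglyMeasurable (μ := volume.restrict (stoppingSet f l)ᶜ)).congr ?_
    filter_upwards [self_mem_ae_restrict measurableSet_stoppingSet.compl] with x hx
    rw [goodPart_of_notMem hx]
  have := aestronglyMeasurable_union_iff.2 ⟨h1, h2⟩
  rwa [Set.union_compl_self, Measure.restrict_univ] at this

/-- On the stopping set the averages are at most `2^d l`; off it the function is unchanged and at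
most `l`. The powers 1 and 2 serve for integrability and for the `L²` estimate. -/
lemma lintegral_enorm_goodPart_pow_le (hd : 1 ≤ d) (hc : Continuous f) (hf : ∫⁻ y, ‖f y‖ₑ ≠ ∞)
    (hl0 : l ≠ 0) (n : ℕ) :
    ∫⁻ x, ‖goodPart f l x‖ₑ ^ n ≤ (2 ^ d * l) ^ n * volume (stoppingSet f l) +
      ∫⁻ x in {x | ‖f x‖ₑ ≤ l}, ‖f x‖ₑ ^ n := by
  rw [← lintegral_add_compl _ (measurableSet_stoppingSet (f := f) (l := l))]
  refine add_le_add ?_ ?_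
  · rw [← setLIntegral_const]
    refine setLIntegral_mono' measurableSet_stoppingSet fun x hx => ?_
    gcongr
    exact enorm_goodPart_le_of_mem hx
  · have hsub : (stoppingSet f l)ᶜ ⊆ {x | ‖f x‖ₑ ≤ l} := by
      intro x hx
      refine enorm_le_of_notMem_stoppingCubes hd hl0 hf hc fun q hq hxq => hx ?_
      exact Set.mem_iUnion.2 ⟨⟨q, hq⟩, hxq⟩
    refine le_trans ?_ (lintegral_mono_set hsub)
    refine setLIntegral_mono' measurableSet_stoppingSet.compl fun x hx => ?_
    rw [goodPart_of_notMem hx]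

lemma integrable_goodPart (hd : 1 ≤ d) (hc : Continuous f) (hf : Integrable f)
    (hl0 : l ≠ 0) (hl : l ≠ ∞) : Integrable (goodPart f l) := by
  refine ⟨aestronglyMeasurable_goodPart hc, ?_⟩
  have hf' := hf.2
  rw [hasFiniteIntegral_iff_enorm] at hf' ⊢
  have := lintegral_enorm_goodPart_pow_le hd hc hf'.ne hl0 1
  simp only [pow_one] at this
  refine this.trans_lt (ENNReal.add_lt_top.2 ⟨?_, ?_⟩)
  · exact ENNReal.mul_lt_top (ENNReal.mul_lt_top (by simp) hl.lt_top)
      (volume_stoppingSet_ne_top hc hf'.ne hl0 hl).lt_top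
  · exact (setLIntegral_le_lintegral _ _).trans_lt hf'

lemma memLp_two_goodPart (hd : 1 ≤ d) (hc : Continuous f) (hf : Integrable f) (hf2 : MemLp f 2)
    (hl0 : l ≠ 0) (hl : l ≠ ∞) : MemLp (goodPart f l) 2 := by
  refine ⟨aestronglyMeasurable_goodPart hc, ?_⟩
  have hf' := hf.2
  rw [hasFiniteIntegral_iff_enorm] at hf'
  have h2 := (eLpNorm_lt_top_iff_lintegral_rpow_enorm_lt_top two_ne_zero ENNReal.ofNat_ne_top).1 hf2.2
  rw [eLpNorm_lt_top_iff_lintegral_rpow_enorm_lt_top two_ne_zero ENNReal.ofNat_ne_top]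
  simp only [ENNReal.toReal_ofNat, ENNReal.rpow_ofNat] at h2 ⊢
  refine (lintegral_enorm_goodPart_pow_le hd hc hf'.ne hl0 2).trans_lt (ENNReal.add_lt_top.2 ⟨?_, ?_⟩)
  · exact ENNReal.mul_lt_top (ENNReal.pow_lt_top (ENNReal.mul_lt_top (by simp) hl.lt_top))
      (volume_stoppingSet_ne_top hc hf'.ne hl0 hl).lt_top
  · exact (setLIntegral_le_lintegral _ _).trans_lt h2

lemma integrable_badPart (hd : 1 ≤ d) (hc : Continuous f) (hf : Integrable f)
    (hl0 : l ≠ 0) (hl : l ≠ ∞) : Integrable (badPart f l) :=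
  hf.sub (integrable_goodPart hd hc hf hl0 hl)

lemma setIntegral_badPart [CompleteSpace F] (q : stoppingCubes f l) :
    ∫ x in dyadicCube q.1, badPart f l x = 0 := by
  have h : ∫ x in dyadicCube q.1, badPart f l x =
      ∫ x in dyadicCube q.1, (f x - ⨍ y in dyadicCube q.1, f y) :=
    setIntegral_congr_fun (measurableSet_dyadicCube _) fun x hx => by
      simp only [badPart, goodPart_of_mem q hx]
  have : IsFiniteMeasure (volume.restrict (dyadicCube q.1)) :=
    ⟨by rw [Measure.restrict_apply_univ]; exact (volume_dyadicCube_ne_top q.1).lt_top⟩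
  rw [h, integral_sub_average]

lemma setLIntegral_badPart_le (q : stoppingCubes f l) :
    ∫⁻ x in dyadicCube q.1, ‖badPart f l x‖ₑ ≤ 2 * (2 ^ d * l) * volume (dyadicCube q.1) := by
  calc ∫⁻ x in dyadicCube q.1, ‖badPart f l x‖ₑ
      ≤ ∫⁻ x in dyadicCube q.1, (‖f x‖ₑ + 2 ^ d * l) :=
        setLIntegral_mono' (measurableSet_dyadicCube _) fun x hx => by
          refine (enorm_sub_le).trans ?_
          gcongr
          exact enorm_goodPart_le_of_mem (Set.mem_iUnion.2 ⟨q, hx⟩)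
    _ = (∫⁻ x in dyadicCube q.1, ‖f x‖ₑ) + 2 ^ d * l * volume (dyadicCube q.1) := by
        rw [lintegral_add_right _ measurable_const, setLIntegral_const]
    _ ≤ 2 ^ d * l * volume (dyadicCube q.1) + 2 ^ d * l * volume (dyadicCube q.1) := by
        gcongr
        exact lintegral_le_of_mem_stoppingCubes q.2
    _ = _ := by ring

end CalderonZygmund

/-! ### The distributional estimate -/

section OpConv

set_option linter.unusedSectionVars false

variable {d : ℕ} {F : Type*} [NormedAddCommGroup F] [NormedSpace ℝ F]

/-- Convolution with an operator valued kernel. -/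
def opConv (K : EuclideanSpace ℝ (Fin d) → F →L[ℝ] F) (f : EuclideanSpace ℝ (Fin d) → F)
    (x : EuclideanSpace ℝ (Fin d)) : F :=
  ∫ y, K (x - y) (f y)

variable {K : EuclideanSpace ℝ (Fin d) → F →L[ℝ] F} {M : ℝ}
  {f : EuclideanSpace ℝ (Fin d) → F}

/-- The bound `M` is qualitative: it makes the convolution converge at every point and enters no
constant of the Calderón–Zygmund theorem. -/
lemma integrable_apply_of_bounded (hK : Continuous K) (hM : ∀ x, ‖K x‖ ≤ M) {μ : Measure (EuclideanSpace ℝ (Fin d))}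
    (hf : Integrable f μ) (x : EuclideanSpace ℝ (Fin d)) :
    Integrable (fun y => K (x - y) (f y)) μ := by
  refine (hf.norm.const_mul M).mono' ?_ (Eventually.of_forall fun y => ?_)
  · exact (ContinuousLinearMap.id ℝ (F →L[ℝ] F)).aestronglyMeasurable_comp₂
      ((hK.comp (continuous_const.sub continuous_id)).aestronglyMeasurable) hf.1
  · exact ((K (x - y)).le_opNorm _).trans (by gcongr; exact hM _)

lemma continuous_opConv (hK : Continuous K) (hM : ∀ x, ‖K x‖ ≤ M) (hf : Integrable f) :
    Continuous (opConv K f) := by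
  refine continuous_of_dominated (bound := fun y => M * ‖f y‖)
    (fun x => (integrable_apply_of_bounded hK hM hf x).1) (fun x => Eventually.of_forall fun y => ?_)
    (hf.norm.const_mul M) (Eventually.of_forall fun y => ?_)
  · exact ((K (x - y)).le_opNorm _).trans (by gcongr; exact hM _)
  · exact (hK.comp (continuous_id.sub continuous_const)).clm_apply continuous_const

lemma opConv_add {g : EuclideanSpace ℝ (Fin d) → F} (hK : Continuous K) (hM : ∀ x, ‖K x‖ ≤ M)
    (hf : Integrable f) (hg : Integrable g) (x : EuclideanSpace ℝ (Fin d)) :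
    opConv K (fun y => f y + g y) x = opConv K f x + opConv K g x := by
  simp only [opConv, map_add]
  exact integral_add (integrable_apply_of_bounded hK hM hf x) (integrable_apply_of_bounded hK hM hg x)

variable {l A : ℝ≥0∞} [CompleteSpace F]

/-- The bad part has mean zero on each stopping cube, so the kernel at the corner may be subtracted
there. -/
lemma enorm_opConv_badPart_le (hd : 1 ≤ d) (hK : Continuous K) (hM : ∀ x, ‖K x‖ ≤ M)
    (hc : Continuous f) (hf : Integrable f) (hl0 : l ≠ 0) (hl : l ≠ ∞) (x : EuclideanSpace ℝ (Fin d)) :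
    ‖opConv K (badPart f l) x‖ₑ ≤ ∑' q : stoppingCubes f l, ∫⁻ y in dyadicCube q.1,
      ‖K (x - y) - K (x - dyadicCorner q.1)‖ₑ * ‖badPart f l y‖ₑ := by
  have hb := integrable_badPart hd hc hf hl0 hl
  have hint := integrable_apply_of_bounded hK hM hb x
  have h1 : opConv K (badPart f l) x =
      ∑' q : stoppingCubes f l, ∫ y in dyadicCube q.1, K (x - y) (badPart f l y) := by
    rw [← integral_iUnion (fun q : stoppingCubes f l => measurableSet_dyadicCube q.1)
      pairwise_disjoint_stoppingCubes hint.integrableOn]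
    refine (setIntegral_eq_integral_of_forall_compl_eq_zero fun y hy => ?_).symm
    rw [badPart_of_notMem hy, map_zero]
  rw [h1]
  refine enorm_tsum_le_tsum_enorm.trans (ENNReal.tsum_le_tsum fun q => ?_)
  have h2 : ∫ y in dyadicCube q.1, K (x - y) (badPart f l y) =
      ∫ y in dyadicCube q.1, (K (x - y) - K (x - dyadicCorner q.1)) (badPart f l y) := by
    have h3 : ∫ y in dyadicCube q.1, K (x - dyadicCorner q.1) (badPart f l y) = 0 := by
      rw [ContinuousLinearMap.integral_comp_comm _ hb.integrableOn, setIntegral_badPart, map_zero]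
    simp only [sub_apply]
    rw [integral_sub hint.integrableOn
      ((K (x - dyadicCorner q.1)).integrable_comp hb.integrableOn), h3, sub_zero]
  rw [h2]
  refine (enorm_integral_le_lintegral_enorm _).trans (lintegral_mono fun y => ?_)
  exact ContinuousLinearMap.le_opENorm _ _

/-- The dilated stopping cubes. -/
def dilatedStoppingSet (f : EuclideanSpace ℝ (Fin d) → F) (l : ℝ≥0∞) :
    Set (EuclideanSpace ℝ (Fin d)) :=
  ⋃ q : stoppingCubes f l, Metric.ball (dyadicCorner q.1) (2 * (√d * 2 ^ (-q.1.1)))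

/-- The ratio of the volumes of a dilated cube and the cube. -/
def dilationConst (d : ℕ) : ℝ≥0∞ :=
  ENNReal.ofReal ((2 * √d) ^ d) * volume (Metric.ball (0 : EuclideanSpace ℝ (Fin d)) 1)

lemma dilationConst_ne_top (d : ℕ) : dilationConst d ≠ ∞ :=
  ENNReal.mul_ne_top ENNReal.ofReal_ne_top measure_ball_lt_top.ne

lemma volume_dilatedStoppingSet_le (hd : 1 ≤ d) :
    volume (dilatedStoppingSet f l) ≤ dilationConst d * volume (stoppingSet f l) := by
  have : Nonempty (Fin d) := ⟨⟨0, hd⟩⟩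
  rw [stoppingSet, measure_iUnion pairwise_disjoint_stoppingCubes fun q => measurableSet_dyadicCube q.1,
    ← ENNReal.tsum_mul_left]
  refine (measure_iUnion_le _).trans (ENNReal.tsum_le_tsum fun q => ?_)
  rw [Measure.addHaar_ball _ _ (by positivity), finrank_euclideanSpace_fin, volume_dyadicCube,
    dilationConst, ← mul_assoc (2 : ℝ), mul_pow, ENNReal.ofReal_mul (by positivity)]
  exact le_of_eq (by ring)

lemma setLIntegral_kernel_sub_le
    (hH : ∀ h, ∫⁻ x in {x | 2 * ‖h‖ ≤ ‖x‖}, ‖K (x - h) - K x‖ₑ ≤ A)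
    {S : Set (EuclideanSpace ℝ (Fin d))} (c y : EuclideanSpace ℝ (Fin d))
    (hS : ∀ x ∈ S, 2 * ‖y - c‖ ≤ ‖x - c‖) (hSm : MeasurableSet S) :
    ∫⁻ x in S, ‖K (x - y) - K (x - c)‖ₑ ≤ A := by
  refine le_trans ?_ (hH (y - c))
  have hm : MeasurableSet {x : EuclideanSpace ℝ (Fin d) | 2 * ‖y - c‖ ≤ ‖x‖} :=
    measurableSet_le measurable_const measurable_norm
  rw [← lintegral_indicator hSm, ← lintegral_indicator hm,
    ← lintegral_sub_right_eq_self (Set.indicator {x : EuclideanSpace ℝ (Fin d) | 2 * ‖y - c‖ ≤ ‖x‖}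
      fun x => ‖K (x - (y - c)) - K x‖ₑ) c]
  refine lintegral_mono fun x => ?_
  by_cases hx : x ∈ S
  · rw [Set.indicator_of_mem hx, Set.indicator_of_mem (by exact hS x hx)]
    have : x - c - (y - c) = x - y := by abel
    rw [this]
  · rw [Set.indicator_of_notMem hx]
    exact zero_le

/-- By Tonelli the `x` integral is done first. The balls removed have radius twice the diameter
bound of the cube, so off them `‖x - c‖ ≥ 2‖y - c‖` and Hörmander's condition bounds the inner
integral by `A`. -/
lemma setLIntegral_opConv_badPart_le (hd : 1 ≤ d) (hK : Continuous K) (hM : ∀ x, ‖K x‖ ≤ M)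
    (hH : ∀ h, ∫⁻ x in {x | 2 * ‖h‖ ≤ ‖x‖}, ‖K (x - h) - K x‖ₑ ≤ A)
    (hc : Continuous f) (hf : Integrable f) (hl0 : l ≠ 0) (hl : l ≠ ∞) :
    ∫⁻ x in (dilatedStoppingSet f l)ᶜ, ‖opConv K (badPart f l) x‖ₑ ≤
      A * (2 * (2 ^ d * l)) * volume (stoppingSet f l) := by
  have hb := integrable_badPart hd hc hf hl0 hl
  have hDm : MeasurableSet (dilatedStoppingSet f l)ᶜ :=
    (MeasurableSet.iUnion fun q => measurableSet_ball).compl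
  have hmeas : ∀ q : stoppingCubes f l, AEMeasurable (Function.uncurry fun x y =>
      ‖K (x - y) - K (x - dyadicCorner q.1)‖ₑ * ‖badPart f l y‖ₑ)
      ((volume.restrict (dilatedStoppingSet f l)ᶜ).prod (volume.restrict (dyadicCube q.1))) := by
    intro q
    have h2 : AEMeasurable (fun w : EuclideanSpace ℝ (Fin d) × EuclideanSpace ℝ (Fin d) =>
        ‖badPart f l w.2‖ₑ)
        ((volume.restrict (dilatedStoppingSet f l)ᶜ).prod (volume.restrict (dyadicCube q.1))) :=
      (hb.1.restrict.comp_snd (μ := volume.restrict (dilatedStoppingSet f l)ᶜ)).enorm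
    refine AEMeasurable.mul (f := fun w : EuclideanSpace ℝ (Fin d) × EuclideanSpace ℝ (Fin d) =>
      ‖K (w.1 - w.2) - K (w.1 - dyadicCorner q.1)‖ₑ) ?_ h2
    · have : Continuous fun w : EuclideanSpace ℝ (Fin d) × EuclideanSpace ℝ (Fin d) =>
          K (w.1 - w.2) - K (w.1 - dyadicCorner q.1) := by fun_prop
      exact this.enorm.measurable.aemeasurable
  calc ∫⁻ x in (dilatedStoppingSet f l)ᶜ, ‖opConv K (badPart f l) x‖ₑ
      ≤ ∫⁻ x in (dilatedStoppingSet f l)ᶜ, ∑' q : stoppingCubes f l, ∫⁻ y in dyadicCube q.1,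
        ‖K (x - y) - K (x - dyadicCorner q.1)‖ₑ * ‖badPart f l y‖ₑ :=
        lintegral_mono fun x => enorm_opConv_badPart_le hd hK hM hc hf hl0 hl x
    _ = ∑' q : stoppingCubes f l, ∫⁻ x in (dilatedStoppingSet f l)ᶜ, ∫⁻ y in dyadicCube q.1,
        ‖K (x - y) - K (x - dyadicCorner q.1)‖ₑ * ‖badPart f l y‖ₑ :=
        lintegral_tsum fun q => (hmeas q).lintegral_prod_right'
    _ = ∑' q : stoppingCubes f l, ∫⁻ y in dyadicCube q.1, ∫⁻ x in (dilatedStoppingSet f l)ᶜ,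
        ‖K (x - y) - K (x - dyadicCorner q.1)‖ₑ * ‖badPart f l y‖ₑ := by
        refine tsum_congr fun q => lintegral_lintegral_swap (hmeas q)
    _ ≤ ∑' q : stoppingCubes f l, A * (2 * (2 ^ d * l) * volume (dyadicCube q.1)) := by
        refine ENNReal.tsum_le_tsum fun q => ?_
        calc ∫⁻ y in dyadicCube q.1, ∫⁻ x in (dilatedStoppingSet f l)ᶜ,
              ‖K (x - y) - K (x - dyadicCorner q.1)‖ₑ * ‖badPart f l y‖ₑ
            ≤ ∫⁻ y in dyadicCube q.1, A * ‖badPart f l y‖ₑ := by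
              refine setLIntegral_mono' (measurableSet_dyadicCube _) fun y hy => ?_
              rw [lintegral_mul_const' _ _ enorm_ne_top]
              gcongr
              refine setLIntegral_kernel_sub_le hH _ _ (fun x hx => ?_) hDm
              have h1 : ‖y - dyadicCorner q.1‖ ≤ √d * 2 ^ (-q.1.1) :=
                norm_sub_le_of_mem_dyadicCube hy (dyadicIndex_corner q.1)
              have h2 : x ∉ Metric.ball (dyadicCorner q.1) (2 * (√d * 2 ^ (-q.1.1))) :=
                fun h => hx (Set.mem_iUnion.2 ⟨q, h⟩)
              rw [Metric.mem_ball, dist_eq_norm, not_lt] at h2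
              linarith
          _ = A * ∫⁻ y in dyadicCube q.1, ‖badPart f l y‖ₑ :=
              lintegral_const_mul'' _ hb.1.restrict.enorm
          _ ≤ _ := by
              gcongr
              exact setLIntegral_badPart_le q
    _ = _ := by
        rw [ENNReal.tsum_mul_left, ENNReal.tsum_mul_left, stoppingSet,
          measure_iUnion pairwise_disjoint_stoppingCubes fun q => measurableSet_dyadicCube q.1, ← mul_assoc]

/-- The constant in the distributional estimate. -/
def weakConst (d : ℕ) : ℝ≥0∞ := 2 * ((2 ^ d) ^ 2 + dilationConst d + 2 * 2 ^ d)

lemma weakConst_ne_top (d : ℕ) : weakConst d ≠ ∞ := by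
  refine ENNReal.mul_ne_top (by norm_num) (ENNReal.add_ne_top.2 ⟨ENNReal.add_ne_top.2
    ⟨by simp, dilationConst_ne_top d⟩, by finiteness⟩)

/-- The Calderón–Zygmund distributional estimate at height `l`. -/
theorem volume_lt_enorm_opConv_le (hd : 1 ≤ d) (hK : Continuous K) (hM : ∀ x, ‖K x‖ ≤ M)
    (hA0 : A ≠ 0) (hA : A ≠ ∞)
    (hL2 : ∀ g, Integrable g → MemLp g 2 →
      ∫⁻ x, ‖opConv K g x‖ₑ ^ 2 ≤ A ^ 2 * ∫⁻ x, ‖g x‖ₑ ^ 2)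
    (hH : ∀ h, ∫⁻ x in {x | 2 * ‖h‖ ≤ ‖x‖}, ‖K (x - h) - K x‖ₑ ≤ A)
    (hc : Continuous f) (hf : Integrable f) (hf2 : MemLp f 2) (hl0 : l ≠ 0) (hl : l ≠ ∞) :
    volume {x | 2 * (A * l) < ‖opConv K f x‖ₑ} ≤
      (l ^ 2)⁻¹ * (∫⁻ x in {x | ‖f x‖ₑ ≤ l}, ‖f x‖ₑ ^ 2) +
        weakConst d * (l⁻¹ * ∫⁻ x in {x | l / 2 < ‖f x‖ₑ}, ‖f x‖ₑ) := by
  have hg := integrable_goodPart hd hc hf hl0 hl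
  have hg2 := memLp_two_goodPart hd hc hf hf2 hl0 hl
  have hb := integrable_badPart hd hc hf hl0 hl
  have hf' : ∫⁻ y, ‖f y‖ₑ ≠ ∞ := by
    have := hf.2
    rw [hasFiniteIntegral_iff_enorm] at this
    exact this.ne
  have hAl0 : A * l ≠ 0 := mul_ne_zero hA0 hl0
  have hAl : A * l ≠ ∞ := ENNReal.mul_ne_top hA hl
  have hsplit : ∀ x, opConv K f x = opConv K (goodPart f l) x + opConv K (badPart f l) x := by
    intro x
    rw [← opConv_add hK hM hg hb]
    simp [badPart]
  -- Chebyshev in `L²`. At height `A * l` the constant `A` cancels, here and for the bad part, which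
  -- makes the final `L^q` bound linear in `A`.
  have hgood : volume {x | A * l ≤ ‖opConv K (goodPart f l) x‖ₑ} ≤
      (2 ^ d) ^ 2 * volume (stoppingSet f l) + (l ^ 2)⁻¹ * ∫⁻ x in {x | ‖f x‖ₑ ≤ l}, ‖f x‖ₑ ^ 2 := by
    have h1 : volume {x | A * l ≤ ‖opConv K (goodPart f l) x‖ₑ} ≤
        volume {x | (A * l) ^ 2 ≤ ‖opConv K (goodPart f l) x‖ₑ ^ 2} :=
      measure_mono fun x hx => by
        simp only [Set.mem_ofPred_eq] at hx ⊢
        gcongr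
    refine h1.trans ((meas_ge_le_lintegral_div
      ((continuous_opConv hK hM hg).enorm.measurable.aemeasurable.pow_const 2)
      (pow_ne_zero 2 hAl0) (ENNReal.pow_ne_top hAl)).trans ?_)
    refine ENNReal.div_le_of_le_mul ((hL2 _ hg hg2).trans ?_)
    have h2 := lintegral_enorm_goodPart_pow_le hd hc hf' hl0 2
    calc A ^ 2 * ∫⁻ x, ‖goodPart f l x‖ₑ ^ 2
        ≤ A ^ 2 * ((2 ^ d * l) ^ 2 * volume (stoppingSet f l) +
          ∫⁻ x in {x | ‖f x‖ₑ ≤ l}, ‖f x‖ₑ ^ 2) := by gcongr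
      _ = A ^ 2 * ((2 ^ d * l) ^ 2 * volume (stoppingSet f l) +
          ((l ^ 2)⁻¹ * l ^ 2) * ∫⁻ x in {x | ‖f x‖ₑ ≤ l}, ‖f x‖ₑ ^ 2) := by
          rw [ENNReal.inv_mul_cancel (pow_ne_zero 2 hl0) (ENNReal.pow_ne_top hl), one_mul]
      _ = _ := by ring
  -- The dilated cubes are thrown away as a set of small measure; outside them Chebyshev in `L¹`
  -- applies.
  have hbad : volume {x | A * l ≤ ‖opConv K (badPart f l) x‖ₑ} ≤
      dilationConst d * volume (stoppingSet f l) + 2 * 2 ^ d * volume (stoppingSet f l) := by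
    have hDm : MeasurableSet (dilatedStoppingSet f l) :=
      MeasurableSet.iUnion fun q => measurableSet_ball
    have h1 : volume {x | A * l ≤ ‖opConv K (badPart f l) x‖ₑ} ≤ volume (dilatedStoppingSet f l) +
        volume.restrict (dilatedStoppingSet f l)ᶜ {x | A * l ≤ ‖opConv K (badPart f l) x‖ₑ} := by
      rw [Measure.restrict_apply' hDm.compl]
      refine (measure_mono fun x hx => ?_).trans (measure_union_le _ _)
      by_cases hxD : x ∈ dilatedStoppingSet f l
      · exact Or.inl hxD
      · exact Or.inr ⟨hx, hxD⟩
    refine h1.trans (add_le_add (volume_dilatedStoppingSet_le hd) ?_)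
    refine (meas_ge_le_lintegral_div
      (continuous_opConv hK hM hb).enorm.measurable.aemeasurable hAl0 hAl).trans ?_
    refine ENNReal.div_le_of_le_mul
      ((setLIntegral_opConv_badPart_le hd hK hM hH hc hf hl0 hl).trans_eq (by ring))
  have hvol := volume_stoppingSet_le hc hl0 hl
  calc volume {x | 2 * (A * l) < ‖opConv K f x‖ₑ}
      ≤ volume ({x | A * l ≤ ‖opConv K (goodPart f l) x‖ₑ} ∪
        {x | A * l ≤ ‖opConv K (badPart f l) x‖ₑ}) := by
        refine measure_mono fun x hx => ?_
        by_contra hcon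
        simp only [Set.mem_union, Set.mem_ofPred_eq, not_or, not_le] at hcon hx
        refine absurd hx (not_lt.2 ?_)
        rw [hsplit, two_mul]
        exact (enorm_add_le _ _).trans (add_le_add hcon.1.le hcon.2.le)
    _ ≤ _ := measure_union_le _ _
    _ ≤ _ := add_le_add hgood hbad
    _ = (l ^ 2)⁻¹ * (∫⁻ x in {x | ‖f x‖ₑ ≤ l}, ‖f x‖ₑ ^ 2) +
        ((2 ^ d) ^ 2 + dilationConst d + 2 * 2 ^ d) * volume (stoppingSet f l) := by ring
    _ ≤ _ := by
        rw [weakConst]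
        refine add_le_add le_rfl ((mul_le_mul' le_rfl hvol).trans_eq (by ring))

end OpConv

/-! ### From distributional estimates to `L^p` bounds -/

section Layer

variable {α : Type*} [MeasurableSpace α] {μ : Measure α} [SFinite μ] {u : α → ℝ} {q : ℝ}

/-- Tonelli reduces this to `∫_u^∞ t^{q-3} dt = u^{q-2} / (2 - q)`, finite exactly because `q < 2`.
-/
lemma lintegral_layer_low (hu : Measurable u) (hu0 : ∀ x, 0 ≤ u x) (hq2 : q < 2) :
    ∫⁻ t in Set.Ioi (0 : ℝ), ((ENNReal.ofReal t ^ 2)⁻¹ *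
      ∫⁻ x in {x | u x ≤ t}, ENNReal.ofReal (u x) ^ 2 ∂μ) * ENNReal.ofReal (t ^ (q - 1)) ≤
    ENNReal.ofReal (1 / (2 - q)) * ∫⁻ x, ENNReal.ofReal (u x ^ q) ∂μ := by
  set k : ℝ × α → ℝ≥0∞ := Set.indicator {w : ℝ × α | u w.2 ≤ w.1}
    fun w => ENNReal.ofReal (u w.2 ^ 2 * w.1 ^ (q - 3)) with hk
  have hkm : Measurable k := by
    refine Measurable.indicator ?_ (measurableSet_le (hu.comp measurable_snd) measurable_fst)
    fun_prop
  have h1 : ∀ t ∈ Set.Ioi (0 : ℝ), ((ENNReal.ofReal t ^ 2)⁻¹ *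
      ∫⁻ x in {x | u x ≤ t}, ENNReal.ofReal (u x) ^ 2 ∂μ) * ENNReal.ofReal (t ^ (q - 1)) =
      ∫⁻ x, k (t, x) ∂μ := by
    intro t ht
    have ht0 : (0 : ℝ) < t := ht
    have hm : MeasurableSet {x | u x ≤ t} := measurableSet_le hu measurable_const
    rw [← lintegral_const_mul _ (by fun_prop), ← lintegral_mul_const _ (by fun_prop),
      ← lintegral_indicator hm]
    refine lintegral_congr fun x => ?_
    by_cases hx : u x ≤ t
    · rw [Set.indicator_of_mem (by exact hx), hk, Set.indicator_of_mem (by exact hx),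
        ← ENNReal.ofReal_pow ht0.le, ← ENNReal.ofReal_pow (hu0 x),
        ← ENNReal.ofReal_inv_of_pos (by positivity), ← ENNReal.ofReal_mul (by positivity),
        ← ENNReal.ofReal_mul (by positivity)]
      congr 1
      have : t ^ (q - 1) = t ^ (q - 3) * t ^ 2 := by
        rw [← Real.rpow_natCast, ← Real.rpow_add ht0]; norm_num; ring_nf
      simp only [this]
      field_simp
    · rw [Set.indicator_of_notMem (by exact hx), hk, Set.indicator_of_notMem (by exact hx)]
  rw [setLIntegral_congr_fun measurableSet_Ioi h1, lintegral_lintegral_swap (f := fun t x => k (t, x)) hkm.aemeasurable,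
    ← lintegral_const_mul _ (by fun_prop)]
  refine lintegral_mono fun x => ?_
  rcases (hu0 x).eq_or_lt with h0 | h0
  · refine le_of_eq_of_le ?_ zero_le
    have : ∀ t, k (t, x) = 0 := by
      intro t
      rw [hk]
      refine Set.indicator_apply_eq_zero.2 fun _ => ?_
      simp [← h0]
    simp [this]
  · have h2 : ∀ t, k (t, x) ≤ Set.indicator (Set.Ici (u x))
        (fun t => ENNReal.ofReal (u x ^ 2 * t ^ (q - 3))) t := fun t => le_rfl
    refine (lintegral_mono h2).trans ((setLIntegral_le_lintegral _ _).trans ?_)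
    rw [lintegral_indicator measurableSet_Ici, setLIntegral_congr Ioi_ae_eq_Ici.symm]
    have hint : IntegrableOn (fun t => u x ^ 2 * t ^ (q - 3)) (Set.Ioi (u x)) :=
      (integrableOn_Ioi_rpow_of_lt (by linarith) h0).const_mul _
    rw [← ofReal_integral_eq_lintegral_ofReal hint, integral_const_mul,
      integral_Ioi_rpow_of_lt (by linarith) h0, ← ENNReal.ofReal_mul (by
        have : 0 < 2 - q := by linarith
        positivity)]
    · refine ENNReal.ofReal_le_ofReal (le_of_eq ?_)
      have h3 : u x ^ q = u x ^ (q - 3 + 1) * u x ^ 2 := by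
        rw [← Real.rpow_natCast, ← Real.rpow_add h0]; norm_num; ring_nf
      have h4 : 2 - q ≠ 0 := by linarith
      have h5 : q - 3 + 1 ≠ 0 := by linarith
      rw [h3]
      field_simp
      ring
    · filter_upwards [self_mem_ae_restrict measurableSet_Ioi] with t ht
      have : 0 < t := h0.trans ht
      positivity

/-- Tonelli reduces this to `∫_0^{2u} t^{q-2} dt = (2u)^{q-1} / (q - 1)`, finite exactly because `q
> 1`. -/
lemma lintegral_layer_high (hu : Measurable u) (hu0 : ∀ x, 0 ≤ u x) (hq1 : 1 < q) :
    ∫⁻ t in Set.Ioi (0 : ℝ), ((ENNReal.ofReal t)⁻¹ *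
      ∫⁻ x in {x | t / 2 < u x}, ENNReal.ofReal (u x) ∂μ) * ENNReal.ofReal (t ^ (q - 1)) ≤
    ENNReal.ofReal (2 ^ (q - 1) / (q - 1)) * ∫⁻ x, ENNReal.ofReal (u x ^ q) ∂μ := by
  set k : ℝ × α → ℝ≥0∞ := Set.indicator {w : ℝ × α | w.1 / 2 < u w.2}
    fun w => ENNReal.ofReal (u w.2 * w.1 ^ (q - 2)) with hk
  have hkm : Measurable k := by
    refine Measurable.indicator ?_ (measurableSet_lt (measurable_fst.div_const 2) (hu.comp measurable_snd))
    fun_prop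
  have h1 : ∀ t ∈ Set.Ioi (0 : ℝ), ((ENNReal.ofReal t)⁻¹ *
      ∫⁻ x in {x | t / 2 < u x}, ENNReal.ofReal (u x) ∂μ) * ENNReal.ofReal (t ^ (q - 1)) =
      ∫⁻ x, k (t, x) ∂μ := by
    intro t ht
    have ht0 : (0 : ℝ) < t := ht
    have hm : MeasurableSet {x | t / 2 < u x} := measurableSet_lt measurable_const hu
    rw [← lintegral_const_mul _ (by fun_prop), ← lintegral_mul_const _ (by fun_prop),
      ← lintegral_indicator hm]
    refine lintegral_congr fun x => ?_
    by_cases hx : t / 2 < u x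
    · have := hu0 x
      rw [Set.indicator_of_mem (by exact hx), hk, Set.indicator_of_mem (by exact hx),
        ← ENNReal.ofReal_inv_of_pos (by positivity), ← ENNReal.ofReal_mul (by positivity),
        ← ENNReal.ofReal_mul (by positivity)]
      congr 1
      have : t ^ (q - 1) = t ^ (q - 2) * t := by
        rw [← Real.rpow_add_one ht0.ne']; ring_nf
      simp only [this]
      field_simp
    · rw [Set.indicator_of_notMem (by exact hx), hk, Set.indicator_of_notMem (by exact hx)]
  rw [setLIntegral_congr_fun measurableSet_Ioi h1, lintegral_lintegral_swap (f := fun t x => k (t, x)) hkm.aemeasurable,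
    ← lintegral_const_mul _ (by fun_prop)]
  refine lintegral_mono fun x => ?_
  have h2 : ∀ t ∈ Set.Ioi (0 : ℝ), k (t, x) ≤ Set.indicator (Set.Ioc 0 (2 * u x))
      (fun t => ENNReal.ofReal (u x * t ^ (q - 2))) t := by
    intro t ht
    by_cases hx : t / 2 < u x
    · rw [hk, Set.indicator_of_mem (by exact hx),
        Set.indicator_of_mem (by exact ⟨ht, by linarith⟩)]
    · rw [hk, Set.indicator_of_notMem (by exact hx)]
      exact zero_le
  refine (setLIntegral_mono' measurableSet_Ioi h2).trans ((setLIntegral_le_lintegral _ _).trans ?_)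
  rw [lintegral_indicator measurableSet_Ioc]
  have h0 : 0 ≤ 2 * u x := mul_nonneg zero_le_two (hu0 x)
  have hint : IntervalIntegrable (fun t => u x * t ^ (q - 2)) volume 0 (2 * u x) :=
    (intervalIntegral.intervalIntegrable_rpow' (by linarith)).const_mul _
  rw [intervalIntegrable_iff_integrableOn_Ioc_of_le h0] at hint
  have hq1' : 0 < q - 1 := by linarith
  rw [← ofReal_integral_eq_lintegral_ofReal hint, ← intervalIntegral.integral_of_le h0,
    intervalIntegral.integral_const_mul, integral_rpow (Or.inl (by linarith)),
    ← ENNReal.ofReal_mul (by positivity)]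
  · refine ENNReal.ofReal_le_ofReal (le_of_eq ?_)
    have e : q - 2 + 1 = q - 1 := by ring
    rw [e, Real.zero_rpow hq1'.ne', sub_zero, Real.mul_rpow zero_le_two (hu0 x)]
    have h3 : u x ^ q = u x ^ (q - 1) * u x := by
      rw [← Real.rpow_add_one' (hu0 x) (by linarith)]; ring_nf
    rw [h3]
    ring
  · filter_upwards [self_mem_ae_restrict measurableSet_Ioc] with t ht
    have := ht.1
    have := hu0 x
    positivity

end Layer

/-! ### The Calderón–Zygmund theorem below exponent 2. -/

section OpConvLp

variable {d : ℕ} {F : Type*} [NormedAddCommGroup F] [NormedSpace ℝ F] [CompleteSpace F]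
  {K : EuclideanSpace ℝ (Fin d) → F →L[ℝ] F} {M : ℝ} {f : EuclideanSpace ℝ (Fin d) → F}

/-- The constant in the Calderón–Zygmund theorem for `1 < q < 2`. -/
def czConst (d : ℕ) (q : ℝ) : ℝ≥0∞ :=
  ENNReal.ofReal (2 ^ q) * (ENNReal.ofReal q * (ENNReal.ofReal (1 / (2 - q)) +
    weakConst d * ENNReal.ofReal (2 ^ (q - 1) / (q - 1))))

lemma czConst_ne_top (d : ℕ) (q : ℝ) : czConst d q ≠ ∞ :=
  ENNReal.mul_ne_top ENNReal.ofReal_ne_top (ENNReal.mul_ne_top ENNReal.ofReal_ne_top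
    (ENNReal.add_ne_top.2 ⟨ENNReal.ofReal_ne_top,
      ENNReal.mul_ne_top (weakConst_ne_top d) ENNReal.ofReal_ne_top⟩))

/-- The Calderón–Zygmund theorem for operator valued kernels, `1 < q < 2`. -/
theorem lintegral_enorm_opConv_rpow_le (hd : 1 ≤ d) (hK : Continuous K) (hM : ∀ x, ‖K x‖ ≤ M)
    {a : ℝ} (ha : 0 < a)
    (hL2 : ∀ g, Integrable g → MemLp g 2 →
      ∫⁻ x, ‖opConv K g x‖ₑ ^ 2 ≤ ENNReal.ofReal a ^ 2 * ∫⁻ x, ‖g x‖ₑ ^ 2)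
    (hH : ∀ h, ∫⁻ x in {x | 2 * ‖h‖ ≤ ‖x‖}, ‖K (x - h) - K x‖ₑ ≤ ENNReal.ofReal a)
    (hc : Continuous f) (hf : Integrable f) (hf2 : MemLp f 2) {q : ℝ} (hq1 : 1 < q) (hq2 : q < 2) :
    ∫⁻ x, ‖opConv K f x‖ₑ ^ q ≤ czConst d q * ENNReal.ofReal a ^ q * ∫⁻ x, ‖f x‖ₑ ^ q := by
  have hTc := continuous_opConv hK hM hf
  have hq0 : 0 < q := by linarith
  -- Division by `2a` matches the level `t` with the threshold `2 A l` at `l = t` in the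
  -- distributional estimate.
  have key : ∫⁻ x, ENNReal.ofReal ((‖opConv K f x‖ / (2 * a)) ^ q) ≤
      ENNReal.ofReal q * (ENNReal.ofReal (1 / (2 - q)) +
        weakConst d * ENNReal.ofReal (2 ^ (q - 1) / (q - 1))) * ∫⁻ x, ENNReal.ofReal (‖f x‖ ^ q) := by
    rw [lintegral_rpow_eq_lintegral_meas_lt_mul volume
      (Eventually.of_forall fun x => by positivity) (hTc.norm.div_const _).aemeasurable hq0, mul_assoc]
    refine mul_le_mul' le_rfl ?_
    have h1 : ∀ t ∈ Set.Ioi (0 : ℝ), volume {x | t < ‖opConv K f x‖ / (2 * a)} *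
        ENNReal.ofReal (t ^ (q - 1)) ≤
        ((ENNReal.ofReal t ^ 2)⁻¹ * ∫⁻ x in {x | ‖f x‖ ≤ t}, ENNReal.ofReal ‖f x‖ ^ 2) *
          ENNReal.ofReal (t ^ (q - 1)) +
        weakConst d * (((ENNReal.ofReal t)⁻¹ * ∫⁻ x in {x | t / 2 < ‖f x‖}, ENNReal.ofReal ‖f x‖) *
          ENNReal.ofReal (t ^ (q - 1))) := by
      intro t ht
      have ht0 : (0 : ℝ) < t := ht
      have hw := volume_lt_enorm_opConv_le hd hK hM (ENNReal.ofReal_pos.2 ha).ne' ENNReal.ofReal_ne_top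
        hL2 hH hc hf hf2 (ENNReal.ofReal_pos.2 ht0).ne' ENNReal.ofReal_ne_top
      have e1 : {x | t < ‖opConv K f x‖ / (2 * a)} =
          {x | 2 * (ENNReal.ofReal a * ENNReal.ofReal t) < ‖opConv K f x‖ₑ} := by
        ext x
        rw [Set.mem_ofPred_eq, Set.mem_ofPred_eq, ← ofReal_norm, ← ENNReal.ofReal_mul ha.le,
          ← ENNReal.ofReal_ofNat, ← ENNReal.ofReal_mul zero_le_two,
          ENNReal.ofReal_lt_ofReal_iff_of_nonneg (by positivity), lt_div_iff₀ (by positivity)]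
        ring_nf
      have e2 : {x | ‖f x‖ₑ ≤ ENNReal.ofReal t} = {x | ‖f x‖ ≤ t} := by
        ext x
        rw [Set.mem_ofPred_eq, Set.mem_ofPred_eq, ← ofReal_norm, ENNReal.ofReal_le_ofReal_iff ht0.le]
      have e3 : {x | ENNReal.ofReal t / 2 < ‖f x‖ₑ} = {x | t / 2 < ‖f x‖} := by
        ext x
        rw [Set.mem_ofPred_eq, Set.mem_ofPred_eq, ← ofReal_norm, ← ENNReal.ofReal_ofNat,
          ← ENNReal.ofReal_div_of_pos two_pos, ENNReal.ofReal_lt_ofReal_iff_of_nonneg (by positivity)]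
      rw [e1]
      rw [e2, e3] at hw
      simp only [← ofReal_norm] at hw ⊢
      refine (mul_le_mul' hw le_rfl).trans_eq ?_
      ring
    refine (setLIntegral_mono' measurableSet_Ioi h1).trans ?_
    have hlow := lintegral_layer_low (μ := (volume : Measure (EuclideanSpace ℝ (Fin d))))
      hc.norm.measurable (fun x => norm_nonneg (f x)) hq2
    have hhigh := lintegral_layer_high (μ := (volume : Measure (EuclideanSpace ℝ (Fin d))))
      hc.norm.measurable (fun x => norm_nonneg (f x)) hq1
    have hmono : ∀ s t : ℝ, s ≤ t → ∫⁻ x in {x | ‖f x‖ ≤ s}, ENNReal.ofReal ‖f x‖ ^ 2 ≤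
        ∫⁻ x in {x | ‖f x‖ ≤ t}, ENNReal.ofReal ‖f x‖ ^ 2 := fun s t hst =>
      lintegral_mono_set fun x hx => le_trans hx hst
    have hmeas : Measurable fun t : ℝ => ((ENNReal.ofReal t ^ 2)⁻¹ *
        ∫⁻ x in {x | ‖f x‖ ≤ t}, ENNReal.ofReal ‖f x‖ ^ 2) * ENNReal.ofReal (t ^ (q - 1)) := by
      have : Measurable fun t : ℝ => ∫⁻ x in {x | ‖f x‖ ≤ t}, ENNReal.ofReal ‖f x‖ ^ 2 :=
        Monotone.measurable fun s t hst => hmono s t hst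
      fun_prop
    rw [lintegral_add_left hmeas, lintegral_const_mul' _ _ (weakConst_ne_top d), add_mul, mul_assoc]
    exact add_le_add hlow (mul_le_mul' le_rfl hhigh)
  have e1 : ∀ x, ‖opConv K f x‖ₑ ^ q = ENNReal.ofReal (2 ^ q) * ENNReal.ofReal a ^ q *
      ENNReal.ofReal ((‖opConv K f x‖ / (2 * a)) ^ q) := by
    intro x
    rw [← ofReal_norm, ENNReal.ofReal_rpow_of_nonneg (norm_nonneg _) hq0.le,
      ENNReal.ofReal_rpow_of_nonneg ha.le hq0.le, ← ENNReal.ofReal_mul (by positivity),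
      ← ENNReal.ofReal_mul (by positivity), ← Real.mul_rpow (by norm_num) ha.le,
      ← Real.mul_rpow (by positivity) (by positivity), mul_div_cancel₀ _ (by positivity)]
  have e2 : ∀ x, ‖f x‖ₑ ^ q = ENNReal.ofReal (‖f x‖ ^ q) := by
    intro x
    rw [← ofReal_norm, ENNReal.ofReal_rpow_of_nonneg (norm_nonneg _) hq0.le]
  simp_rw [e1, e2]
  rw [lintegral_const_mul' _ _ (ENNReal.mul_ne_top ENNReal.ofReal_ne_top
    (ENNReal.rpow_ne_top_of_nonneg hq0.le ENNReal.ofReal_ne_top)), czConst]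
  refine (mul_le_mul' le_rfl key).trans_eq ?_
  ring

end OpConvLp

/-! ### Diagonal convolution operators on vector valued `L^p` -/

section Diag

variable {d n : ℕ} {p : ℝ≥0∞}

/-- `ℓ²`-valued `L^p` functions. -/
abbrev VecLp (d n : ℕ) (p : ℝ≥0∞) : Type :=
  Lp (EuclideanSpace ℂ (Fin n)) p (volume : Measure (EuclideanSpace ℝ (Fin d)))

/-- The vector valued function with given coordinates. -/
def vecLp (f : Fin n → LpSpace d p) : VecLp d n p :=
  MemLp.toLp (fun x => WithLp.toLp 2 fun i => f i x)
    (memLp_piLp_iff.2 fun i => Lp.memLp (f i))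

lemma vecLp_ae (f : Fin n → LpSpace d p) :
    vecLp f =ᵐ[volume] fun x => WithLp.toLp 2 fun i => f i x :=
  MemLp.coeFn_toLp _

variable [Fact (1 ≤ p)] [Fact (p ≠ ∞)]

/-- The coordinates of a vector valued function. -/
def coordLp (i : Fin n) : VecLp d n p →L[ℂ] LpSpace d p :=
  (EuclideanSpace.proj i : EuclideanSpace ℂ (Fin n) →L[ℂ] ℂ).compLpL p volume

omit [Fact (p ≠ ∞)] in
lemma coordLp_ae (i : Fin n) (v : VecLp d n p) : coordLp i v =ᵐ[volume] fun x => v x i :=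
  ContinuousLinearMap.coeFn_compLpL _ _

omit [Fact (p ≠ ∞)] in
lemma coordLp_vecLp (i : Fin n) (f : Fin n → LpSpace d p) : coordLp i (vecLp f) = f i := by
  refine Lp.ext ?_
  filter_upwards [coordLp_ae i (vecLp f), vecLp_ae f] with x h1 h2
  rw [h1, h2]

/-- The diagonal convolution operator. -/
def diagConv (d n : ℕ) (p : ℝ≥0∞) [Fact (1 ≤ p)] [Fact (p ≠ ∞)] (K : Fin n → LpSpace d 1) :
    VecLp d n p →L[ℂ] VecLp d n p :=
  ∑ i, ((ContinuousLinearMap.toSpanSingleton ℂ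
    (EuclideanSpace.single i (1 : ℂ))).compLpL p volume).comp ((convLp d p (K i)).comp (coordLp i))

lemma diagConv_ae (K : Fin n → LpSpace d 1) (v : VecLp d n p) :
    diagConv d n p K v =ᵐ[volume] fun x => WithLp.toLp 2 fun i => convLp d p (K i) (coordLp i v) x := by
  have h1 : diagConv d n p K v = ∑ i, (ContinuousLinearMap.toSpanSingleton ℂ
    (EuclideanSpace.single i (1 : ℂ))).compLpL p volume (convLp d p (K i) (coordLp i v)) := by
    simp [diagConv, sum_apply]
  rw [h1]
  have h2 : ∀ i, ∀ᵐ x, (ContinuousLinearMap.toSpanSingleton ℂ (EuclideanSpace.single i (1 : ℂ))).compLpL p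
      volume (convLp d p (K i) (coordLp i v)) x =
      convLp d p (K i) (coordLp i v) x • EuclideanSpace.single i (1 : ℂ) := by
    intro i
    filter_upwards [ContinuousLinearMap.coeFn_compLpL (ContinuousLinearMap.toSpanSingleton ℂ
      (EuclideanSpace.single i (1 : ℂ))) (convLp d p (K i) (coordLp i v))] with x hx
    rw [hx, ContinuousLinearMap.toSpanSingleton_apply]
  filter_upwards [Lp.coeFn_fun_finsetSum Finset.univ fun i => (ContinuousLinearMap.toSpanSingleton ℂ
    (EuclideanSpace.single i (1 : ℂ))).compLpL p volume (convLp d p (K i) (coordLp i v)),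
    ae_all_iff.2 h2] with x hx hx2
  rw [hx]
  simp only [hx2]
  ext j
  simp [WithLp.ofLp_sum, Finset.sum_apply, Pi.single_apply]

lemma diagConv_vecLp (K : Fin n → LpSpace d 1) (f : Fin n → LpSpace d p) :
    diagConv d n p K (vecLp f) = vecLp fun i => convLp d p (K i) (f i) := by
  refine Lp.ext ?_
  filter_upwards [diagConv_ae K (vecLp f), vecLp_ae fun i => convLp d p (K i) (f i)] with x h1 h2
  rw [h1, h2]
  simp only [coordLp_vecLp]

lemma enorm_sq_euclidean (v : EuclideanSpace ℂ (Fin n)) : ‖v‖ₑ ^ 2 = ∑ i, ‖v i‖ₑ ^ 2 := by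
  simp_rw [← ofReal_norm, ← ENNReal.ofReal_pow (norm_nonneg _)]
  rw [EuclideanSpace.norm_sq_eq, ENNReal.ofReal_sum_of_nonneg fun i _ => by positivity]

lemma lintegral_enorm_sq_eq_of_Lp_two {G : Type*} [NormedAddCommGroup G]
    (v : Lp G 2 (volume : Measure (EuclideanSpace ℝ (Fin d)))) :
    ∫⁻ x, ‖v x‖ₑ ^ 2 = ‖v‖ₑ ^ 2 := by
  rw [Lp.enorm_def, eLpNorm_eq_lintegral_rpow_enorm_toReal two_ne_zero ENNReal.ofNat_ne_top,
    ← ENNReal.rpow_natCast, ← ENNReal.rpow_mul]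
  simp

/-- Plancherel in each coordinate: on `L²` nothing is lost in `n` or in the angle of `z`. -/
lemma norm_diagConv_two_le (K : Fin n → LpSpace d 1)
    (hK : ∀ i ξ, ‖𝓕 (K i : EuclideanSpace ℝ (Fin d) → ℂ) ξ‖ ≤ 1) (v : VecLp d n 2) :
    ‖diagConv d n 2 K v‖ ≤ ‖v‖ := by
  have key : ∀ w : VecLp d n 2, ‖w‖ₑ ^ 2 = ∑ i, ‖coordLp i w‖ₑ ^ 2 := by
    intro w
    simp_rw [← lintegral_enorm_sq_eq_of_Lp_two, enorm_sq_euclidean]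
    rw [lintegral_finsetSum' _ fun i _ => ?_]
    · refine Finset.sum_congr rfl fun i _ => lintegral_congr_ae ?_
      filter_upwards [coordLp_ae i w] with x hx
      rw [hx]
    · refine AEMeasurable.pow_const ?_ 2
      exact ((Lp.memLp (coordLp i w)).1.congr (coordLp_ae i w)).enorm
  have h1 : ∀ i, coordLp i (diagConv d n 2 K v) = convLp d 2 (K i) (coordLp i v) := by
    intro i
    refine Lp.ext ?_
    filter_upwards [coordLp_ae i (diagConv d n 2 K v), diagConv_ae K v] with x e1 e2
    rw [e1, e2]
  have h2 : ‖diagConv d n 2 K v‖ₑ ^ 2 ≤ ‖v‖ₑ ^ 2 := by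
    rw [key, key]
    refine Finset.sum_le_sum fun i _ => ?_
    rw [h1]
    have := norm_convLp_two_le (K i) (hK i) (coordLp i v)
    gcongr
    rwa [← ofReal_norm, ← ofReal_norm, ENNReal.ofReal_le_ofReal_iff (norm_nonneg _)]
  rw [← ofReal_norm, ← ofReal_norm, ← ENNReal.ofReal_pow (norm_nonneg _),
    ← ENNReal.ofReal_pow (norm_nonneg _), ENNReal.ofReal_le_ofReal_iff (by positivity)] at h2
  exact (sq_le_sq₀ (norm_nonneg _) (norm_nonneg _)).1 h2

/-- Diagonal matrices. -/
def diagCLM (n : ℕ) : (Fin n → ℂ) →L[ℝ] EuclideanSpace ℂ (Fin n) →L[ℝ] EuclideanSpace ℂ (Fin n) :=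
  LinearMap.mkContinuous₂ (LinearMap.mk₂ ℝ (fun c v => WithLp.toLp 2 fun i => c i * v i)
    (fun c c' v => by ext i; simp [add_mul]) (fun a c v => by ext i; simp [mul_assoc])
    (fun c v v' => by ext i; simp [mul_add]) (fun a c v => by ext i; simp; ring)) 1 (by
      intro c v
      rw [one_mul, LinearMap.mk₂_apply, ← sq_le_sq₀ (norm_nonneg _) (by positivity), mul_pow,
        EuclideanSpace.norm_sq_eq, EuclideanSpace.norm_sq_eq, Finset.mul_sum]
      refine Finset.sum_le_sum fun i _ => ?_
      rw [norm_mul, mul_pow]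
      gcongr
      exact norm_le_pi_norm c i)

lemma norm_diagCLM_le (c : Fin n → ℂ) : ‖diagCLM n c‖ ≤ ‖c‖ := by
  have h : ‖diagCLM n‖ ≤ 1 := LinearMap.mkContinuous₂_norm_le _ zero_le_one _
  exact ((diagCLM n).le_of_opNorm_le h c).trans_eq (one_mul _)

lemma convLp_ae_of_ae_eq {K : LpSpace d 1} {k : EuclideanSpace ℝ (Fin d) → ℂ} (hk : K =ᵐ[volume] k)
    (f : LpSpace d p) : convLp d p K f =ᵐ[volume] fun x => ∫ y, k (x - y) * f y := by
  filter_upwards [convLp_ae K f] with x hx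
  rw [hx]
  refine integral_congr_ae ?_
  filter_upwards [(Measure.measurePreserving_sub_left volume x).quasiMeasurePreserving.ae_eq_comp hk]
    with y hy
  simp only [Function.comp_apply] at hy
  rw [hy]

/-- Connects the bounded operator on classes with the pointwise convolution of the Calderón–Zygmund
theorem. -/
lemma diagConv_toLp_ae {K : Fin n → LpSpace d 1} {k : Fin n → EuclideanSpace ℝ (Fin d) → ℂ}
    (hk : ∀ i, K i =ᵐ[volume] k i) (hkc : ∀ i, Continuous (k i)) {M : ℝ}
    (hM : ∀ x, ‖diagCLM n fun i => k i x‖ ≤ M) {g : EuclideanSpace ℝ (Fin d) → EuclideanSpace ℂ (Fin n)}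
    (hg : MemLp g p) (hgi : Integrable g) :
    diagConv d n p K (hg.toLp g) =ᵐ[volume] opConv (fun x => diagCLM n fun i => k i x) g := by
  have hKc : Continuous fun x => diagCLM n fun i => k i x := by fun_prop
  filter_upwards [diagConv_ae K (hg.toLp g),
    ae_all_iff.2 fun i => convLp_ae_of_ae_eq (hk i) (coordLp i (hg.toLp g))] with x h1 h2
  rw [h1]
  ext i
  simp only [h2]
  have h3 := ((EuclideanSpace.proj i : EuclideanSpace ℂ (Fin n) →L[ℂ] ℂ).restrictScalars ℝ).integral_comp_comm
    (integrable_apply_of_bounded hKc hM hgi x)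
  rw [opConv]
  refine Eq.trans ?_ h3
  refine integral_congr_ae ?_
  filter_upwards [coordLp_ae i (hg.toLp g), hg.coeFn_toLp] with y e1 e2
  rw [e1, e2]
  rfl

end Diag

/-! ### Square function bounds for the Poisson semigroup -/

section SquareFunction

variable {d n : ℕ} {p q : ℝ≥0∞}

lemma lintegral_enorm_rpow_eq_of_Lp {G : Type*} [NormedAddCommGroup G] (hp0 : p ≠ 0) (hp : p ≠ ∞)
    (v : Lp G p (volume : Measure (EuclideanSpace ℝ (Fin d)))) :
    ∫⁻ x, ‖v x‖ₑ ^ p.toReal = ‖v‖ₑ ^ p.toReal := by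
  rw [Lp.enorm_def, eLpNorm_eq_lintegral_rpow_enorm_toReal hp0 hp,
    ← ENNReal.rpow_mul, one_div, inv_mul_cancel₀ (ENNReal.toReal_pos hp0 hp).ne', ENNReal.rpow_one]

lemma dense_continuous_compact_vecLp [Fact (1 ≤ p)] [hp : Fact (p ≠ ∞)] :
    Dense {v : VecLp d n p | ∃ g : EuclideanSpace ℝ (Fin d) → EuclideanSpace ℂ (Fin n),
      Continuous g ∧ HasCompactSupport g ∧ ∃ hg : MemLp g p, v = hg.toLp g} := by
  intro f
  rw [Metric.mem_closure_iff]
  intro ε hε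
  obtain ⟨g, hg1, hg2, hg3, hg4⟩ := (Lp.memLp f).exists_hasCompactSupport_eLpNorm_sub_le hp.out
    (ε := ENNReal.ofReal (ε / 2)) (by simpa using hε)
  refine ⟨hg4.toLp g, ⟨g, hg3, hg1, hg4, rfl⟩, ?_⟩
  rw [Lp.dist_def]
  refine (ENNReal.toReal_le_of_le_ofReal (by positivity) ?_).trans_lt (half_lt_self hε)
  refine (eLpNorm_congr_ae ?_).trans_le hg2
  filter_upwards [hg4.coeFn_toLp] with x hx
  simp [hx]

/-- The family of Poisson kernels at dyadic dilates of `z`. -/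
def dyadicPoisson (d : ℕ) {n : ℕ} (k : Fin n → ℤ) (z : ℂ) (i : Fin n) : LpSpace d 1 :=
  poissonL1 d (((2 ^ k i : ℝ) : ℂ) * z)

lemma re_dyadic_pos {z : ℂ} (hz : 0 < z.re) (k : ℤ) : 0 < ((((2 : ℝ) ^ k : ℝ) : ℂ) * z).re := by
  rw [Complex.re_ofReal_mul]
  positivity

lemma norm_fourier_dyadicPoisson_le {z : ℂ} (hz : 0 < z.re) (k : Fin n → ℤ) (i : Fin n)
    (ξ : EuclideanSpace ℝ (Fin d)) :
    ‖𝓕 (dyadicPoisson d k z i : EuclideanSpace ℝ (Fin d) → ℂ) ξ‖ ≤ 1 := by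
  have h := re_dyadic_pos hz (k i)
  rw [dyadicPoisson, fourier_poissonL1 h, norm_expSymbol, Real.exp_le_one_iff]
  have : 0 ≤ 2 * Real.pi * ‖ξ‖ := by positivity
  nlinarith [mul_nonneg h.le this]

lemma one_le_norm_div_re {z : ℂ} (hz : 0 < z.re) : 1 ≤ ‖z‖ / z.re := by
  rw [one_le_div hz]
  exact Complex.re_le_norm z

/-- The Calderón–Zygmund theorem applies to the diagonal kernel with `a = max 1 C * (‖z‖ / Re z)^α`:
this is at least the `L²` norm bound 1 and dominates the Hörmander sum. -/
lemma exists_norm_diagConv_dyadicPoisson_le_of_lt_two (hd : 1 ≤ d) {α : ℝ}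
    (hα : ((d : ℝ) - 1) / 2 < α) [Fact (1 ≤ p)] [hp : Fact (p ≠ ∞)] (hp1 : 1 < p) (hp2 : p < 2) :
    ∃ C : ℝ≥0, ∀ z : ℂ, 0 < z.re → ∀ (n : ℕ) (k : Fin n → ℤ) (v : VecLp d n p),
      ‖diagConv d n p (dyadicPoisson d k z) v‖ ≤ C * (‖z‖ / z.re) ^ α * ‖v‖ := by
  obtain ⟨C, hC⟩ := exists_sum_poissonHormander_le hd hα
  have hα0 : 0 ≤ α := by
    have : (1 : ℝ) ≤ d := by exact_mod_cast hd
    linarith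
  set r := p.toReal with hr
  have hr1 : 1 < r := by
    rw [hr, ← ENNReal.toReal_one]
    exact (ENNReal.toReal_lt_toReal (by simp) hp.out).2 hp1
  have hr2 : r < 2 := by
    rw [hr, ← ENNReal.toReal_ofNat]
    exact (ENNReal.toReal_lt_toReal hp.out (by simp)).2 hp2
  have hr0 : 0 < r := by linarith
  have hp0 : p ≠ 0 := (zero_lt_one.trans hp1).ne'
  refine ⟨(czConst d r ^ (1 / r)).toNNReal * max 1 C, fun z hz n k v => ?_⟩
  set a : ℝ := max 1 C * (‖z‖ / z.re) ^ α with ha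
  have hz1 : 1 ≤ (‖z‖ / z.re) ^ α := Real.one_le_rpow (one_le_norm_div_re hz) hα0
  have ha1 : 1 ≤ a := one_le_mul_of_one_le_of_one_le (le_max_left _ _) hz1
  set P : Fin n → EuclideanSpace ℝ (Fin d) → ℂ :=
    fun i => halfSpacePoissonKernel d (((2 ^ k i : ℝ) : ℂ) * z) with hP
  have hPae : ∀ i, dyadicPoisson d k z i =ᵐ[volume] P i := fun i => poissonL1_ae (re_dyadic_pos hz (k i))
  have hPc : ∀ i, Continuous (P i) := fun i => continuous_halfSpacePoissonKernel (re_dyadic_pos hz (k i))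
  set K : EuclideanSpace ℝ (Fin d) → EuclideanSpace ℂ (Fin n) →L[ℝ] EuclideanSpace ℂ (Fin n) :=
    fun x => diagCLM n fun i => P i x with hK
  have hKc : Continuous K := by
    rw [hK]; fun_prop
  obtain ⟨M, hM⟩ : ∃ M : ℝ, ∀ x, ‖K x‖ ≤ M := by
    choose c hc using fun i => exists_norm_halfSpacePoissonKernel_le (d := d) (re_dyadic_pos hz (k i))
    refine ⟨∑ i, |c i|, fun x => (norm_diagCLM_le _).trans ?_⟩
    refine (pi_norm_le_iff_of_nonneg (by positivity)).2 fun i => ?_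
    exact (hc i x).trans ((le_abs_self _).trans
      (Finset.single_le_sum (f := fun i => |c i|) (fun i _ => abs_nonneg _) (Finset.mem_univ i)))
  have hL2 : ∀ g, Integrable g → MemLp g 2 →
      ∫⁻ x, ‖opConv K g x‖ₑ ^ 2 ≤ ENNReal.ofReal a ^ 2 * ∫⁻ x, ‖g x‖ₑ ^ 2 := by
    intro g hg hg2
    have e1 : ∫⁻ x, ‖opConv K g x‖ₑ ^ 2 = ‖diagConv d n 2 (dyadicPoisson d k z) (hg2.toLp g)‖ₑ ^ 2 := by
      rw [← lintegral_enorm_sq_eq_of_Lp_two]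
      refine lintegral_congr_ae ?_
      filter_upwards [diagConv_toLp_ae hPae hPc hM hg2 hg] with x hx
      rw [hx]
    have e2 : ∫⁻ x, ‖g x‖ₑ ^ 2 = ‖hg2.toLp g‖ₑ ^ 2 := by
      rw [← lintegral_enorm_sq_eq_of_Lp_two]
      refine lintegral_congr_ae ?_
      filter_upwards [hg2.coeFn_toLp] with x hx
      rw [hx]
    rw [e1, e2]
    have h1 : ‖diagConv d n 2 (dyadicPoisson d k z) (hg2.toLp g)‖ₑ ^ 2 ≤ ‖hg2.toLp g‖ₑ ^ 2 := by
      gcongr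
      rw [← ofReal_norm, ← ofReal_norm]
      exact ENNReal.ofReal_le_ofReal (norm_diagConv_two_le _ (norm_fourier_dyadicPoisson_le hz k) _)
    refine h1.trans (le_mul_of_one_le_left zero_le (one_le_pow₀ ?_))
    rwa [ENNReal.one_le_ofReal]
  have hH : ∀ h, ∫⁻ x in {x | 2 * ‖h‖ ≤ ‖x‖}, ‖K (x - h) - K x‖ₑ ≤ ENNReal.ofReal a := by
    intro h
    -- The norm of a diagonal matrix is at most the supremum of its entries, so a sum over the
    -- distinct exponents suffices. Repeated operators cost nothing, and the bound is uniform in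
    -- `n`.
    have h1 : ∀ x, ‖K (x - h) - K x‖ₑ ≤ ∑ j ∈ Finset.univ.image k,
        ‖halfSpacePoissonKernel d (((2 ^ j : ℝ) : ℂ) * z) (x - h) -
          halfSpacePoissonKernel d (((2 ^ j : ℝ) : ℂ) * z) x‖ₑ := by
      intro x
      simp only [hK]
      rw [← map_sub]
      have h2 : ‖(fun i => P i (x - h)) - fun i => P i x‖ ≤ ∑ j ∈ Finset.univ.image k,
          ‖halfSpacePoissonKernel d (((2 ^ j : ℝ) : ℂ) * z) (x - h) -
            halfSpacePoissonKernel d (((2 ^ j : ℝ) : ℂ) * z) x‖ := by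
        refine (pi_norm_le_iff_of_nonneg (by positivity)).2 fun i => ?_
        exact Finset.single_le_sum (f := fun j : ℤ => ‖halfSpacePoissonKernel d (((2 ^ j : ℝ) : ℂ) * z) (x - h) -
            halfSpacePoissonKernel d (((2 ^ j : ℝ) : ℂ) * z) x‖) (fun j _ => norm_nonneg _)
            (Finset.mem_image_of_mem k (Finset.mem_univ i))
      simp_rw [← ofReal_norm]
      rw [← ENNReal.ofReal_sum_of_nonneg fun j _ => norm_nonneg _]
      exact ENNReal.ofReal_le_ofReal ((norm_diagCLM_le _).trans h2)
    refine (lintegral_mono h1).trans ?_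
    rw [lintegral_finsetSum' _ fun j _ => ?_]
    · refine (hC z hz (Finset.univ.image k) h).trans ?_
      rw [ha, ENNReal.ofReal_mul (by positivity)]
      gcongr
      rw [← ENNReal.ofReal_coe_nnreal]
      exact ENNReal.ofReal_le_ofReal (le_max_right _ _)
    · have := continuous_halfSpacePoissonKernel (d := d) (re_dyadic_pos hz j)
      exact Continuous.aemeasurable (by fun_prop)
  have hclosed : IsClosed {v : VecLp d n p | ‖diagConv d n p (dyadicPoisson d k z) v‖ ≤
      ((czConst d r ^ (1 / r)).toNNReal * max 1 C : ℝ≥0) * (‖z‖ / z.re) ^ α * ‖v‖} :=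
    isClosed_le (by fun_prop) (by fun_prop)
  refine (hclosed.closure_subset_iff.2 ?_) (dense_continuous_compact_vecLp v)
  rintro _ ⟨g, hg1, hg2, hg3, rfl⟩
  have hgi : Integrable g := hg1.integrable_of_hasCompactSupport hg2
  have hmain := lintegral_enorm_opConv_rpow_le hd hKc hM (by linarith : 0 < a) hL2 hH hg1 hgi
    (hg1.memLp_of_hasCompactSupport hg2) hr1 hr2
  have e1 : ∫⁻ x, ‖opConv K g x‖ₑ ^ r = ‖diagConv d n p (dyadicPoisson d k z) (hg3.toLp g)‖ₑ ^ r := by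
    rw [hr, ← lintegral_enorm_rpow_eq_of_Lp hp0 hp.out]
    refine lintegral_congr_ae ?_
    filter_upwards [diagConv_toLp_ae hPae hPc hM hg3 hgi] with x hx
    rw [hx]
  have e2 : ∫⁻ x, ‖g x‖ₑ ^ r = ‖hg3.toLp g‖ₑ ^ r := by
    rw [hr, ← lintegral_enorm_rpow_eq_of_Lp hp0 hp.out]
    refine lintegral_congr_ae ?_
    filter_upwards [hg3.coeFn_toLp] with x hx
    rw [hx]
  rw [e1, e2] at hmain
  have hcz : czConst d r ^ (1 / r) ≠ ∞ :=
    ENNReal.rpow_ne_top_of_nonneg (by positivity) (czConst_ne_top d r)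
  have h3 : ‖diagConv d n p (dyadicPoisson d k z) (hg3.toLp g)‖ₑ ≤
      czConst d r ^ (1 / r) * ENNReal.ofReal a * ‖hg3.toLp g‖ₑ := by
    have := ENNReal.rpow_le_rpow hmain (by positivity : 0 ≤ 1 / r)
    rw [ENNReal.mul_rpow_of_nonneg _ _ (by positivity), ENNReal.mul_rpow_of_nonneg _ _ (by positivity),
      ← ENNReal.rpow_mul, ← ENNReal.rpow_mul, ← ENNReal.rpow_mul, mul_one_div_cancel hr0.ne',
      ENNReal.rpow_one, ENNReal.rpow_one, ENNReal.rpow_one] at this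
    exact this
  have h4 := ENNReal.toReal_mono (by finiteness) h3
  rw [ENNReal.toReal_mul, ENNReal.toReal_mul, toReal_enorm, toReal_enorm,
    ENNReal.toReal_ofReal (by positivity)] at h4
  refine h4.trans_eq ?_
  rw [ha]
  push_cast
  rw [← ENNReal.coe_toNNReal_eq_toReal]
  ring

end SquareFunction

/-! ### Duality for exponents above 2. -/

section Duality

variable {d n : ℕ} {p q : ℝ≥0∞}

/-- The duality map `v ↦ ‖v‖^{r-2} v̄`. -/
def dualityMap (n : ℕ) (r : ℝ) (v : EuclideanSpace ℂ (Fin n)) : EuclideanSpace ℂ (Fin n) :=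
  ((‖v‖ ^ (r - 2) : ℝ) : ℂ) • WithLp.toLp 2 fun i => (starRingEnd ℂ) (v i)

lemma measurable_dualityMap (n : ℕ) (r : ℝ) : Measurable (dualityMap n r) := by
  refine Measurable.smul (Complex.measurable_ofReal.comp (measurable_norm.pow_const _)) ?_
  exact Continuous.measurable (by fun_prop)

lemma norm_dualityMap {r : ℝ} (hr : 1 < r) (v : EuclideanSpace ℂ (Fin n)) :
    ‖dualityMap n r v‖ = ‖v‖ ^ (r - 1) := by
  have h1 : ‖(WithLp.toLp 2 fun i => (starRingEnd ℂ) (v i) : EuclideanSpace ℂ (Fin n))‖ = ‖v‖ := by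
    simp [EuclideanSpace.norm_eq]
  rw [dualityMap, norm_smul, h1, Complex.norm_real, Real.norm_of_nonneg (by positivity)]
  rcases (norm_nonneg v).eq_or_lt with h | h
  · rw [← h, mul_zero, Real.zero_rpow (by linarith)]
  · rw [← Real.rpow_add_one h.ne']
    ring_nf

lemma sum_mul_dualityMap {r : ℝ} (hr : 1 < r) (v : EuclideanSpace ℂ (Fin n)) :
    ∑ i, v i * dualityMap n r v i = ((‖v‖ ^ r : ℝ) : ℂ) := by
  have h1 : ∑ i, v i * dualityMap n r v i = ((‖v‖ ^ (r - 2) : ℝ) : ℂ) * ((‖v‖ ^ 2 : ℝ) : ℂ) := by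
    rw [EuclideanSpace.norm_sq_eq, Complex.ofReal_sum, Finset.mul_sum]
    refine Finset.sum_congr rfl fun i _ => ?_
    simp only [dualityMap, PiLp.smul_apply, smul_eq_mul]
    rw [Complex.ofReal_pow, ← Complex.mul_conj']
    ring
  rw [h1, ← Complex.ofReal_mul]
  congr 1
  rcases (norm_nonneg v).eq_or_lt with h | h
  · have h0 : (0 : ℝ) ^ r = 0 := Real.zero_rpow (by linarith)
    rw [← h, h0]
    simp
  · rw [← Real.rpow_natCast, ← Real.rpow_add h]
    norm_num

lemma norm_sum_mul_le (v w : EuclideanSpace ℂ (Fin n)) : ‖∑ i, v i * w i‖ ≤ ‖v‖ * ‖w‖ := by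
  have h := norm_inner_le_norm (𝕜 := ℂ) (WithLp.toLp 2 fun i => (starRingEnd ℂ) (v i) :
    EuclideanSpace ℂ (Fin n)) w
  have h1 : ‖(WithLp.toLp 2 fun i => (starRingEnd ℂ) (v i) : EuclideanSpace ℂ (Fin n))‖ = ‖v‖ := by
    simp [EuclideanSpace.norm_eq]
  rw [h1] at h
  refine le_trans (le_of_eq ?_) h
  congr 1
  simp [PiLp.inner_apply, mul_comm]

variable [Fact (1 ≤ p)] [Fact (1 ≤ q)] [hp : Fact (p ≠ ∞)] [hq : Fact (q ≠ ∞)]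
  [hpq : ENNReal.HolderConjugate p q]

/-- Duality for diagonal convolution operators with even kernels. -/
lemma norm_diagConv_le_of_conj (K : Fin n → LpSpace d 1) (hK : ∀ i, ∀ᵐ x, K i (-x) = K i x) {B : ℝ}
    (hB0 : 0 ≤ B) (hB : ∀ w : VecLp d n q, ‖diagConv d n q K w‖ ≤ B * ‖w‖) (v : VecLp d n p) :
    ‖diagConv d n p K v‖ ≤ B * ‖v‖ := by
  set r := p.toReal with hr
  set s := q.toReal with hs
  have hrs : r.HolderConjugate s := ENNReal.HolderConjugate.toReal_of_ne_top hp.out hq.out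
  have hr1 : 1 < r := hrs.lt
  have hp0 : p ≠ 0 := (zero_lt_one.trans_le Fact.out).ne'
  have hq0 : q ≠ 0 := (zero_lt_one.trans_le Fact.out).ne'
  set u := diagConv d n p K v with hu
  have hpow : (r - 1) * s = r := hrs.sub_one_mul_conj
  have hum : AEStronglyMeasurable (fun x => dualityMap n r (u x)) volume :=
    ((measurable_dualityMap n r).comp_aemeasurable (Lp.memLp u).1.aemeasurable).aestronglyMeasurable
  have he : ∀ x, ‖dualityMap n r (u x)‖ₑ ^ s = ‖u x‖ₑ ^ r := by
    intro x
    rw [← ofReal_norm, norm_dualityMap hr1, ← ENNReal.ofReal_rpow_of_nonneg (norm_nonneg _) (by linarith),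
      ← ENNReal.rpow_mul, hpow, ofReal_norm]
  have hmem : MemLp (fun x => dualityMap n r (u x)) q := by
    refine ⟨hum, ?_⟩
    rw [eLpNorm_lt_top_iff_lintegral_rpow_enorm_lt_top hq0 hq.out]
    simp_rw [← hs, he]
    rw [hr, lintegral_enorm_rpow_eq_of_Lp hp0 hp.out]
    exact ENNReal.rpow_lt_top_of_nonneg (by positivity) enorm_ne_top
  -- The explicit norming function of `u`: its pairing with `u` is `‖u‖^r` and its norm is
  -- `‖u‖^{r-1}`, so no description of the dual space is needed.
  set w : VecLp d n q := hmem.toLp _ with hw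
  have hwae : w =ᵐ[volume] fun x => dualityMap n r (u x) := hmem.coeFn_toLp
  have hwn : ‖w‖ₑ ^ s = ‖u‖ₑ ^ r := by
    rw [hs, ← lintegral_enorm_rpow_eq_of_Lp hq0 hq.out, hr, ← lintegral_enorm_rpow_eq_of_Lp hp0 hp.out]
    refine lintegral_congr_ae ?_
    filter_upwards [hwae] with x hx
    rw [hx]
    exact he x
  have hint : ∀ (a : VecLp d n p) (b : VecLp d n q) (i : Fin n),
      Integrable fun x => coordLp i a x * coordLp i b x := by
    intro a b i
    exact MemLp.integrable_mul (Lp.memLp (coordLp i a)) (Lp.memLp (coordLp i b))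
  -- Evenness of the kernels moves the operator from `v` to `w`, where the bound on `L^q` is
  -- available.
  have hpair : ∑ i, ∫ x, coordLp i u x * coordLp i w x =
      ∑ i, ∫ x, coordLp i v x * coordLp i (diagConv d n q K w) x := by
    refine Finset.sum_congr rfl fun i _ => ?_
    rw [show ∫ x, coordLp i u x * coordLp i w x =
      ∫ x, convLp d p (K i) (coordLp i v) x * coordLp i w x from integral_congr_ae (by
        filter_upwards [coordLp_ae i u, diagConv_ae K v] with x h1 h2
        rw [h1, hu, h2]), pairLp_convLp_comm (K i) (hK i)]
    refine integral_congr_ae ?_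
    filter_upwards [coordLp_ae i (diagConv d n q K w), diagConv_ae K w] with x h1 h2
    rw [h1, h2]
  have hleft : ∑ i, ∫ x, coordLp i u x * coordLp i w x = ((∫ x, ‖u x‖ ^ r : ℝ) : ℂ) := by
    rw [← integral_finsetSum _ fun i _ => hint u w i, ← integral_complex_ofReal]
    refine integral_congr_ae ?_
    filter_upwards [ae_all_iff.2 fun i => coordLp_ae i u, ae_all_iff.2 fun i => coordLp_ae i w, hwae]
      with x h1 h2 h3
    simp only [h1, h2, h3]
    exact sum_mul_dualityMap hr1 (u x)
  have hright : ‖∑ i, ∫ x, coordLp i v x * coordLp i (diagConv d n q K w) x‖ₑ ≤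
      ‖v‖ₑ * ‖diagConv d n q K w‖ₑ := by
    rw [← integral_finsetSum _ fun i _ => hint v _ i]
    refine (enorm_integral_le_lintegral_enorm _).trans ?_
    calc ∫⁻ x, ‖∑ i, coordLp i v x * coordLp i (diagConv d n q K w) x‖ₑ
        ≤ ∫⁻ x, ((fun x => ‖v x‖ₑ) * fun x => ‖diagConv d n q K w x‖ₑ) x := by
          refine lintegral_mono_ae ?_
          filter_upwards [ae_all_iff.2 fun i => coordLp_ae i v,
            ae_all_iff.2 fun i => coordLp_ae i (diagConv d n q K w)] with x h1 h2
          simp only [h1, h2, Pi.mul_apply, ← ofReal_norm]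
          rw [← ENNReal.ofReal_mul (norm_nonneg _)]
          exact ENNReal.ofReal_le_ofReal (norm_sum_mul_le _ _)
      _ ≤ (∫⁻ x, ‖v x‖ₑ ^ r) ^ (1 / r) * (∫⁻ x, ‖diagConv d n q K w x‖ₑ ^ s) ^ (1 / s) :=
          ENNReal.lintegral_mul_le_Lp_mul_Lq volume hrs (Lp.memLp v).1.enorm (Lp.memLp _).1.enorm
      _ = _ := by
          rw [hr, lintegral_enorm_rpow_eq_of_Lp hp0 hp.out, hs, lintegral_enorm_rpow_eq_of_Lp hq0 hq.out,
            ← ENNReal.rpow_mul, ← ENNReal.rpow_mul, mul_one_div_cancel hrs.ne_zero,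
            mul_one_div_cancel hrs.symm.ne_zero, ENNReal.rpow_one, ENNReal.rpow_one]
  have hu_r : ‖((∫ x, ‖u x‖ ^ r : ℝ) : ℂ)‖ₑ = ‖u‖ₑ ^ r := by
    rw [hr, ← lintegral_enorm_rpow_eq_of_Lp hp0 hp.out, ← ofReal_norm, Complex.norm_real,
      Real.norm_of_nonneg (integral_nonneg fun x => by positivity), ofReal_integral_eq_lintegral_ofReal]
    · refine lintegral_congr fun x => ?_
      rw [← ofReal_norm, ENNReal.ofReal_rpow_of_nonneg (norm_nonneg _) (by positivity)]
    · exact (Lp.memLp u).integrable_norm_rpow hp0 hp.out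
    · exact Eventually.of_forall fun x => by positivity
  rw [← hpair, hleft, hu_r, ← ofReal_norm, ← ofReal_norm, ← ofReal_norm,
    ENNReal.ofReal_rpow_of_nonneg (norm_nonneg _) (by linarith), ← ENNReal.ofReal_mul (norm_nonneg _),
    ENNReal.ofReal_le_ofReal_iff (by positivity)] at hright
  have hwn' : ‖w‖ = ‖u‖ ^ (r - 1) := by
    rw [← ofReal_norm, ← ofReal_norm, ENNReal.ofReal_rpow_of_nonneg (norm_nonneg _) hrs.symm.nonneg,
      ENNReal.ofReal_rpow_of_nonneg (norm_nonneg _) hrs.nonneg,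
      ENNReal.ofReal_eq_ofReal_iff (by positivity) (by positivity)] at hwn
    rw [← hpow, Real.rpow_mul (norm_nonneg _)] at hwn
    exact (Real.rpow_left_inj (norm_nonneg _) (by positivity) hrs.symm.ne_zero).1 hwn
  rcases (norm_nonneg u).eq_or_lt with h | h
  · rw [← h]
    positivity
  · have h1 : ‖u‖ ^ r = ‖u‖ ^ (r - 1) * ‖u‖ := by
      rw [← Real.rpow_add_one h.ne']; ring_nf
    have h2 : ‖u‖ ^ (r - 1) * ‖u‖ ≤ ‖u‖ ^ (r - 1) * (B * ‖v‖) := by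
      rw [← h1]
      refine hright.trans ((mul_le_mul_of_nonneg_left (hB w) (norm_nonneg _)).trans_eq ?_)
      rw [hwn']
      ring
    exact le_of_mul_le_mul_left h2 (by positivity)

end Duality

/-! ### Square function bound for all exponents. -/

section AllExponents

variable {d : ℕ} {p : ℝ≥0∞} [Fact (1 ≤ p)] [hp : Fact (p ≠ ∞)]

lemma poissonL1_neg_ae {z : ℂ} (hz : 0 < z.re) :
    ∀ᵐ x, poissonL1 d z (-x) = poissonL1 d z x := by
  have h := poissonL1_ae (d := d) hz
  have h2 := (Measure.measurePreserving_neg (volume : Measure (EuclideanSpace ℝ (Fin d)))).quasiMeasurePreserving.ae_eq_comp h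
  filter_upwards [h, h2] with x h1 h2
  simp only [Function.comp_apply] at h2
  rw [h2, h1, halfSpacePoissonKernel_neg]

/-- The square function bound for the Poisson semigroup at dyadic dilates. -/
theorem exists_norm_diagConv_dyadicPoisson_le (hd : 1 ≤ d) {α : ℝ}
    (hα : ((d : ℝ) - 1) / 2 < α) (hp1 : 1 < p) :
    ∃ C : ℝ≥0, ∀ z : ℂ, 0 < z.re → ∀ (n : ℕ) (k : Fin n → ℤ) (v : VecLp d n p),
      ‖diagConv d n p (dyadicPoisson d k z) v‖ ≤ C * (‖z‖ / z.re) ^ α * ‖v‖ := by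
  have hα0 : 0 ≤ α := by
    have : (1 : ℝ) ≤ d := by exact_mod_cast hd
    linarith
  rcases lt_trichotomy p 2 with h | rfl | h
  · exact exists_norm_diagConv_dyadicPoisson_le_of_lt_two hd hα hp1 h
  · refine ⟨1, fun z hz n k v => ?_⟩
    refine (norm_diagConv_two_le _ (norm_fourier_dyadicPoisson_le hz k) v).trans ?_
    refine le_mul_of_one_le_left (norm_nonneg _) ?_
    rw [NNReal.coe_one, one_mul]
    exact Real.one_le_rpow (one_le_norm_div_re hz) hα0
  · obtain ⟨q, hq⟩ : ∃ q, ENNReal.HolderConjugate p q :=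
      ⟨p.conjExponent, ENNReal.HolderConjugate.conjExponent Fact.out⟩
    have hq' : ENNReal.HolderConjugate q p := ENNReal.HolderConjugate.symm
    have hq1 : Fact (1 ≤ q) := ⟨ENNReal.HolderConjugate.one_le q p⟩
    have hqt : Fact (q ≠ ∞) := ⟨(ENNReal.HolderConjugate.ne_top_iff_ne_one q p).2 hp1.ne'⟩
    have hq1' : 1 < q := (ENNReal.HolderConjugate.lt_top_iff_one_lt p q).1 hp.out.lt_top
    have hq2 : q < 2 := by
      have hrs : p.toReal.HolderConjugate q.toReal :=
        ENNReal.HolderConjugate.toReal_of_ne_top hp.out hqt.out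
      have h2 : 2 < p.toReal := by
        rw [← ENNReal.toReal_ofNat]
        exact (ENNReal.toReal_lt_toReal (by simp) hp.out).2 h
      refine (ENNReal.toReal_lt_toReal hqt.out (by simp)).1 ?_
      rw [ENNReal.toReal_ofNat]
      nlinarith [hrs.sub_one_mul_conj, hrs.symm.pos]
    obtain ⟨C, hC⟩ := exists_norm_diagConv_dyadicPoisson_le_of_lt_two (p := q) hd hα hq1' hq2
    refine ⟨C, fun z hz n k v => norm_diagConv_le_of_conj (q := q) _
      (fun i => poissonL1_neg_ae (re_dyadic_pos hz (k i))) ?_ (fun w => hC z hz n k w) v⟩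
    have := hz.le
    positivity

end AllExponents

/-! ### Gaussian moments -/

section GaussianMoments

variable {n : ℕ} {r : ℝ}

/-- The standard Gaussian product measure. -/
abbrev gaussPi (n : ℕ) : Measure (Fin n → ℝ) := Measure.pi fun _ : Fin n => gaussianReal 0 1

/-- The absolute moments of the standard Gaussian. -/
def gaussMoment (r : ℝ) : ℝ≥0∞ := ∫⁻ t : ℝ, ‖t‖ₑ ^ r ∂gaussianReal 0 1

lemma gaussMoment_ne_top (hr : 0 < r) : gaussMoment r ≠ ∞ := by
  have h := (memLp_id_gaussianReal' (μ := 0) (v := 1) (ENNReal.ofReal r) ENNReal.ofReal_ne_top).2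
  rw [eLpNorm_lt_top_iff_lintegral_rpow_enorm_lt_top (ENNReal.ofReal_pos.2 hr).ne'
    ENNReal.ofReal_ne_top, ENNReal.toReal_ofReal hr.le] at h
  exact h.ne

lemma gaussMoment_two : gaussMoment 2 = 1 := by
  have h1 : ∫ t : ℝ, t ^ 2 ∂gaussianReal 0 1 = 1 := by
    have h := variance_fun_id_gaussianReal (μ := 0) (v := 1)
    rw [variance_of_integral_eq_zero aemeasurable_id' integral_id_gaussianReal] at h
    exact h
  have h2 : ∀ t : ℝ, ‖t‖ₑ ^ (2 : ℝ) = ENNReal.ofReal (t ^ 2) := by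
    intro t
    rw [ENNReal.rpow_ofNat, ← ofReal_norm, ← ENNReal.ofReal_pow (norm_nonneg _), Real.norm_eq_abs, sq_abs]
  simp_rw [gaussMoment, h2]
  rw [← ofReal_integral_eq_lintegral_ofReal, h1, ENNReal.ofReal_one]
  · exact (memLp_id_gaussianReal 2).integrable_sq
  · exact Eventually.of_forall fun t => by positivity

lemma gaussMoment_ne_zero (hr : 0 < r) : gaussMoment r ≠ 0 := by
  intro h
  rw [gaussMoment, lintegral_eq_zero_iff (by fun_prop)] at h
  have h2 : gaussMoment 2 = 0 := by
    rw [gaussMoment, lintegral_eq_zero_iff (by fun_prop)]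
    filter_upwards [h] with t ht
    have h3 : ‖t‖ₑ = 0 := by simpa [ENNReal.rpow_eq_zero_iff, hr, hr.le] using ht
    simp [h3]
  rw [gaussMoment_two] at h2
  exact one_ne_zero h2

/-- Rotation invariance of the Gaussian measure, read off from characteristic functions. -/
lemma map_sum_gaussPi (a : EuclideanSpace ℝ (Fin n)) :
    (gaussPi n).map (fun ω => ∑ k, ω k * a k) = (gaussianReal 0 1).map (· * ‖a‖) := by
  have h1 : (fun ω : Fin n → ℝ => ∑ k, ω k * a k) =
      (innerSL ℝ a : EuclideanSpace ℝ (Fin n) → ℝ) ∘ WithLp.toLp 2 := by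
    ext ω
    simp [PiLp.inner_apply]
  rw [h1, ← Measure.map_map (by fun_prop) (by fun_prop), map_pi_eq_stdGaussian]
  refine Measure.ext_of_charFun ?_
  ext t
  rw [charFun_map_eq_charFunDual_smul, charFunDual_stdGaussian, gaussianReal_map_mul_const,
    charFun_gaussianReal, norm_smul, innerSL_apply_norm]
  congr 1
  push_cast
  rw [mul_pow, Real.norm_eq_abs, ← Complex.ofReal_pow |t|, sq_abs]
  push_cast
  simp
  ring

lemma lintegral_sum_gaussPi_rpow (hr : 0 ≤ r) (a : EuclideanSpace ℝ (Fin n)) :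
    ∫⁻ ω, ‖∑ k, ω k * a k‖ₑ ^ r ∂gaussPi n = gaussMoment r * ‖a‖ₑ ^ r := by
  have h1 : ∫⁻ t, ‖t‖ₑ ^ r ∂((gaussPi n).map (fun ω => ∑ k, ω k * a k)) =
      ∫⁻ ω, ‖∑ k, ω k * a k‖ₑ ^ r ∂gaussPi n := lintegral_map (by fun_prop) (by fun_prop)
  rw [← h1, map_sum_gaussPi, lintegral_map (by fun_prop) (by fun_prop), gaussMoment]
  simp_rw [enorm_mul, ENNReal.mul_rpow_of_nonneg _ _ hr, enorm_norm]
  rw [lintegral_mul_const _ (by fun_prop)]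

/-- The real parts of the coordinates of a complex vector. -/
def reVec (v : EuclideanSpace ℂ (Fin n)) : EuclideanSpace ℝ (Fin n) := WithLp.toLp 2 fun i => (v i).re

/-- The imaginary parts of the coordinates of a complex vector. -/
def imVec (v : EuclideanSpace ℂ (Fin n)) : EuclideanSpace ℝ (Fin n) := WithLp.toLp 2 fun i => (v i).im

lemma norm_sq_reVec_add (v : EuclideanSpace ℂ (Fin n)) : ‖reVec v‖ ^ 2 + ‖imVec v‖ ^ 2 = ‖v‖ ^ 2 := by
  rw [EuclideanSpace.norm_sq_eq, EuclideanSpace.norm_sq_eq, EuclideanSpace.norm_sq_eq,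
    ← Finset.sum_add_distrib]
  refine Finset.sum_congr rfl fun i _ => ?_
  rw [Complex.sq_norm, Complex.normSq_apply]
  simp only [reVec, imVec, Real.norm_eq_abs, sq_abs]
  ring

lemma sum_gauss_re (ω : Fin n → ℝ) (v : EuclideanSpace ℂ (Fin n)) :
    (∑ k, (ω k : ℂ) * v k).re = ∑ k, ω k * reVec v k := by
  simp [reVec]

lemma sum_gauss_im (ω : Fin n → ℝ) (v : EuclideanSpace ℂ (Fin n)) :
    (∑ k, (ω k : ℂ) * v k).im = ∑ k, ω k * imVec v k := by
  simp [imVec]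

/-- At exponent 2 the real and imaginary parts add up exactly, hence no constant appears. -/
lemma lintegral_gauss_sq (v : EuclideanSpace ℂ (Fin n)) :
    ∫⁻ ω, ‖∑ k, (ω k : ℂ) * v k‖ₑ ^ (2 : ℝ) ∂gaussPi n = ‖v‖ₑ ^ (2 : ℝ) := by
  have h1 : ∀ z : ℂ, ‖z‖ₑ ^ (2 : ℝ) = ‖z.re‖ₑ ^ (2 : ℝ) + ‖z.im‖ₑ ^ (2 : ℝ) := by
    intro z
    simp_rw [ENNReal.rpow_ofNat, ← ofReal_norm, ← ENNReal.ofReal_pow (norm_nonneg _)]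
    rw [← ENNReal.ofReal_add (by positivity) (by positivity), Complex.sq_norm, Complex.normSq_apply]
    simp only [Real.norm_eq_abs, sq_abs]
    congr 1
    ring
  simp_rw [h1, sum_gauss_re, sum_gauss_im]
  rw [lintegral_add_left (by fun_prop), lintegral_sum_gaussPi_rpow zero_le_two,
    lintegral_sum_gaussPi_rpow zero_le_two, gaussMoment_two, one_mul, one_mul]
  simp_rw [ENNReal.rpow_ofNat, ← ofReal_norm, ← ENNReal.ofReal_pow (norm_nonneg _)]
  rw [← ENNReal.ofReal_add (by positivity) (by positivity), norm_sq_reVec_add]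

lemma rpow_le_two_rpow_mul_add (hr : 0 ≤ r) {a b c : ℝ≥0∞} (h : a ≤ b + c) :
    a ^ r ≤ 2 ^ r * (b ^ r + c ^ r) := by
  rcases le_total b c with hbc | hbc
  · calc a ^ r ≤ (2 * c) ^ r := by
          gcongr
          exact h.trans (by rw [two_mul]; gcongr)
      _ = 2 ^ r * c ^ r := ENNReal.mul_rpow_of_nonneg _ _ hr
      _ ≤ _ := by gcongr; exact le_add_self
  · calc a ^ r ≤ (2 * b) ^ r := by
          gcongr
          exact h.trans (by rw [two_mul]; gcongr)
      _ = 2 ^ r * b ^ r := ENNReal.mul_rpow_of_nonneg _ _ hr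
      _ ≤ _ := by gcongr; exact le_self_add

lemma enorm_reVec_le (v : EuclideanSpace ℂ (Fin n)) : ‖reVec v‖ₑ ≤ ‖v‖ₑ := by
  rw [← ofReal_norm, ← ofReal_norm]
  refine ENNReal.ofReal_le_ofReal ((sq_le_sq₀ (norm_nonneg _) (norm_nonneg _)).1 ?_)
  rw [← norm_sq_reVec_add]
  exact le_add_of_nonneg_right (by positivity)

lemma enorm_imVec_le (v : EuclideanSpace ℂ (Fin n)) : ‖imVec v‖ₑ ≤ ‖v‖ₑ := by
  rw [← ofReal_norm, ← ofReal_norm]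
  refine ENNReal.ofReal_le_ofReal ((sq_le_sq₀ (norm_nonneg _) (norm_nonneg _)).1 ?_)
  rw [← norm_sq_reVec_add]
  exact le_add_of_nonneg_left (by positivity)

lemma enorm_le_reVec_add_imVec (v : EuclideanSpace ℂ (Fin n)) : ‖v‖ₑ ≤ ‖reVec v‖ₑ + ‖imVec v‖ₑ := by
  simp_rw [← ofReal_norm]
  rw [← ENNReal.ofReal_add (norm_nonneg _) (norm_nonneg _)]
  refine ENNReal.ofReal_le_ofReal ((sq_le_sq₀ (norm_nonneg _) (by positivity)).1 ?_)
  rw [← norm_sq_reVec_add]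
  nlinarith [mul_nonneg (norm_nonneg (reVec v)) (norm_nonneg (imVec v))]

/-- Real Gaussians with complex coefficients do not give a multiple of one Gaussian; splitting into
real and imaginary parts accounts for the factors `2^r` and 2. -/
lemma lintegral_gauss_rpow_le (hr : 0 < r) (v : EuclideanSpace ℂ (Fin n)) :
    ∫⁻ ω, ‖∑ k, (ω k : ℂ) * v k‖ₑ ^ r ∂gaussPi n ≤ 2 ^ r * (2 * gaussMoment r) * ‖v‖ₑ ^ r := by
  have h1 : ∀ z : ℂ, ‖z‖ₑ ≤ ‖z.re‖ₑ + ‖z.im‖ₑ := by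
    intro z
    simp_rw [← ofReal_norm]
    rw [← ENNReal.ofReal_add (norm_nonneg _) (norm_nonneg _)]
    exact ENNReal.ofReal_le_ofReal (Complex.norm_le_abs_re_add_abs_im z)
  calc ∫⁻ ω, ‖∑ k, (ω k : ℂ) * v k‖ₑ ^ r ∂gaussPi n
      ≤ ∫⁻ ω, 2 ^ r * (‖∑ k, ω k * reVec v k‖ₑ ^ r + ‖∑ k, ω k * imVec v k‖ₑ ^ r) ∂gaussPi n := by
        refine lintegral_mono fun ω => ?_
        rw [← sum_gauss_re, ← sum_gauss_im]
        exact rpow_le_two_rpow_mul_add hr.le (h1 _)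
    _ = 2 ^ r * (gaussMoment r * ‖reVec v‖ₑ ^ r + gaussMoment r * ‖imVec v‖ₑ ^ r) := by
        rw [lintegral_const_mul _ (by fun_prop), lintegral_add_left (by fun_prop),
          lintegral_sum_gaussPi_rpow hr.le, lintegral_sum_gaussPi_rpow hr.le]
    _ ≤ 2 ^ r * (gaussMoment r * ‖v‖ₑ ^ r + gaussMoment r * ‖v‖ₑ ^ r) := by
        gcongr
        · exact enorm_reVec_le v
        · exact enorm_imVec_le v
    _ = _ := by ring

lemma le_lintegral_gauss_rpow (hr : 0 < r) (v : EuclideanSpace ℂ (Fin n)) :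
    gaussMoment r * ‖v‖ₑ ^ r ≤ 2 ^ r * 2 * ∫⁻ ω, ‖∑ k, (ω k : ℂ) * v k‖ₑ ^ r ∂gaussPi n := by
  have h1 : ∀ z : ℂ, ‖z.re‖ₑ ≤ ‖z‖ₑ := by
    intro z
    simp_rw [← ofReal_norm]
    exact ENNReal.ofReal_le_ofReal (Complex.abs_re_le_norm z)
  have h2 : ∀ z : ℂ, ‖z.im‖ₑ ≤ ‖z‖ₑ := by
    intro z
    simp_rw [← ofReal_norm]
    exact ENNReal.ofReal_le_ofReal (Complex.abs_im_le_norm z)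
  calc gaussMoment r * ‖v‖ₑ ^ r
      ≤ gaussMoment r * (2 ^ r * (‖reVec v‖ₑ ^ r + ‖imVec v‖ₑ ^ r)) := by
        gcongr
        exact rpow_le_two_rpow_mul_add hr.le (enorm_le_reVec_add_imVec v)
    _ = 2 ^ r * (gaussMoment r * ‖reVec v‖ₑ ^ r + gaussMoment r * ‖imVec v‖ₑ ^ r) := by ring
    _ = 2 ^ r * (∫⁻ ω, ‖∑ k, ω k * reVec v k‖ₑ ^ r ∂gaussPi n +
          ∫⁻ ω, ‖∑ k, ω k * imVec v k‖ₑ ^ r ∂gaussPi n) := by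
        rw [lintegral_sum_gaussPi_rpow hr.le, lintegral_sum_gaussPi_rpow hr.le]
    _ ≤ 2 ^ r * (∫⁻ ω, ‖∑ k, (ω k : ℂ) * v k‖ₑ ^ r ∂gaussPi n +
          ∫⁻ ω, ‖∑ k, (ω k : ℂ) * v k‖ₑ ^ r ∂gaussPi n) := by
        gcongr with ω ω
        · rw [← sum_gauss_re]; exact h1 _
        · rw [← sum_gauss_im]; exact h2 _
    _ = _ := by ring

end GaussianMoments

/-! ### Gaussian norms and square functions -/

section GaussSum

variable {n : ℕ} {X : Type*} [NormedAddCommGroup X] [NormedSpace ℂ X]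

/-- The Gaussian sum of a family. -/
def gaussianSum (x : Fin n → X) (ω : Fin n → ℝ) : X := ∑ k, (ω k : ℂ) • x k

lemma continuous_gaussianSum (x : Fin n → X) : Continuous (gaussianSum x) := by
  unfold gaussianSum; fun_prop

lemma memLp_gaussianSum (x : Fin n → X) : MemLp (gaussianSum x) 2 (gaussPi n) := by
  refine memLp_finsetSum _ fun k _ => ?_
  have h : MemLp (fun ω : Fin n → ℝ => ω k) 2 (gaussPi n) :=
    (memLp_id_gaussianReal 2).comp_measurePreserving
      (measurePreserving_eval (fun _ : Fin n => gaussianReal 0 1) k)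
  refine MemLp.of_le_mul (c := ‖x k‖) h (Continuous.aestronglyMeasurable (by fun_prop))
    (Eventually.of_forall fun ω => ?_)
  rw [norm_smul, Complex.norm_real, mul_comm]

lemma ofReal_gaussNorm (x : Fin n → X) :
    ENNReal.ofReal (gaussNorm x) = eLpNorm (gaussianSum x) 2 (gaussPi n) := by
  have hI : 0 ≤ ∫ ω : Fin n → ℝ, ‖∑ k, (ω k : ℂ) • x k‖ ^ 2 ∂gaussPi n :=
    integral_nonneg fun ω => by positivity
  have h2 : ∫⁻ ω, ‖gaussianSum x ω‖ₑ ^ (2 : ℝ) ∂gaussPi n = ENNReal.ofReal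
      (∫ ω : Fin n → ℝ, ‖∑ k, (ω k : ℂ) • x k‖ ^ 2 ∂gaussPi n) := by
    change _ = ENNReal.ofReal (∫ ω : Fin n → ℝ, ‖gaussianSum x ω‖ ^ 2 ∂gaussPi n)
    rw [ofReal_integral_eq_lintegral_ofReal ((memLp_gaussianSum x).integrable_norm_pow two_ne_zero)
      (Eventually.of_forall fun ω => by positivity)]
    refine lintegral_congr fun ω => ?_
    rw [ENNReal.rpow_ofNat, ← ofReal_norm, ← ENNReal.ofReal_pow (norm_nonneg _)]
  rw [gaussNorm, eLpNorm_eq_lintegral_rpow_enorm_toReal two_ne_zero ENNReal.ofNat_ne_top,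
    ENNReal.toReal_ofNat, h2, ENNReal.ofReal_rpow_of_nonneg hI (by norm_num), Real.sqrt_eq_rpow]

end GaussSum

/-! ### Comparison of Gaussian norms with square functions on `L^p`. -/

section GaussLp

set_option linter.unusedSectionVars false

variable {d n : ℕ} {p : ℝ≥0∞} [Fact (1 ≤ p)]

/-- The pointwise Gaussian sum. -/
def pointwiseGauss (x : Fin n → LpSpace d p) (ω : Fin n → ℝ) (y : EuclideanSpace ℝ (Fin d)) : ℂ :=
  ∑ k, (ω k : ℂ) * x k y

lemma measurable_pointwiseGauss (x : Fin n → LpSpace d p) :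
    Measurable fun w : (Fin n → ℝ) × EuclideanSpace ℝ (Fin d) => pointwiseGauss x w.1 w.2 := by
  have : ∀ k, Measurable (x k) := fun k => (Lp.stronglyMeasurable (x k)).measurable
  unfold pointwiseGauss
  refine Finset.measurable_sum _ fun k _ => Measurable.mul ?_ ((this k).comp measurable_snd)
  exact Complex.measurable_ofReal.comp ((measurable_pi_apply k).comp measurable_fst)

lemma gaussianSum_ae (x : Fin n → LpSpace d p) (ω : Fin n → ℝ) :
    (gaussianSum x ω : LpSpace d p) =ᵐ[volume] pointwiseGauss x ω := by
  have h : ∀ k, ∀ᵐ y, ((ω k : ℂ) • x k : LpSpace d p) y = (ω k : ℂ) * x k y := by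
    intro k
    filter_upwards [Lp.coeFn_smul (ω k : ℂ) (x k)] with y hy
    rw [hy]; rfl
  filter_upwards [Lp.coeFn_fun_finsetSum Finset.univ fun k => ((ω k : ℂ) • x k : LpSpace d p),
    ae_all_iff.2 h] with y h1 h2
  rw [gaussianSum, h1, pointwiseGauss]
  simp only [h2]

/-- The pointwise square function. -/
def squareFun (x : Fin n → LpSpace d p) (y : EuclideanSpace ℝ (Fin d)) : ℝ≥0∞ :=
  ‖(WithLp.toLp 2 fun i => x i y : EuclideanSpace ℂ (Fin n))‖ₑ

lemma measurable_squareFun (x : Fin n → LpSpace d p) : Measurable (squareFun x) := by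
  have : ∀ k, Measurable (x k) := fun k => (Lp.stronglyMeasurable (x k)).measurable
  unfold squareFun
  fun_prop

lemma lintegral_squareFun_rpow (hp : p ≠ ∞) (x : Fin n → LpSpace d p) :
    ∫⁻ y, squareFun x y ^ p.toReal = ‖vecLp x‖ₑ ^ p.toReal := by
  rw [← lintegral_enorm_rpow_eq_of_Lp (zero_lt_one.trans_le Fact.out).ne' hp]
  refine lintegral_congr_ae ?_
  filter_upwards [vecLp_ae x] with y hy
  rw [hy, squareFun]

lemma enorm_gaussianSum_rpow (hp : p ≠ ∞) (x : Fin n → LpSpace d p) (ω : Fin n → ℝ) :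
    ‖gaussianSum x ω‖ₑ ^ p.toReal = ∫⁻ y, ‖pointwiseGauss x ω y‖ₑ ^ p.toReal := by
  rw [← lintegral_enorm_rpow_eq_of_Lp (zero_lt_one.trans_le Fact.out).ne' hp]
  refine lintegral_congr_ae ?_
  filter_upwards [gaussianSum_ae x ω] with y hy
  rw [hy]

lemma lintegral_enorm_gaussianSum_rpow (hp : p ≠ ∞) (x : Fin n → LpSpace d p) :
    ∫⁻ ω, ‖gaussianSum x ω‖ₑ ^ p.toReal ∂gaussPi n =
      ∫⁻ y, ∫⁻ ω, ‖pointwiseGauss x ω y‖ₑ ^ p.toReal ∂gaussPi n := by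
  simp_rw [enorm_gaussianSum_rpow hp]
  exact lintegral_lintegral_swap ((measurable_pointwiseGauss x).enorm.pow_const _).aemeasurable

lemma lintegral_pointwiseGauss_sq (x : Fin n → LpSpace d p) (y : EuclideanSpace ℝ (Fin d)) :
    ∫⁻ ω, ‖pointwiseGauss x ω y‖ₑ ^ (2 : ℝ) ∂gaussPi n = squareFun x y ^ (2 : ℝ) :=
  lintegral_gauss_sq (WithLp.toLp 2 fun i => x i y)

/-- The weighted second moment. -/
lemma lintegral_weighted_gauss_sq (x : Fin n → LpSpace d p) (w : EuclideanSpace ℝ (Fin d) → ℝ≥0∞)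
    (hw : Measurable w) :
    ∫⁻ ω, ∫⁻ y, ‖pointwiseGauss x ω y‖ₑ ^ (2 : ℝ) * w y ∂volume ∂gaussPi n =
      ∫⁻ y, squareFun x y ^ (2 : ℝ) * w y := by
  have hm := measurable_pointwiseGauss x
  rw [lintegral_lintegral_swap (f := fun ω y => ‖pointwiseGauss x ω y‖ₑ ^ (2 : ℝ) * w y)
    ((hm.enorm.pow_const _).mul (hw.comp measurable_snd)).aemeasurable]
  refine lintegral_congr fun y => ?_
  rw [lintegral_mul_const _ (by
    have : Measurable fun ω => pointwiseGauss x ω y := hm.comp (measurable_id.prodMk measurable_const)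
    fun_prop), lintegral_pointwiseGauss_sq]

lemma enorm_rpow_inj_le {a b : ℝ≥0∞} {r : ℝ} (hr : 0 < r) (h : a ^ r ≤ b ^ r) : a ≤ b :=
  (ENNReal.rpow_le_rpow_iff hr).1 h

lemma pointwiseGauss_eq_zero_of_squareFun {x : Fin n → LpSpace d p} {y : EuclideanSpace ℝ (Fin d)}
    (h : squareFun x y = 0) (ω : Fin n → ℝ) : pointwiseGauss x ω y = 0 := by
  rw [squareFun, enorm_eq_zero] at h
  have h1 : ∀ i, x i y = 0 := fun i => congrArg (fun v : EuclideanSpace ℂ (Fin n) => v i) h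
  simp [pointwiseGauss, h1]

/-- For `p ≤ 2` the Gaussian norm is dominated by the square function. -/
lemma eLpNorm_gaussianSum_le_of_le_two (hp2 : p ≤ 2) (x : Fin n → LpSpace d p) :
    eLpNorm (gaussianSum x) 2 (gaussPi n) ≤ ‖vecLp x‖ₑ := by
  have hp : p ≠ ∞ := ne_top_of_le_ne_top ENNReal.ofNat_ne_top hp2
  set r := p.toReal with hr
  have hr0 : 0 < r := ENNReal.toReal_pos (zero_lt_one.trans_le Fact.out).ne' hp
  have hr2 : r ≤ 2 := by
    rw [hr, ← ENNReal.toReal_ofNat]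
    exact ENNReal.toReal_mono (by simp) hp2
  have hσm := measurable_squareFun x
  -- With `S` the Gaussian sum and `σ` the square function, Hölder is applied to `|S|^r = (|S|²
  -- σ^{r-2})^{r/2} (σ^r)^{1-r/2}`. The first factor is quadratic in `S`, so its expectation is
  -- explicit and no Kahane–Khinchin inequality is needed.
  have hpt : ∀ ω, ‖gaussianSum x ω‖ₑ ^ (2 : ℝ) ≤
      (∫⁻ y, ‖pointwiseGauss x ω y‖ₑ ^ (2 : ℝ) * squareFun x y ^ (r - 2)) * ‖vecLp x‖ₑ ^ (2 - r) := by
    intro ω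
    have hsm : Measurable fun y => pointwiseGauss x ω y :=
      (measurable_pointwiseGauss x).comp (measurable_const.prodMk measurable_id)
    have h1 : ‖gaussianSum x ω‖ₑ ^ r ≤
        (∫⁻ y, ‖pointwiseGauss x ω y‖ₑ ^ (2 : ℝ) * squareFun x y ^ (r - 2)) ^ (r / 2) *
          (‖vecLp x‖ₑ ^ r) ^ (1 - r / 2) := by
      rw [hr, enorm_gaussianSum_rpow hp, ← lintegral_squareFun_rpow hp, ← hr]
      refine le_trans (lintegral_mono fun y => ?_) (ENNReal.lintegral_mul_norm_pow_le
        (f := fun y => ‖pointwiseGauss x ω y‖ₑ ^ (2 : ℝ) * squareFun x y ^ (r - 2))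
        (g := fun y => squareFun x y ^ r) (by fun_prop) (by fun_prop) (by positivity) (by linarith)
        (by ring))
      -- Where `σ` vanishes so does `S`, so the negative power of `σ` does no harm.
      by_cases h0 : squareFun x y = 0
      · rw [pointwiseGauss_eq_zero_of_squareFun h0, enorm_zero, ENNReal.zero_rpow_of_pos hr0]
        exact zero_le
      · have ht : squareFun x y ≠ ∞ := enorm_ne_top
        rw [ENNReal.mul_rpow_of_nonneg _ _ (by positivity), ← ENNReal.rpow_mul, ← ENNReal.rpow_mul,
          ← ENNReal.rpow_mul, mul_assoc, ← ENNReal.rpow_add _ _ h0 ht]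
        have e1 : (r - 2) * (r / 2) + r * (1 - r / 2) = 0 := by ring
        have e2 : 2 * (r / 2) = r := by ring
        rw [e1, e2, ENNReal.rpow_zero, mul_one]
    have h2 := ENNReal.rpow_le_rpow h1 (by positivity : 0 ≤ 2 / r)
    rw [ENNReal.mul_rpow_of_nonneg _ _ (by positivity), ← ENNReal.rpow_mul, ← ENNReal.rpow_mul,
      ← ENNReal.rpow_mul, ← ENNReal.rpow_mul] at h2
    have e1 : r * (2 / r) = 2 := by field_simp
    have e2 : r / 2 * (2 / r) = 1 := by field_simp
    have e3 : r * ((1 - r / 2) * (2 / r)) = 2 - r := by field_simp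
    rwa [e1, e2, e3, ENNReal.rpow_one] at h2
  refine enorm_rpow_inj_le (two_pos : (0 : ℝ) < 2) ?_
  have e0 : eLpNorm (gaussianSum x) 2 (gaussPi n) ^ (2 : ℝ) =
      ∫⁻ ω, ‖gaussianSum x ω‖ₑ ^ (2 : ℝ) ∂gaussPi n := by
    rw [eLpNorm_eq_lintegral_rpow_enorm_toReal two_ne_zero ENNReal.ofNat_ne_top, ← ENNReal.rpow_mul]
    simp
  rw [e0]
  refine (lintegral_mono hpt).trans ?_
  rw [lintegral_mul_const' _ _ (ENNReal.rpow_ne_top_of_nonneg (by linarith) enorm_ne_top),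
    lintegral_weighted_gauss_sq x _ (by fun_prop)]
  have h3 : ∫⁻ y, squareFun x y ^ (2 : ℝ) * squareFun x y ^ (r - 2) ≤ ‖vecLp x‖ₑ ^ r := by
    rw [hr, ← lintegral_squareFun_rpow hp, ← hr]
    refine lintegral_mono fun y => ?_
    by_cases h0 : squareFun x y = 0
    · rw [h0, ENNReal.zero_rpow_of_pos two_pos, zero_mul]
      exact zero_le
    · rw [← ENNReal.rpow_add _ _ h0 enorm_ne_top]
      exact le_of_eq (by ring_nf)
  refine (mul_le_mul' h3 le_rfl).trans_eq ?_
  rw [← ENNReal.rpow_add_of_nonneg _ _ hr0.le (by linarith)]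
  ring_nf

/-- For `p ≥ 2` the square function is dominated by the Gaussian norm. -/
lemma enorm_vecLp_le_of_two_le (hp : p ≠ ∞) (hp2 : 2 ≤ p) (x : Fin n → LpSpace d p) :
    ‖vecLp x‖ₑ ≤ eLpNorm (gaussianSum x) 2 (gaussPi n) := by
  set r := p.toReal with hr
  have hr2 : 2 ≤ r := by
    rw [hr, ← ENNReal.toReal_ofNat]
    exact ENNReal.toReal_mono hp hp2
  have hr0 : 0 < r := by linarith
  have hσm := measurable_squareFun x
  rcases eq_or_ne ‖vecLp x‖ₑ 0 with hN | hN
  · rw [hN]; exact zero_le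
  -- The same weight, now with Hölder exponents `r / 2` and `r / (r - 2)`; taking expectations
  -- leaves `∫ σ^r` on the left.
  have hpt : ∀ ω, (∫⁻ y, ‖pointwiseGauss x ω y‖ₑ ^ (2 : ℝ) * squareFun x y ^ (r - 2)) ≤
      ‖gaussianSum x ω‖ₑ ^ (2 : ℝ) * ‖vecLp x‖ₑ ^ (r - 2) := by
    intro ω
    have hsm : Measurable fun y => pointwiseGauss x ω y :=
      (measurable_pointwiseGauss x).comp (measurable_const.prodMk measurable_id)
    have h1 := ENNReal.lintegral_mul_norm_pow_le (μ := volume)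
        (f := fun y => ‖pointwiseGauss x ω y‖ₑ ^ r)
        (g := fun y => squareFun x y ^ r) (by fun_prop) (by fun_prop) (p := 2 / r) (q := (r - 2) / r)
        (by positivity) (div_nonneg (by linarith) hr0.le) (by field_simp; ring)
    have e1 : r * (2 / r) = 2 := by field_simp
    have e2 : r * ((r - 2) / r) = r - 2 := by field_simp
    rw [hr, ← enorm_gaussianSum_rpow hp, lintegral_squareFun_rpow hp, ← hr] at h1
    simp_rw [← ENNReal.rpow_mul] at h1
    rwa [e1, e2] at h1
  refine enorm_rpow_inj_le (two_pos : (0 : ℝ) < 2) ?_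
  have e0 : eLpNorm (gaussianSum x) 2 (gaussPi n) ^ (2 : ℝ) =
      ∫⁻ ω, ‖gaussianSum x ω‖ₑ ^ (2 : ℝ) ∂gaussPi n := by
    rw [eLpNorm_eq_lintegral_rpow_enorm_toReal two_ne_zero ENNReal.ofNat_ne_top, ← ENNReal.rpow_mul]
    simp
  have hN' : ‖vecLp x‖ₑ ^ (r - 2) ≠ ∞ := ENNReal.rpow_ne_top_of_nonneg (by linarith) enorm_ne_top
  have hN0 : ‖vecLp x‖ₑ ^ (r - 2) ≠ 0 := by
    rw [Ne, ENNReal.rpow_eq_zero_iff]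
    rintro (⟨h, -⟩ | ⟨h, -⟩)
    · exact hN h
    · exact enorm_ne_top h
  rw [e0, ← ENNReal.mul_le_mul_iff_left hN0 hN', ← lintegral_mul_const' _ _ hN']
  refine le_trans (le_of_eq ?_) (lintegral_mono hpt)
  rw [lintegral_weighted_gauss_sq x _ (by fun_prop), ← ENNReal.rpow_add_of_nonneg _ _ two_pos.le (by linarith)]
  have e3 : 2 + (r - 2) = r := by ring
  rw [e3, hr, ← lintegral_squareFun_rpow hp, ← hr]
  refine lintegral_congr fun y => ?_
  rw [← ENNReal.rpow_add_of_nonneg _ _ two_pos.le (by linarith), e3]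

lemma eLpNorm_gaussianSum_rpow (hp : p ≠ ∞) (x : Fin n → LpSpace d p) :
    eLpNorm (gaussianSum x) p (gaussPi n) ^ p.toReal =
      ∫⁻ y, ∫⁻ ω, ‖pointwiseGauss x ω y‖ₑ ^ p.toReal ∂gaussPi n := by
  have hp0 : p ≠ 0 := (zero_lt_one.trans_le Fact.out).ne'
  rw [← lintegral_enorm_gaussianSum_rpow hp, eLpNorm_eq_lintegral_rpow_enorm_toReal hp0 hp,
    ← ENNReal.rpow_mul, one_div, inv_mul_cancel₀ (ENNReal.toReal_pos hp0 hp).ne', ENNReal.rpow_one]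

/-- Gaussian norms and square functions are equivalent. -/
theorem exists_gaussNorm_equiv (d : ℕ) (hp : p ≠ ∞) :
    ∃ C : ℝ≥0, ∀ (n : ℕ) (x : Fin n → LpSpace d p),
      gaussNorm x ≤ C * ‖vecLp x‖ ∧ ‖vecLp x‖ ≤ C * gaussNorm x := by
  set r := p.toReal with hr
  have hr0 : 0 < r := ENNReal.toReal_pos (zero_lt_one.trans_le Fact.out).ne' hp
  suffices h : ∃ C : ℝ≥0, ∀ (n : ℕ) (x : Fin n → LpSpace d p),
      eLpNorm (gaussianSum x) 2 (gaussPi n) ≤ C * ‖vecLp x‖ₑ ∧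
        ‖vecLp x‖ₑ ≤ C * eLpNorm (gaussianSum x) 2 (gaussPi n) by
    obtain ⟨C, hC⟩ := h
    refine ⟨C, fun n x => ?_⟩
    have h := hC n x
    have hg : 0 ≤ gaussNorm x := Real.sqrt_nonneg _
    rwa [← ofReal_gaussNorm, ← ofReal_norm, ← ENNReal.ofReal_coe_nnreal,
      ← ENNReal.ofReal_mul (by positivity), ← ENNReal.ofReal_mul (by positivity),
      ENNReal.ofReal_le_ofReal_iff (by positivity), ENNReal.ofReal_le_ofReal_iff (by positivity)] at h
  have hm0 := gaussMoment_ne_zero hr0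
  have hmt := gaussMoment_ne_top hr0
  have hroot : ∀ {a b c : ℝ≥0∞}, a ^ r ≤ c * b ^ r → a ≤ c ^ (1 / r) * b := by
    intro a b c h
    refine enorm_rpow_inj_le hr0 ?_
    rwa [ENNReal.mul_rpow_of_nonneg _ _ hr0.le, ← ENNReal.rpow_mul, one_div_mul_cancel hr0.ne',
      ENNReal.rpow_one]
  -- On each side of 2 one inequality is the weighted Hölder argument with constant 1. The other
  -- combines monotonicity of `L^q` norms on a probability space with the scalar `p`-th moments at
  -- each point.
  rcases le_total p 2 with h2 | h2
  · set c : ℝ≥0∞ := 2 ^ r * 2 * (gaussMoment r)⁻¹ with hc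
    have hct : c ^ (1 / r) ≠ ∞ := ENNReal.rpow_ne_top_of_nonneg (by positivity)
      (ENNReal.mul_ne_top (by finiteness) (ENNReal.inv_ne_top.2 hm0))
    refine ⟨max 1 (c ^ (1 / r)).toNNReal, fun n x => ⟨?_, ?_⟩⟩
    · refine (eLpNorm_gaussianSum_le_of_le_two h2 x).trans (le_mul_of_one_le_left zero_le ?_)
      exact_mod_cast le_max_left _ _
    · have h3 : ‖vecLp x‖ₑ ^ r ≤ c * eLpNorm (gaussianSum x) p (gaussPi n) ^ r := by
        rw [hr, eLpNorm_gaussianSum_rpow hp, ← lintegral_squareFun_rpow hp, ← hr,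
          ← lintegral_const_mul' _ _ (ENNReal.mul_ne_top (by finiteness) (ENNReal.inv_ne_top.2 hm0))]
        refine lintegral_mono fun y => ?_
        have := le_lintegral_gauss_rpow hr0 (WithLp.toLp 2 fun i => x i y : EuclideanSpace ℂ (Fin n))
        rw [mul_comm, ← ENNReal.le_div_iff_mul_le (Or.inl hm0) (Or.inl hmt), div_eq_mul_inv] at this
        exact this.trans_eq (by simp only [pointwiseGauss]; ring)
      refine (hroot h3).trans (mul_le_mul' ?_ ?_)
      · rw [← ENNReal.coe_toNNReal hct]
        exact_mod_cast le_max_right _ _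
      · exact eLpNorm_le_eLpNorm_of_exponent_le h2 (continuous_gaussianSum x).aestronglyMeasurable
  · set c : ℝ≥0∞ := 2 ^ r * (2 * gaussMoment r) with hc
    have hct : c ^ (1 / r) ≠ ∞ := ENNReal.rpow_ne_top_of_nonneg (by positivity) (by finiteness)
    refine ⟨max 1 (c ^ (1 / r)).toNNReal, fun n x => ⟨?_, ?_⟩⟩
    · have h3 : eLpNorm (gaussianSum x) p (gaussPi n) ^ r ≤ c * ‖vecLp x‖ₑ ^ r := by
        rw [hr, eLpNorm_gaussianSum_rpow hp, ← lintegral_squareFun_rpow hp, ← hr,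
          ← lintegral_const_mul' _ _ (by finiteness)]
        exact lintegral_mono fun y =>
          lintegral_gauss_rpow_le hr0 (WithLp.toLp 2 fun i => x i y : EuclideanSpace ℂ (Fin n))
      refine (eLpNorm_le_eLpNorm_of_exponent_le h2 (continuous_gaussianSum x).aestronglyMeasurable).trans
        ((hroot h3).trans (mul_le_mul' ?_ le_rfl))
      rw [← ENNReal.coe_toNNReal hct]
      exact_mod_cast le_max_right _ _
    · refine (enorm_vecLp_le_of_two_le hp h2 x).trans (le_mul_of_one_le_left zero_le ?_)
      exact_mod_cast le_max_left _ _

/-- Square function bounds for diagonal operators give `γ`-bounds. -/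
theorem exists_gammaBound_le (d : ℕ) [hp : Fact (p ≠ ∞)] :
    ∃ C : ℝ≥0, ∀ (K : ℤ → LpSpace d 1) (B : ℝ), 0 ≤ B →
      (∀ (n : ℕ) (k : Fin n → ℤ) (v : VecLp d n p), ‖diagConv d n p (fun i => K (k i)) v‖ ≤ B * ‖v‖) →
      gammaBound {T : LpSpace d p →L[ℂ] LpSpace d p | ∃ k : ℤ, T = convLp d p (K k)} ≤
        ENNReal.ofReal (C * B) := by
  obtain ⟨C, hC⟩ := exists_gaussNorm_equiv (p := p) d hp.out
  refine ⟨C * C, fun K B hB h => ?_⟩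
  refine iInf₂_le (Real.toNNReal (((C * C : ℝ≥0) : ℝ) * B)) fun n T x hT => ?_
  choose k hk using hT
  obtain ⟨h1, -⟩ := hC n fun i => T i (x i)
  obtain ⟨-, h2⟩ := hC n x
  have h3 := h n k (vecLp x)
  rw [diagConv_vecLp] at h3
  simp only [hk] at h1 ⊢
  rw [Real.coe_toNNReal _ (by positivity)]
  calc _ ≤ C * ‖vecLp fun i => convLp d p (K (k i)) (x i)‖ := h1
    _ ≤ C * (B * (C * gaussNorm x)) := by gcongr; exact h3.trans (by gcongr)
    _ = _ := by push_cast; ring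

end GaussLp

/-! ### The Poisson semigroup -/

section Semigroup

set_option linter.unusedSectionVars false

variable {d : ℕ} {p : ℝ≥0∞} [Fact (1 ≤ p)] [hp : Fact (p ≠ ∞)]

lemma isFunctionOfSqrtLaplacian_poissonL1 {z : ℂ} (hz : 0 < z.re) :
    IsFunctionOfSqrtLaplacian (expSymbol z) (convLp d p (poissonL1 d z)) :=
  isFunctionOfSqrtLaplacian_convLp _ (fourier_poissonL1 hz)

lemma poissonSemigroup_eq {z : ℂ} (hz : 0 < z.re) :
    poissonSemigroup d p z = convLp d p (poissonL1 d z) :=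
  (isFunctionOfSqrtLaplacian_poissonL1 hz).functionOf_eq

lemma isFunctionOfSqrtLaplacian_poissonSemigroup {z : ℂ} (hz : 0 < z.re) :
    IsFunctionOfSqrtLaplacian (expSymbol z) (poissonSemigroup d p z) := by
  rw [poissonSemigroup_eq hz]
  exact isFunctionOfSqrtLaplacian_poissonL1 hz

lemma differentiableOn_poissonSemigroup :
    DifferentiableOn ℂ (poissonSemigroup d p) {z : ℂ | 0 < z.re} := by
  refine DifferentiableOn.congr ?_ fun z hz => poissonSemigroup_eq hz
  exact (convLp d p).differentiable.comp_differentiableOn (differentiableOn_poissonL1 d)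

lemma poissonSemigroup_add {z w : ℂ} (hz : 0 < z.re) (hw : 0 < w.re) :
    poissonSemigroup d p (z + w) = (poissonSemigroup d p z).comp (poissonSemigroup d p w) := by
  have hzw : 0 < (z + w).re := by rw [Complex.add_re]; positivity
  rw [poissonSemigroup_eq hz, poissonSemigroup_eq hw, poissonSemigroup_eq hzw]
  refine convLp_comp_convLp fun ξ => ?_
  rw [fourier_poissonL1 hz, fourier_poissonL1 hw, fourier_poissonL1 hzw, expSymbol, expSymbol, expSymbol,
    ← Complex.exp_add]
  ring_nf

lemma integral_halfSpacePoissonKernel_one :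
    ∫ x : EuclideanSpace ℝ (Fin d), halfSpacePoissonKernel d 1 x = 1 := by
  have h1 : (0 : ℝ) < (1 : ℂ).re := by simp
  have h := fourier_halfSpacePoissonKernel h1 (integrable_halfSpacePoissonKernel (d := d) h1) 0
  rw [Real.fourier_eq] at h
  simpa [expSymbol] using h

/-- Rescaling leaves `t` only in the translation, so strong continuity at 0 becomes dominated
convergence against a fixed kernel. -/
lemma convLp_poissonL1_ofReal {t : ℝ} (ht : 0 < t) (f : LpSpace d p) :
    convLp d p (poissonL1 d t) f = ∫ y, halfSpacePoissonKernel d 1 y • translateLp p (t • y) f := by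
  have ht' : 0 < (t : ℂ).re := by simpa using ht
  rw [convLp_apply]
  have h1 : ∫ y, poissonL1 d t y • translateLp p y f =
      ∫ y, halfSpacePoissonKernel d t y • translateLp p y f := by
    refine integral_congr_ae ?_
    filter_upwards [poissonL1_ae ht'] with y hy
    rw [hy]
  have h2 := Measure.integral_comp_smul_of_nonneg volume
    (fun y => halfSpacePoissonKernel d t y • translateLp p y f) t (hR := ht.le)
  have h3 : ∀ y, halfSpacePoissonKernel d t (t • y) • translateLp p (t • y) f =
      (t ^ d)⁻¹ • (halfSpacePoissonKernel d 1 y • translateLp p (t • y) f) := by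
    intro y
    have := halfSpacePoissonKernel_smul (d := d) ht 1 (t • y)
    rw [mul_one, inv_smul_smul₀ ht.ne', Real.rpow_neg ht.le, Real.rpow_natCast] at this
    rw [this, mul_smul]
    exact Complex.coe_smul _ _
  simp_rw [h3] at h2
  rw [integral_smul, finrank_euclideanSpace_fin] at h2
  rw [h1]
  exact (smul_right_injective _ (by positivity : (t ^ d)⁻¹ ≠ 0) h2).symm

lemma tendsto_convLp_poissonL1 (f : LpSpace d p) :
    Tendsto (fun t : ℝ => convLp d p (poissonL1 d t) f) (𝓝[>] 0) (𝓝 f) := by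
  have h1 : (0 : ℝ) < (1 : ℂ).re := by simp
  have hint := integrable_halfSpacePoissonKernel (d := d) h1
  have key : Tendsto (fun t : ℝ => ∫ y, halfSpacePoissonKernel d 1 y • translateLp p (t • y) f)
      (𝓝[>] 0) (𝓝 (∫ y, halfSpacePoissonKernel d 1 y • f)) := by
    refine tendsto_integral_filter_of_dominated_convergence
      (fun y => ‖halfSpacePoissonKernel d 1 y‖ * ‖f‖) ?_ ?_ (hint.norm.mul_const _) ?_
    · refine Eventually.of_forall fun t => ?_
      refine Continuous.aestronglyMeasurable ?_
      exact (continuous_halfSpacePoissonKernel h1).smul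
        ((continuous_translateLp f).comp (continuous_const_smul t))
    · refine Eventually.of_forall fun t => Eventually.of_forall fun y => ?_
      rw [norm_smul, LinearIsometry.norm_map]
    · refine Eventually.of_forall fun y => Tendsto.const_smul ?_ _
      have hc : Continuous fun t : ℝ => translateLp p (t • y) f :=
        (continuous_translateLp f).comp (continuous_id.smul continuous_const)
      have := hc.tendsto 0
      rw [zero_smul, translateLp_zero] at this
      exact this.mono_left nhdsWithin_le_nhds
  rw [integral_smul_const, integral_halfSpacePoissonKernel_one, one_smul] at key
  refine key.congr' ?_
  filter_upwards [self_mem_nhdsWithin] with t ht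
  rw [convLp_poissonL1_ofReal ht]

lemma memLp_halfSpacePoissonKernel {z : ℂ} (hz : 0 < z.re) {q : ℝ≥0∞} (hq1 : 1 ≤ q) (hq : q ≠ ∞) :
    MemLp (halfSpacePoissonKernel d z) q := by
  obtain ⟨C, hC⟩ := exists_norm_halfSpacePoissonKernel_le (d := d) hz
  have hc := continuous_halfSpacePoissonKernel (d := d) hz
  have hr : 1 ≤ q.toReal := by
    rw [← ENNReal.toReal_one]
    exact ENNReal.toReal_mono hq hq1
  rw [← integrable_norm_rpow_iff hc.aestronglyMeasurable (zero_lt_one.trans_le hq1).ne' hq]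
  refine ((integrable_halfSpacePoissonKernel hz).norm.const_mul (C ^ (q.toReal - 1))).mono'
    (hc.norm.rpow_const fun x => Or.inr (by positivity)).aestronglyMeasurable
    (Eventually.of_forall fun x => ?_)
  rw [Real.norm_of_nonneg (by positivity)]
  have h1 : ‖halfSpacePoissonKernel d z x‖ ^ q.toReal =
      ‖halfSpacePoissonKernel d z x‖ ^ (q.toReal - 1) * ‖halfSpacePoissonKernel d z x‖ := by
    rw [← Real.rpow_add_one' (norm_nonneg _) (by linarith)]
    ring_nf
  rw [h1]
  gcongr
  exact hC x

/-- The kernel lies in the conjugate `L^q`, so Hölder gives convergence at every `x`, not only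
almost everywhere. -/
lemma integrable_halfSpacePoissonKernel_mul (hp1 : 1 < p) {z : ℂ} (hz : 0 < z.re) (f : LpSpace d p)
    (x : EuclideanSpace ℝ (Fin d)) : Integrable fun y => halfSpacePoissonKernel d z (x - y) * f y := by
  obtain ⟨q, hq⟩ : ∃ q, ENNReal.HolderConjugate p q :=
    ⟨p.conjExponent, ENNReal.HolderConjugate.conjExponent Fact.out⟩
  have hq' : ENNReal.HolderConjugate q p := ENNReal.HolderConjugate.symm
  have h := (memLp_halfSpacePoissonKernel (d := d) hz (ENNReal.HolderConjugate.one_le q p)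
    ((ENNReal.HolderConjugate.ne_top_iff_ne_one q p).2 hp1.ne')).comp_measurePreserving
    (Measure.measurePreserving_sub_left volume x)
  exact MemLp.integrable_mul h (Lp.memLp f)

lemma poissonSemigroup_ae {z : ℂ} (hz : 0 < z.re) (f : LpSpace d p) :
    poissonSemigroup d p z f =ᵐ[volume] fun x => ∫ y, halfSpacePoissonKernel d z (x - y) * f y := by
  rw [poissonSemigroup_eq hz]
  exact convLp_ae_of_ae_eq (poissonL1_ae hz) f

end Semigroup

/-! ### The generator -/

section Generator

lemma fourier_sub_Lp_two {d : ℕ} (u v : LpSpace d 2) : 𝓕 (u - v) = 𝓕 u - 𝓕 v :=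
  map_sub (Lp.fourierTransformₗᵢ (EuclideanSpace ℝ (Fin d)) ℂ) u v

variable {d : ℕ} {p : ℝ≥0∞} [Fact (1 ≤ p)] [hp : Fact (p ≠ ∞)]

/-- Evaluation of the Fourier transform of an integrable function. -/
def fourierEval (ξ : EuclideanSpace ℝ (Fin d)) : LpSpace d 1 →L[ℂ] ℂ :=
  LinearMap.mkContinuous
    { toFun := fun K => 𝓕 (K : EuclideanSpace ℝ (Fin d) → ℂ) ξ
      map_add' := fun K L => by
        rw [fourier_congr_ae (Lp.coeFn_add K L), Real.fourier_eq, Real.fourier_eq, Real.fourier_eq,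
          ← integral_add]
        · simp
        · exact (Real.fourierIntegral_convergent_iff ξ).2 (L1.integrable_coeFn K)
        · exact (Real.fourierIntegral_convergent_iff ξ).2 (L1.integrable_coeFn L)
      map_smul' := fun c K => by
        rw [fourier_congr_ae (Lp.coeFn_smul c K), Real.fourier_eq, Real.fourier_eq, RingHom.id_apply,
          ← integral_smul]
        refine integral_congr_ae (Eventually.of_forall fun x => ?_)
        simp only [Pi.smul_apply, smul_eq_mul, Circle.smul_def]
        ring } 1 fun K => by
      rw [one_mul, L1.norm_eq_integral_norm]
      exact norm_fourier_le_integral_norm _ ξ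

lemma fourierEval_apply (ξ : EuclideanSpace ℝ (Fin d)) (K : LpSpace d 1) :
    fourierEval ξ K = 𝓕 (K : EuclideanSpace ℝ (Fin d) → ℂ) ξ := rfl

lemma continuousOn_poissonL1_ofReal (d : ℕ) :
    ContinuousOn (fun s : ℝ => poissonL1 d (s : ℂ)) (Set.Ioi 0) :=
  (differentiableOn_poissonL1 d).continuousOn.comp Complex.continuous_ofReal.continuousOn
    fun s hs => by simpa using hs

lemma intervalIntegrable_poissonL1 (hd : 1 ≤ d) {t : ℝ} (ht : 0 ≤ t) :
    IntervalIntegrable (fun s : ℝ => poissonL1 d (s : ℂ)) volume 0 t := by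
  -- On the real axis `‖z‖ / Re z = 1`, so any admissible exponent gives a bound uniform down to `s
  -- = 0`.
  obtain ⟨C, hC⟩ := exists_norm_poissonL1_le hd (show ((d : ℝ) - 1) / 2 < (d : ℝ) by
    have : (1 : ℝ) ≤ d := by exact_mod_cast hd
    linarith)
  rw [intervalIntegrable_iff_integrableOn_Ioc_of_le ht]
  refine IntegrableOn.of_bound measure_Ioc_lt_top (((continuousOn_poissonL1_ofReal d).mono
    fun s hs => hs.1).aestronglyMeasurable measurableSet_Ioc) C ?_
  filter_upwards [self_mem_ae_restrict measurableSet_Ioc] with s hs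
  have hs' : 0 < (s : ℂ).re := by simpa using hs.1
  refine (hC s hs').trans_eq ?_
  rw [Complex.norm_real, Complex.ofReal_re, Real.norm_of_nonneg hs.1.le, div_self hs.1.ne', Real.one_rpow,
    mul_one]

/-- The kernel of `∫_0^t exp(-sA) ds`. -/
def integratedPoisson (d : ℕ) (t : ℝ) : LpSpace d 1 := ∫ s in (0 : ℝ)..t, poissonL1 d (s : ℂ)

/-- The symbol form of `A ∫_0^t exp(-sA) ds = 1 - exp(-tA)`, by the fundamental theorem of calculus.
-/
lemma mul_fourier_integratedPoisson (hd : 1 ≤ d) {t : ℝ} (ht : 0 ≤ t) (ξ : EuclideanSpace ℝ (Fin d)) :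
    ((2 * Real.pi * ‖ξ‖ : ℝ) : ℂ) * 𝓕 (integratedPoisson d t : EuclideanSpace ℝ (Fin d) → ℂ) ξ =
      1 - expSymbol t (2 * Real.pi * ‖ξ‖) := by
  set l : ℝ := 2 * Real.pi * ‖ξ‖ with hl
  have h1 : 𝓕 (integratedPoisson d t : EuclideanSpace ℝ (Fin d) → ℂ) ξ =
      ∫ s in (0 : ℝ)..t, Complex.exp (-(s : ℂ) * (l : ℂ)) := by
    rw [← fourierEval_apply, integratedPoisson,
      ← ContinuousLinearMap.intervalIntegral_comp_comm _ (intervalIntegrable_poissonL1 hd ht)]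
    refine intervalIntegral.integral_congr_ae (Eventually.of_forall fun s hs => ?_)
    rw [Set.uIoc_of_le ht] at hs
    rw [fourierEval_apply, fourier_poissonL1 (by simpa using hs.1), expSymbol]
  have h2 : ∀ s ∈ Set.uIcc 0 t, HasDerivAt (fun s : ℝ => -Complex.exp (-(s : ℂ) * (l : ℂ)))
      ((l : ℂ) * Complex.exp (-(s : ℂ) * (l : ℂ))) s := by
    intro s _
    have := (((Complex.ofRealCLM.hasDerivAt (x := s)).neg.mul_const (l : ℂ)).cexp).neg
    refine this.congr_deriv ?_
    simp
    ring
  rw [h1, ← intervalIntegral.integral_const_mul,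
    intervalIntegral.integral_eq_sub_of_hasDerivAt h2 (Continuous.intervalIntegrable (by fun_prop) _ _),
    expSymbol]
  simp
  ring

lemma convLp_integratedPoisson (hd : 1 ≤ d) {t : ℝ} (ht : 0 ≤ t) (f : LpSpace d p) :
    convLp d p (integratedPoisson d t) f = ∫ s in (0 : ℝ)..t, convLp d p (poissonL1 d s) f := by
  have := ContinuousLinearMap.intervalIntegral_comp_comm ((convLp d p).flip f)
    (intervalIntegrable_poissonL1 hd ht)
  exact this.symm

lemma tendsto_inv_smul_convLp_integratedPoisson (hd : 1 ≤ d) (f : LpSpace d p) :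
    Tendsto (fun t : ℝ => (t : ℂ)⁻¹ • convLp d p (integratedPoisson d t) f) (𝓝[>] 0) (𝓝 f) := by
  have h := tendsto_convLp_poissonL1 f
  rw [Metric.tendsto_nhdsWithin_nhds] at h ⊢
  intro ε hε
  obtain ⟨δ, hδ, hball⟩ := h (ε / 2) (half_pos hε)
  refine ⟨δ, hδ, fun {t} ht htδ => ?_⟩
  have ht0 : 0 < t := ht
  have hii : IntervalIntegrable (fun s : ℝ => convLp d p (poissonL1 d s) f) volume 0 t :=
    intervalIntegrable_iff.2 (((convLp d p).flip f).integrable_comp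
      (intervalIntegrable_iff.1 (intervalIntegrable_poissonL1 hd ht0.le)))
  have htf : t • f = (t : ℂ) • f := (Complex.coe_smul t f).symm
  have e1 : (t : ℂ)⁻¹ • convLp d p (integratedPoisson d t) f - f =
      (t : ℂ)⁻¹ • ∫ s in (0 : ℝ)..t, (convLp d p (poissonL1 d s) f - f) := by
    rw [intervalIntegral.integral_sub hii (by simp), intervalIntegral.integral_const,
      ← convLp_integratedPoisson hd ht0.le, smul_sub, sub_zero, htf, smul_smul,
      inv_mul_cancel₀ (by exact_mod_cast ht0.ne'), one_smul]
  have e2 : ‖∫ s in (0 : ℝ)..t, (convLp d p (poissonL1 d s) f - f)‖ ≤ ε / 2 * |t - 0| := by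
    refine intervalIntegral.norm_integral_le_of_norm_le_const fun s hs => ?_
    rw [Set.uIoc_of_le ht0.le] at hs
    have := hball (x := s) hs.1 (by
      rw [dist_zero_right, Real.norm_of_nonneg hs.1.le]
      rw [dist_zero_right, Real.norm_of_nonneg ht0.le] at htδ
      exact hs.2.trans_lt htδ)
    rw [dist_eq_norm] at this
    exact this.le
  rw [dist_eq_norm, e1, norm_smul, norm_inv, Complex.norm_real, Real.norm_of_nonneg ht0.le]
  rw [sub_zero, abs_of_pos ht0] at e2
  calc t⁻¹ * _ ≤ t⁻¹ * (ε / 2 * t) := by gcongr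
    _ = ε / 2 := by field_simp
    _ < ε := half_lt_self hε

lemma mem_spectralGraph_integratedPoisson (hd : 1 ≤ d) {t : ℝ} (ht : 0 < t) (f : LpSpace d p) :
    (convLp d p (integratedPoisson d t) f, f - convLp d p (poissonL1 d t) f) ∈
      spectralGraph d p fun s => (s : ℂ) := by
  have hc : Continuous fun f : LpSpace d p =>
      (convLp d p (integratedPoisson d t) f, f - convLp d p (poissonL1 d t) f) := by fun_prop
  refine closure_mono ?_ (map_mem_closure (f := fun f : LpSpace d p =>
    (convLp d p (integratedPoisson d t) f, f - convLp d p (poissonL1 d t) f)) hc (dense_inter_Lp_two f) fun f hf => Set.mem_image_of_mem _ hf)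
  rintro _ ⟨f, ⟨u, hu⟩, rfl⟩
  refine ⟨convLp d 2 (integratedPoisson d t) u, u - convLp d 2 (poissonL1 d t) u, convLp_congr _ hu, ?_, ?_⟩
  · exact (Lp.coeFn_sub _ _).trans ((hu.sub (convLp_congr _ hu)).trans (Lp.coeFn_sub _ _).symm)
  · rw [fourier_sub_Lp_two]
    filter_upwards [Lp.coeFn_sub (𝓕 u) (𝓕 (convLp d 2 (poissonL1 d t) u)),
      fourier_convLp (integratedPoisson d t) u, fourier_convLp (poissonL1 d t) u] with ξ e1 e2 e3
    rw [e1, Pi.sub_apply, e2, e3, fourier_poissonL1 (by simpa using ht), ← mul_assoc,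
      mul_fourier_integratedPoisson hd ht.le]
    ring

/-- The relation `(1 - exp(-tA)) f = ∫_0^t exp(-sA) A f ds`, phrased for pairs in the closed graph
so that it can prove that this graph is single valued. -/
lemma sub_convLp_poissonL1_eq_of_mem (hd : 1 ≤ d) {t : ℝ} (ht : 0 < t) {q : LpSpace d p × LpSpace d p}
    (hq : q ∈ spectralGraph d p fun s => (s : ℂ)) :
    q.1 - convLp d p (poissonL1 d t) q.1 = convLp d p (integratedPoisson d t) q.2 := by
  have hclosed : IsClosed {q : LpSpace d p × LpSpace d p |
      q.1 - convLp d p (poissonL1 d t) q.1 = convLp d p (integratedPoisson d t) q.2} :=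
    isClosed_eq (by fun_prop) (by fun_prop)
  refine closure_minimal ?_ hclosed hq
  rintro ⟨f, g⟩ ⟨u, v, h1, h2, h3⟩
  have key : u - convLp d 2 (poissonL1 d t) u = convLp d 2 (integratedPoisson d t) v := by
    refine eq_of_fourier_ae_eq ?_
    rw [fourier_sub_Lp_two]
    filter_upwards [Lp.coeFn_sub (𝓕 u) (𝓕 (convLp d 2 (poissonL1 d t) u)),
      fourier_convLp (integratedPoisson d t) v, fourier_convLp (poissonL1 d t) u, h3] with ξ e1 e2 e3 e4
    rw [e1, Pi.sub_apply, e2, e3, e4, fourier_poissonL1 (by simpa using ht), ← mul_assoc,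
      mul_comm (𝓕 (integratedPoisson d t : EuclideanSpace ℝ (Fin d) → ℂ) ξ),
      mul_fourier_integratedPoisson hd ht.le]
    ring
  refine Lp.ext ?_
  refine (Lp.coeFn_sub _ _).trans (((h1.symm.sub (convLp_congr _ h1).symm).trans
    (Lp.coeFn_sub _ _).symm).trans ?_)
  rw [key]
  exact convLp_congr _ h2

/-- Closability of the `L²` definition: for a pair `(0, g)` the averages `t⁻¹ ∫_0^t exp(-sA) g ds`
vanish, and they tend to `g`. -/
lemma sqrtLaplacian_graph (hd : 1 ≤ d) :
    (sqrtLaplacian d p).graph = spectralGraph d p fun s => (s : ℂ) := by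
  refine Submodule.toLinearPMap_graph_eq _ fun q hq hq0 => ?_
  refine tendsto_nhds_unique (tendsto_inv_smul_convLp_integratedPoisson hd q.2) ?_
  refine tendsto_const_nhds.congr' ?_
  filter_upwards [self_mem_nhdsWithin] with t ht
  rw [← sub_convLp_poissonL1_eq_of_mem hd ht hq, hq0]
  simp

/-- On the graph the difference quotient is the average of the semigroup applied to `g`, which tends
to `g`. Conversely the averages of `f` are in the domain, their images are the difference quotients,
and the graph is closed. -/
theorem mem_sqrtLaplacian_graph_iff (hd : 1 ≤ d) (f g : LpSpace d p) :
    (f, g) ∈ (sqrtLaplacian d p).graph ↔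
      Tendsto (fun t : ℝ => (t : ℂ)⁻¹ • (f - poissonSemigroup d p (t : ℂ) f)) (𝓝[>] 0) (𝓝 g) := by
  have hT : ∀ t ∈ Set.Ioi (0 : ℝ), poissonSemigroup d p (t : ℂ) = convLp d p (poissonL1 d t) :=
    fun t ht => poissonSemigroup_eq (by simpa using ht)
  rw [sqrtLaplacian_graph hd]
  constructor
  · intro h
    refine (tendsto_inv_smul_convLp_integratedPoisson hd g).congr' ?_
    filter_upwards [self_mem_nhdsWithin] with t ht
    rw [hT t ht, ← sub_convLp_poissonL1_eq_of_mem hd ht h]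
  · intro h
    refine (Submodule.isClosed_topologicalClosure _).mem_of_tendsto
      ((tendsto_inv_smul_convLp_integratedPoisson hd f).prodMk_nhds h) ?_
    filter_upwards [self_mem_nhdsWithin] with t ht
    rw [hT t ht]
    exact Submodule.smul_mem _ (t : ℂ)⁻¹ (mem_spectralGraph_integratedPoisson hd ht f)

end Generator

/-! ### `γ`-bounds of the semigroup -/

section SemigroupGamma

variable {d : ℕ} {p : ℝ≥0∞} [Fact (1 ≤ p)] [hp : Fact (p ≠ ∞)]

lemma poissonSemigroup_set_eq {z : ℂ} (hz : 0 < z.re) :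
    {T : LpSpace d p →L[ℂ] LpSpace d p | ∃ k : ℤ, T = poissonSemigroup d p (z * 2 ^ k)} =
      {T | ∃ k : ℤ, T = convLp d p (poissonL1 d (((2 ^ k : ℝ) : ℂ) * z))} := by
  have h : ∀ k : ℤ, poissonSemigroup d p (z * 2 ^ k) =
      convLp d p (poissonL1 d (((2 ^ k : ℝ) : ℂ) * z)) := by
    intro k
    rw [← poissonSemigroup_eq (re_dyadic_pos hz k)]
    push_cast
    rw [mul_comm]
  simp only [h]

lemma exists_gammaBound_poissonSemigroup_le (hd : 1 ≤ d) (hp1 : 1 < p) {α : ℝ}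
    (hα : ((d : ℝ) - 1) / 2 < α) :
    ∃ C : ℝ, ∀ t θ : ℝ, 0 < t → |θ| < Real.pi / 2 →
      gammaBound {T : LpSpace d p →L[ℂ] LpSpace d p |
          ∃ k : ℤ, T = poissonSemigroup d p (Complex.exp (θ * Complex.I) * t * 2 ^ k)} ≤
        ENNReal.ofReal (C * (Real.pi / 2 - |θ|) ^ (-α)) := by
  obtain ⟨C₁, hC₁⟩ := exists_gammaBound_le (p := p) d
  obtain ⟨C₂, hC₂⟩ := exists_norm_diagConv_dyadicPoisson_le (p := p) hd hα hp1
  have hα0 : 0 ≤ α := by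
    have : (1 : ℝ) ≤ d := by exact_mod_cast hd
    linarith
  refine ⟨C₁ * (C₂ * (Real.pi / 2) ^ α), fun t θ ht hθ => ?_⟩
  set z : ℂ := Complex.exp (θ * Complex.I) * t with hz
  have hδ : 0 < Real.pi / 2 - |θ| := by linarith
  have hre : z.re = Real.cos θ * t := by
    rw [hz, Complex.re_mul_ofReal, Complex.exp_ofReal_mul_I_re]
  -- Jordan's inequality, since `‖z‖ / Re z = 1 / cos θ`.
  have hcos : 2 / Real.pi * (Real.pi / 2 - |θ|) ≤ Real.cos θ := by
    rw [← Real.cos_abs θ, ← Real.sin_pi_div_two_sub]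
    exact Real.mul_le_sin hδ.le (by linarith [abs_nonneg θ])
  have hcos0 : 0 < Real.cos θ := lt_of_lt_of_le (by positivity) hcos
  have hz0 : 0 < z.re := by rw [hre]; positivity
  have hnorm : ‖z‖ = t := by
    rw [hz, norm_mul, Complex.norm_exp_ofReal_mul_I, one_mul, Complex.norm_real, Real.norm_of_nonneg ht.le]
  have hratio : (‖z‖ / z.re) ^ α ≤ (Real.pi / 2) ^ α * (Real.pi / 2 - |θ|) ^ (-α) := by
    rw [Real.rpow_neg hδ.le, ← Real.inv_rpow hδ.le, ← Real.mul_rpow (by positivity) (by positivity)]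
    refine Real.rpow_le_rpow (by positivity) ?_ hα0
    rw [hnorm, hre, div_mul_cancel_right₀ ht.ne']
    refine (inv_anti₀ (by positivity) hcos).trans_eq ?_
    rw [mul_inv, inv_div]
  rw [poissonSemigroup_set_eq hz0]
  have hB : 0 ≤ C₂ * (‖z‖ / z.re) ^ α := by positivity
  have h := hC₁ (fun k => poissonL1 d (((2 ^ k : ℝ) : ℂ) * z)) _ hB fun n k v => hC₂ z hz0 n k v
  refine h.trans ?_
  refine ENNReal.ofReal_le_ofReal ?_
  calc (C₁ : ℝ) * (C₂ * (‖z‖ / z.re) ^ α)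
      ≤ C₁ * (C₂ * ((Real.pi / 2) ^ α * (Real.pi / 2 - |θ|) ^ (-α))) := by gcongr
    _ = _ := by ring

end SemigroupGamma

/-! ### Regularised wave operators -/

section Wave

variable {d : ℕ} {p : ℝ≥0∞} [Fact (1 ≤ p)] [hp : Fact (p ≠ ∞)]

/-- Near 0 the integrand behaves like `u^{α-β-1}`, which is where `β < α` is used. Bounding `(1 +
u)^β` by `2^β (1 + u^β)` leaves the Gamma integrals of `α - β` and `α`. -/
lemma integrableOn_gamma_weight {α β : ℝ} (hβ : 0 ≤ β) (hβα : β < α) :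
    IntegrableOn (fun u : ℝ => u ^ (α - 1) * Real.exp (-u) * ((1 + u) / u) ^ β) (Set.Ioi 0) := by
  have h1 := (Real.GammaIntegral_convergent (sub_pos.2 hβα)).add
    (Real.GammaIntegral_convergent (hβ.trans_lt hβα))
  refine (h1.const_mul (2 ^ β)).mono' ?_ ?_
  · refine ContinuousOn.aestronglyMeasurable (fun u hu => ContinuousAt.continuousWithinAt ?_) measurableSet_Ioi
    have hu0 : (0 : ℝ) < u := hu
    refine ((Real.continuousAt_rpow_const _ _ (Or.inl hu0.ne')).mul (by fun_prop)).mul ?_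
    exact ContinuousAt.rpow_const (((continuousAt_const.add continuousAt_id).div continuousAt_id hu0.ne'))
      (Or.inr hβ)
  · filter_upwards [self_mem_ae_restrict measurableSet_Ioi] with u hu
    have hu0 : (0 : ℝ) < u := hu
    have h2 : (1 + u) ^ β ≤ 2 ^ β * (1 + u ^ β) := by
      rcases le_total u 1 with h | h
      · calc (1 + u) ^ β ≤ 2 ^ β := Real.rpow_le_rpow (by positivity) (by linarith) hβ
          _ ≤ _ := le_mul_of_one_le_right (by positivity) (by linarith [Real.rpow_nonneg hu0.le β])
      · calc (1 + u) ^ β ≤ (2 * u) ^ β := Real.rpow_le_rpow (by positivity) (by linarith) hβ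
          _ = 2 ^ β * u ^ β := Real.mul_rpow (by norm_num) hu0.le
          _ ≤ _ := by gcongr; linarith
    have h3 : u ^ (α - 1) = u ^ (α - β - 1) * u ^ β := by
      rw [← Real.rpow_add hu0]; ring_nf
    rw [Real.norm_of_nonneg (by positivity), Real.div_rpow (by positivity) hu0.le]
    have hub : 0 < u ^ β := Real.rpow_pos_of_pos hu0 β
    calc u ^ (α - 1) * Real.exp (-u) * ((1 + u) ^ β / u ^ β)
        = u ^ (α - β - 1) * Real.exp (-u) * (1 + u) ^ β := by rw [h3]; field_simp
      _ ≤ u ^ (α - β - 1) * Real.exp (-u) * (2 ^ β * (1 + u ^ β)) := by gcongr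
      _ = _ := by rw [Pi.add_apply, h3]; ring

/-- The Gamma density. -/
def gammaWeight (α u : ℝ) : ℝ := (Real.Gamma α)⁻¹ * (u ^ (α - 1) * Real.exp (-u))

lemma gammaWeight_nonneg {α u : ℝ} (hα : 0 < α) (hu : 0 ≤ u) : 0 ≤ gammaWeight α u := by
  have := Real.Gamma_pos_of_pos hα
  unfold gammaWeight
  positivity

/-- The integrand in the representation of the wave kernel. -/
def waveIntegrand (d : ℕ) (α t r u : ℝ) : LpSpace d 1 :=
  (gammaWeight α u : ℂ) • poissonL1 d ((r : ℂ) * (u - t * Complex.I))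

lemma re_wave (t u : ℝ) : ((u : ℂ) - t * Complex.I).re = u := by simp

lemma norm_wave_div_le {t u : ℝ} (hu : 0 < u) :
    ‖(u : ℂ) - t * Complex.I‖ / ((u : ℂ) - t * Complex.I).re ≤ (1 + |t|) * ((1 + u) / u) := by
  rw [re_wave, ← mul_div_assoc]
  gcongr
  calc ‖(u : ℂ) - t * Complex.I‖ ≤ ‖(u : ℂ)‖ + ‖t * Complex.I‖ := norm_sub_le _ _
    _ = u + |t| := by simp [abs_of_pos hu]
    _ ≤ _ := by nlinarith [abs_nonneg t, mul_nonneg (abs_nonneg t) hu.le]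

lemma norm_wave_div_rpow_le {t u β : ℝ} (hu : 0 < u) (hβ : 0 ≤ β) :
    (‖(u : ℂ) - t * Complex.I‖ / ((u : ℂ) - t * Complex.I).re) ^ β ≤
      (1 + |t|) ^ β * ((1 + u) / u) ^ β := by
  rw [← Real.mul_rpow (by positivity) (by positivity)]
  refine Real.rpow_le_rpow ?_ (norm_wave_div_le hu) hβ
  rw [re_wave]
  positivity

lemma re_mul_wave_pos {r t u : ℝ} (hr : 0 < r) (hu : 0 < u) :
    0 < ((r : ℂ) * (u - t * Complex.I)).re := by
  rw [Complex.re_ofReal_mul, re_wave]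
  positivity

lemma integrableOn_waveIntegrand (hd : 1 ≤ d) {α r : ℝ} (hα : ((d : ℝ) - 1) / 2 < α) (t : ℝ)
    (hr : 0 < r) : IntegrableOn (waveIntegrand d α t r) (Set.Ioi 0) := by
  have hd' : (1 : ℝ) ≤ d := by exact_mod_cast hd
  have hα0 : 0 < α := by linarith
  -- The kernel bound with exponent `α` itself would leave the nonintegrable `u^{-1}` at 0, so a
  -- smaller exponent is taken.
  obtain ⟨β, hβ1, hβ2⟩ := exists_between hα
  have hβ0 : 0 ≤ β := by linarith
  obtain ⟨C, hC⟩ := exists_norm_poissonL1_le hd hβ1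
  refine ((integrableOn_gamma_weight hβ0 hβ2).const_mul
    ((Real.Gamma α)⁻¹ * C * (1 + |t|) ^ β)).mono' ?_ ?_
  · refine ContinuousOn.aestronglyMeasurable ?_ measurableSet_Ioi
    refine ContinuousOn.smul (f := fun u : ℝ => (gammaWeight α u : ℂ))
      (g := fun u : ℝ => poissonL1 d ((r : ℂ) * (u - t * Complex.I))) ?_ ?_
    · refine Complex.continuous_ofReal.comp_continuousOn fun u hu => ContinuousAt.continuousWithinAt ?_
      have hu0 : (0 : ℝ) < u := hu
      exact continuousAt_const.mul ((Real.continuousAt_rpow_const _ _ (Or.inl hu0.ne')).mul (by fun_prop))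
    · exact (differentiableOn_poissonL1 d).continuousOn.comp (Continuous.continuousOn (by fun_prop))
        fun u hu => re_mul_wave_pos hr hu
  · filter_upwards [self_mem_ae_restrict measurableSet_Ioi] with u hu
    have hu0 : (0 : ℝ) < u := hu
    have h1 := hC _ (re_mul_wave_pos (t := t) hr hu0)
    have h2 : ‖(r : ℂ) * (u - t * Complex.I)‖ / ((r : ℂ) * (u - t * Complex.I)).re =
        ‖(u : ℂ) - t * Complex.I‖ / ((u : ℂ) - t * Complex.I).re := by
      rw [norm_mul, Complex.re_ofReal_mul, Complex.norm_real, Real.norm_of_nonneg hr.le,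
        mul_div_mul_left _ _ hr.ne']
    rw [h2] at h1
    rw [waveIntegrand, norm_smul, Complex.norm_real, Real.norm_of_nonneg (gammaWeight_nonneg hα0 hu0.le)]
    calc gammaWeight α u * _ ≤ gammaWeight α u * (C * ((1 + |t|) ^ β * ((1 + u) / u) ^ β)) := by
          refine mul_le_mul_of_nonneg_left (h1.trans ?_) (gammaWeight_nonneg hα0 hu0.le)
          exact mul_le_mul_of_nonneg_left (norm_wave_div_rpow_le hu0 hβ0) C.2
      _ = _ := by rw [gammaWeight]; ring

/-- The convolution kernel of the regularised wave operator. -/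
def waveKernel (d : ℕ) (α t r : ℝ) : LpSpace d 1 := ∫ u in Set.Ioi (0 : ℝ), waveIntegrand d α t r u

/-- The Gamma integral of `u^{α-1} e^{-(1 + rs)u}` produces `(1 + rs)^{-α}`, while the shift of time
by `-it` contributes the factor `e^{itrs}`, independent of `u`. -/
lemma fourier_waveKernel (hd : 1 ≤ d) {α r : ℝ} (hα : ((d : ℝ) - 1) / 2 < α) (t : ℝ) (hr : 0 < r)
    (ξ : EuclideanSpace ℝ (Fin d)) :
    𝓕 (waveKernel d α t r : EuclideanSpace ℝ (Fin d) → ℂ) ξ = waveSymbol α t r (2 * Real.pi * ‖ξ‖) := by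
  have hd' : (1 : ℝ) ≤ d := by exact_mod_cast hd
  have hα0 : 0 < α := by linarith
  set s : ℝ := 2 * Real.pi * ‖ξ‖ with hs
  have hs0 : 0 ≤ s := by positivity
  have h0 : 0 < 1 + r * s := by positivity
  rw [← fourierEval_apply, waveKernel,
    ← ContinuousLinearMap.integral_comp_comm _ (integrableOn_waveIntegrand hd hα t hr)]
  have h1 : ∀ u ∈ Set.Ioi (0 : ℝ), fourierEval ξ (waveIntegrand d α t r u) =
      (((Real.Gamma α)⁻¹ * (u ^ (α - 1) * Real.exp (-((1 + r * s) * u))) : ℝ) : ℂ) *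
        Complex.exp (Complex.I * ((t * (r * s) : ℝ) : ℂ)) := by
    intro u hu
    rw [waveIntegrand, map_smul, fourierEval_apply, fourier_poissonL1 (re_mul_wave_pos hr hu), expSymbol,
      gammaWeight, smul_eq_mul]
    have e1 : Complex.exp (-((r : ℂ) * (u - t * Complex.I)) * (s : ℂ)) =
        ((Real.exp (-(r * s * u)) : ℝ) : ℂ) * Complex.exp (Complex.I * ((t * (r * s) : ℝ) : ℂ)) := by
      rw [Complex.ofReal_exp, ← Complex.exp_add]
      congr 1
      push_cast
      ring
    have e2 : Real.exp (-((1 + r * s) * u)) = Real.exp (-u) * Real.exp (-(r * s * u)) := by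
      rw [← Real.exp_add]; congr 1; ring
    rw [e1, e2]
    push_cast
    ring
  rw [setIntegral_congr_fun measurableSet_Ioi h1, integral_mul_const, integral_complex_ofReal,
    integral_const_mul, Real.integral_rpow_mul_exp_neg_mul_Ioi hα0 h0, waveSymbol]
  congr 2
  rw [Real.rpow_neg h0.le, one_div, Real.inv_rpow h0.le]
  have := (Real.Gamma_pos_of_pos hα0).ne'
  field_simp

lemma isFunctionOfSqrtLaplacian_waveKernel (hd : 1 ≤ d) {α r : ℝ} (hα : ((d : ℝ) - 1) / 2 < α) (t : ℝ)
    (hr : 0 < r) : IsFunctionOfSqrtLaplacian (waveSymbol α t r) (convLp d p (waveKernel d α t r)) :=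
  isFunctionOfSqrtLaplacian_convLp _ (fourier_waveKernel hd hα t hr)

lemma waveOperator_eq (hd : 1 ≤ d) {α r : ℝ} (hα : ((d : ℝ) - 1) / 2 < α) (t : ℝ) (hr : 0 < r) :
    waveOperator d p α t r = convLp d p (waveKernel d α t r) :=
  (isFunctionOfSqrtLaplacian_waveKernel hd hα t hr).functionOf_eq

lemma diagConv_integral {n : ℕ} {K : Fin n → ℝ → LpSpace d 1} {S : Set ℝ}
    (hK : ∀ i, IntegrableOn (K i) S) (v : VecLp d n p) :
    diagConv d n p (fun i => ∫ u in S, K i u) v = ∫ u in S, diagConv d n p (fun i => K i u) v := by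
  set L : Fin n → LpSpace d 1 →L[ℂ] VecLp d n p := fun i => ((ContinuousLinearMap.toSpanSingleton ℂ
    (EuclideanSpace.single i (1 : ℂ))).compLpL p volume).comp ((convLp d p).flip (coordLp i v)) with hL
  have h1 : ∀ k : Fin n → LpSpace d 1, diagConv d n p k v = ∑ i, L i (k i) := by
    intro k
    simp [diagConv, sum_apply, hL]
  simp only [h1]
  rw [integral_finsetSum _ fun i _ => (L i).integrable_comp (hK i)]
  refine Finset.sum_congr rfl fun i _ => ?_
  rw [ContinuousLinearMap.integral_comp_comm _ (hK i)]

lemma diagConv_smul {n : ℕ} (c : ℂ) (K : Fin n → LpSpace d 1) (v : VecLp d n p) :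
    diagConv d n p (fun i => c • K i) v = c • diagConv d n p K v := by
  simp [diagConv, sum_apply, Finset.smul_sum]

/-- For fixed `u` the kernels at `r = 2^k` form the dyadic Poisson family of the single point `z = u
- it`. The square function bound thus holds under the integral, and Minkowski's inequality
integrates it. -/
lemma exists_norm_diagConv_waveKernel_le (hd : 1 ≤ d) (hp1 : 1 < p) {α : ℝ}
    (hα : ((d : ℝ) - 1) / 2 < α) :
    ∃ C : ℝ, 0 ≤ C ∧ ∀ (t : ℝ) (n : ℕ) (k : Fin n → ℤ) (v : VecLp d n p),
      ‖diagConv d n p (fun i => waveKernel d α t (2 ^ k i)) v‖ ≤ C * (1 + |t|) ^ α * ‖v‖ := by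
  have hd' : (1 : ℝ) ≤ d := by exact_mod_cast hd
  have hα0 : 0 < α := by linarith
  obtain ⟨β, hβ1, hβ2⟩ := exists_between hα
  have hβ0 : 0 ≤ β := by linarith
  obtain ⟨C, hC⟩ := exists_norm_diagConv_dyadicPoisson_le (p := p) hd hβ1 hp1
  set I : ℝ := ∫ u in Set.Ioi (0 : ℝ), u ^ (α - 1) * Real.exp (-u) * ((1 + u) / u) ^ β with hI
  have hI0 : 0 ≤ I := setIntegral_nonneg measurableSet_Ioi fun u hu => by
    have hu0 : (0 : ℝ) < u := hu
    positivity
  have hΓ := Real.Gamma_pos_of_pos hα0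
  refine ⟨(Real.Gamma α)⁻¹ * C * I, by positivity, fun t n k v => ?_⟩
  have h1 : diagConv d n p (fun i => waveKernel d α t (2 ^ k i)) v =
      ∫ u in Set.Ioi (0 : ℝ), diagConv d n p (fun i => waveIntegrand d α t (2 ^ k i) u) v :=
    diagConv_integral (fun i => integrableOn_waveIntegrand hd hα t (by positivity)) v
  rw [h1]
  have h2 : ∀ u ∈ Set.Ioi (0 : ℝ), ‖diagConv d n p (fun i => waveIntegrand d α t (2 ^ k i) u) v‖ ≤
      (Real.Gamma α)⁻¹ * C * (1 + |t|) ^ β * ‖v‖ *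
        (u ^ (α - 1) * Real.exp (-u) * ((1 + u) / u) ^ β) := by
    intro u hu
    have hu0 : (0 : ℝ) < u := hu
    have hre : 0 < ((u : ℂ) - t * Complex.I).re := by rw [re_wave]; exact hu0
    have e1 : diagConv d n p (fun i => waveIntegrand d α t (2 ^ k i) u) v =
        (gammaWeight α u : ℂ) • diagConv d n p (dyadicPoisson d k ((u : ℂ) - t * Complex.I)) v := by
      rw [← diagConv_smul]
      rfl
    rw [e1, norm_smul, Complex.norm_real, Real.norm_of_nonneg (gammaWeight_nonneg hα0 hu0.le)]
    calc gammaWeight α u * ‖diagConv d n p (dyadicPoisson d k ((u : ℂ) - t * Complex.I)) v‖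
        ≤ gammaWeight α u * (C * ((1 + |t|) ^ β * ((1 + u) / u) ^ β) * ‖v‖) := by
          refine mul_le_mul_of_nonneg_left ((hC _ hre n k v).trans ?_) (gammaWeight_nonneg hα0 hu0.le)
          gcongr
          exact norm_wave_div_rpow_le hu0 hβ0
      _ = _ := by rw [gammaWeight]; ring
  calc _ ≤ ∫ u in Set.Ioi (0 : ℝ), (Real.Gamma α)⁻¹ * C * (1 + |t|) ^ β * ‖v‖ *
        (u ^ (α - 1) * Real.exp (-u) * ((1 + u) / u) ^ β) := by
        refine norm_integral_le_of_norm_le ((integrableOn_gamma_weight hβ0 hβ2).const_mul _) ?_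
        filter_upwards [self_mem_ae_restrict measurableSet_Ioi] with u hu using h2 u hu
    _ = (Real.Gamma α)⁻¹ * C * I * (1 + |t|) ^ β * ‖v‖ := by
        rw [integral_const_mul, ← hI]; ring
    -- The power `β` of `1 + |t| ≥ 1` is raised to `α`.
    _ ≤ _ := by
        gcongr
        linarith [abs_nonneg t]

theorem waveGammaCondition (hd : 1 ≤ d) (hp1 : 1 < p) {α : ℝ} (hα : ((d : ℝ) - 1) / 2 < α) :
    WaveGammaCondition d p α α := by
  have h2 : ∀ k : ℤ, (0 : ℝ) < 2 ^ k := fun k => by positivity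
  refine ⟨fun t k => ?_, ?_⟩
  · rw [waveOperator_eq hd hα t (h2 k)]
    exact isFunctionOfSqrtLaplacian_waveKernel hd hα t (h2 k)
  · obtain ⟨C₁, hC₁⟩ := exists_gammaBound_le (p := p) d
    obtain ⟨C₂, hC₂0, hC₂⟩ := exists_norm_diagConv_waveKernel_le (p := p) hd hp1 hα
    refine ⟨C₁ * C₂, fun t => ?_⟩
    have h := hC₁ (fun k => waveKernel d α t (2 ^ k)) (C₂ * (1 + |t|) ^ α) (by positivity)
      fun n k v => hC₂ t n k v
    have e : ∀ k : ℤ, waveOperator d p α t (2 ^ k) = convLp d p (waveKernel d α t (2 ^ k)) :=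
      fun k => waveOperator_eq hd hα t (h2 k)
    simp only [e]
    rwa [mul_assoc]

end Wave

end

theorem mainTheorem3 (d : ℕ) (hd : 1 ≤ d) (p : ℝ≥0∞) [Fact (1 ≤ p)] (hp1 : 1 < p)
    (hp2 : p < ∞) :
    -- `exp(-zA)`, `Re z > 0`, is everywhere defined and bounded
    (∀ z : ℂ, 0 < z.re →
      IsFunctionOfSqrtLaplacian (expSymbol z) (poissonSemigroup d p z)) ∧
    -- it is an analytic semigroup on the right half plane
    DifferentiableOn ℂ (poissonSemigroup d p) {z : ℂ | 0 < z.re} ∧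
    (∀ z w : ℂ, 0 < z.re → 0 < w.re →
      poissonSemigroup d p (z + w) = (poissonSemigroup d p z).comp (poissonSemigroup d p w)) ∧
    (∀ f : LpSpace d p,
      Tendsto (fun t : ℝ => poissonSemigroup d p (t : ℂ) f) (𝓝[>] 0) (𝓝 f)) ∧
    -- it is generated by `-A`
    (∀ f g : LpSpace d p, (f, g) ∈ (sqrtLaplacian d p).graph ↔
      Tendsto (fun t : ℝ => (t : ℂ)⁻¹ • (f - poissonSemigroup d p (t : ℂ) f))
        (𝓝[>] 0) (𝓝 g)) ∧
    -- it has the Poisson kernel as integral kernel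
    (∀ z : ℂ, 0 < z.re → ∀ f : LpSpace d p,
      (∀ x : EuclideanSpace ℝ (Fin d),
        Integrable (fun y => halfSpacePoissonKernel d z (x - y) * f y) volume) ∧
      poissonSemigroup d p z f =ᵐ[volume]
        fun x => ∫ y, halfSpacePoissonKernel d z (x - y) * f y) ∧
    (∀ α : ℝ, ((d : ℝ) - 1) / 2 < α →
      -- the `γ`-bound of the semigroup
      (∃ C : ℝ, ∀ t θ : ℝ, 0 < t → |θ| < Real.pi / 2 →
        gammaBound {T : LpSpace d p →L[ℂ] LpSpace d p |
            ∃ k : ℤ, T = poissonSemigroup d p (Complex.exp (θ * Complex.I) * t * 2 ^ k)} ≤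
          ENNReal.ofReal (C * (Real.pi / 2 - |θ|) ^ (-α))) ∧
      -- the `γ`-bound of the wave operators
      WaveGammaCondition d p α α ∧
      -- condition (A)
      ∃ β : ℝ, α ≤ β ∧ WaveGammaCondition d p β α) := by
  have : Fact (p ≠ ∞) := ⟨hp2.ne⟩
  refine ⟨fun z hz => isFunctionOfSqrtLaplacian_poissonSemigroup hz, differentiableOn_poissonSemigroup,
    fun z w hz hw => poissonSemigroup_add hz hw, fun f => ?_, fun f g => mem_sqrtLaplacian_graph_iff hd f g,
    fun z hz f => ⟨fun x => integrable_halfSpacePoissonKernel_mul hp1 hz f x, poissonSemigroup_ae hz f⟩,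
    -- Condition (A) holds already with `β = α`.
    fun α hα => ⟨exists_gammaBound_poissonSemigroup_le hd hp1 hα, waveGammaCondition hd hp1 hα, α, le_rfl,
      waveGammaCondition hd hp1 hα⟩⟩
  refine (tendsto_convLp_poissonL1 f).congr' ?_
  filter_upwards [self_mem_nhdsWithin] with t ht
  rw [poissonSemigroup_eq (by simpa using ht)]
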